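/- Let $M$ be a smooth manifold of dimension $n$ and let $p\colon Z\to M$ be a smooth $n$-torus bundle with zero section $s$, i.e. a smooth bundle of Lie groups with fibre $\mathbb R^n/\mathbb Z^n$: it has smooth local trivializations $p^{-1}(U)\cong U\times \mathbb R^n/\mathbb Z^n$ which take $s$ to $0$ and whose transition maps are group automorphisms of $\mathbb R^n/\mathbb Z^n$ on each fibre. Put $T_{Z/M}=\ker(dp)$ and $V=s^*T_{Z/M}$. Let $\nabla$ be the Gauss--Manin connection on $V$, that is, the flat connection for which the local sections of the lattices $H_1(Z_m,\mathbb Z)\subset V_m$ are flat. Let $\mathcal S$ be the sheaf of flat sections of $V$, and $\mathcal S^\vee=\mathrm{Hom}(\mathcal S,\mathbb R)$ the sheaf of flat sections of $V^\vee$. Let $j\colon p^*V\to T_Z$ be the inclusion with image $T_{Z/M}$ given by translation in the fibres, and let $D\colon T_Z\to p^*V$, $\alpha\colon p^*T_M\to T_Z$ be the splitting of $$0\to p^*V\xrightarrow{\ j\ } T_Z\xrightarrow{\ dp\ } p^*T_M\to 0$$ determined by $\nabla$: for a local flat frame $(e_i)$ of $V$ with corresponding fibre coordinates $\xi_i$ on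 $Z$ (defined up to constants), $D=\sum_i p^*e_i\otimes d\xi_i$, and $\alpha$ is the right inverse of $dp$ with image $\ker D$. On $W\oplus W^\vee$ use the pairing $\langle v+f,w+g\rangle=-\tfrac12(f(w)+g(v))$. A generalized almost complex structure on a real vector bundle $W$ is a smooth orthogonal automorphism $\mathcal J$ of $W\oplus W^\vee$ with $\mathcal J^2=-1$. Let $\underline{\mathcal J}$ be a generalized almost complex structure on $V\oplus T_M$ which is adapted, i.e. $\underline{\mathcal J}(V\oplus V^\vee)=T_M\oplus T_M^\vee$, and let $$\mathcal J=F^{-1}\circ p^*\underline{\mathcal J}\circ F,\qquad F=(D,dp)\oplus(j,\alpha)^\vee\colon\ T_Z\oplus T_Z^\vee\ \xrightarrow{\ \cong\ }\ p^*\bigl((V\oplus T_M)\oplus (V\oplus T_M)^\vee\bigr),$$ be the associated semi-flat generalized almost complex structure on $Z$. Let $$[X+\xi,Y+\eta]=[X,Y]+\mathcal L_X\eta-\mathcal L_Y\xi+\tfrac12 d(\iota_Y\xi-\iota_X\eta)$$ be the Courant bracket. Then $\mathcal J$ is integrable (the sheaf of smooth sections of its $+i$-eigenbundle in $(T_Z\oplus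 T_Z^\vee)\otimes\mathbb C$ is closed under the complex bilinear extension of the Courant bracket) if and only if $$\bigl[\underline{\mathcal J}(\mathcal S\oplus\mathcal S^\vee),\underline{\mathcal J}(\mathcal S\oplus\mathcal S^\vee)\bigr]=0,$$ i.e. over every open subset of $M$ all pairwise Courant brackets of sections $\underline{\mathcal J}(a)$, $\underline{\mathcal J}(b)$ of $T_M\oplus T_M^\vee$, with $a,b$ sections of $\mathcal S\oplus\mathcal S^\vee$, vanish. -/

import Mathlib

open Set Bundle Topology
open scoped Manifold ContDiff

noncomputable section

/-! ### Generalized complex linear algebra -/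

section Linear

variable {W : Type*} [AddCommGroup W] [Module ℝ W] [TopologicalSpace W]

/-- The pairing `⟨v + f, w + g⟩ = -(f w + g v) / 2` on `W ⊕ W^∨`. -/
def genPairing (a b : W × (W →L[ℝ] ℝ)) : ℝ :=
  -(1 / 2) * (a.2 b.1 + b.2 a.1)

/-- A generalized complex structure on a real vector space `W`: an endomorphism `J` of `W ⊕ W^∨`
which preserves the pairing and satisfies `J² = -1`. -/
def IsGenComplexLinear (J : (W × (W →L[ℝ] ℝ)) →ₗ[ℝ] (W × (W →L[ℝ] ℝ))) : Prop :=
  (∀ a, J (J a) = -a) ∧ ∀ a b, genPairing (J a) (J b) = genPairing a b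

end Linear

/-! ### The Courant bracket and integrability on a manifold -/

section Courant

variable {E : Type*} [NormedAddCommGroup E] [NormedSpace ℝ E]
  {M : Type*} [TopologicalSpace M] [ChartedSpace E M] [IsManifold 𝓘(ℝ, E) ∞ M]

variable (E) in
/-- The fibre `T_x ⊕ T_x^∨`. -/
abbrev GenTangent (x : M) : Type _ :=
  TangentSpace 𝓘(ℝ, E) x × (TangentSpace 𝓘(ℝ, E) x →L[ℝ] ℝ)

/-- The vector field `X` is smooth on `U`. -/
def SmoothVectorFieldOn (U : Set M) (X : ∀ x : M, TangentSpace 𝓘(ℝ, E) x) : Prop :=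
  ContMDiffOn 𝓘(ℝ, E) 𝓘(ℝ, E).tangent ∞ (fun x => (⟨x, X x⟩ : TangentBundle 𝓘(ℝ, E) M)) U

/-- The 1-form `η` is smooth on `U`, as a section of the bundle `Hom(T_M, ℝ)`. -/
def SmoothOneFormOn (U : Set M) (η : ∀ x : M, TangentSpace 𝓘(ℝ, E) x →L[ℝ] ℝ) : Prop :=
  ContMDiffOn 𝓘(ℝ, E) (𝓘(ℝ, E).prod 𝓘(ℝ, E →L[ℝ] ℝ)) ∞
    (fun x => (⟨x, η x⟩ : TotalSpace (E →L[ℝ] ℝ)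
      (fun x : M => TangentSpace 𝓘(ℝ, E) x →L[ℝ] Trivial M ℝ x))) U

/-- Smooth local sections of `T_M ⊕ T_M^∨` over `U`. -/
def SmoothGenSectionOn (U : Set M) (a : ∀ x : M, GenTangent E x) : Prop :=
  SmoothVectorFieldOn U (fun x => (a x).1) ∧ SmoothOneFormOn U (fun x => (a x).2)

/-- The differential of a real function, as a 1-form. -/
def dFun (f : M → ℝ) (x : M) : TangentSpace 𝓘(ℝ, E) x →L[ℝ] ℝ :=
  mfderiv 𝓘(ℝ, E) 𝓘(ℝ, ℝ) f x

/-- The 1-form `η` written in the chart at `x`. -/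
def oneFormInChart (η : ∀ x : M, TangentSpace 𝓘(ℝ, E) x →L[ℝ] ℝ) (x : M) (u : E) : E →L[ℝ] ℝ :=
  (η ((extChartAt 𝓘(ℝ, E) x).symm u)).comp
    (mfderiv 𝓘(ℝ, E) 𝓘(ℝ, E) (extChartAt 𝓘(ℝ, E) x).symm u)

/-- The contraction `ι_X dη`, computed in the chart at `x`, where
`dη(v, w) = (D_v η)(w) - (D_w η)(v)`. -/
def contractExtDeriv (X : ∀ x : M, TangentSpace 𝓘(ℝ, E) x)
    (η : ∀ x : M, TangentSpace 𝓘(ℝ, E) x →L[ℝ] ℝ) (x : M) : TangentSpace 𝓘(ℝ, E) x →L[ℝ] ℝ :=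
  let A : E →L[ℝ] E →L[ℝ] ℝ := fderiv ℝ (oneFormInChart η x) (extChartAt 𝓘(ℝ, E) x x)
  let φ : TangentSpace 𝓘(ℝ, E) x →L[ℝ] E :=
    mfderiv 𝓘(ℝ, E) 𝓘(ℝ, E) (extChartAt 𝓘(ℝ, E) x) x
  (A (φ (X x)) - A.flip (φ (X x))).comp φ

/-- The Lie derivative of a 1-form, `𝓛_X η = ι_X dη + d(ι_X η)`. -/
def lieDerivOneForm (X : ∀ x : M, TangentSpace 𝓘(ℝ, E) x)
    (η : ∀ x : M, TangentSpace 𝓘(ℝ, E) x →L[ℝ] ℝ) (x : M) : TangentSpace 𝓘(ℝ, E) x →L[ℝ] ℝ :=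
  contractExtDeriv X η x + dFun (fun y => η y (X y)) x

/-- The Courant bracket
`[X + ξ, Y + η] = [X, Y] + 𝓛_X η - 𝓛_Y ξ + (1/2) d(ι_Y ξ - ι_X η)`. -/
def courantBracket (a b : ∀ x : M, GenTangent E x) (x : M) : GenTangent E x :=
  (VectorField.mlieBracket 𝓘(ℝ, E) (fun y => (a y).1) (fun y => (b y).1) x,
    lieDerivOneForm (fun y => (a y).1) (fun y => (b y).2) x
      - lieDerivOneForm (fun y => (b y).1) (fun y => (a y).2) x
      + (1 / 2 : ℝ) • dFun (fun y => (a y).2 (b y).1 - (b y).2 (a y).1) x)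

variable (E M) in
/-- A section `re + i im` of the complexified bundle `(T_M ⊕ T_M^∨) ⊗ ℂ`. -/
structure ComplexGenSection where
  re : ∀ x : M, GenTangent E x
  im : ∀ x : M, GenTangent E x

/-- The complex bilinear extension of the Courant bracket. -/
def complexCourantBracket (a b : ComplexGenSection E M) : ComplexGenSection E M where
  re x := courantBracket a.re b.re x - courantBracket a.im b.im x
  im x := courantBracket a.re b.im x + courantBracket a.im b.re x

/-- The value at `x` of `a = re + i im` lies in the `+i`-eigenspace of (the complex linear
extension of) `J`, that is, `J re + i J im = i (re + i im)`. -/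
def InPlusEigenbundle (J : ∀ x : M, GenTangent E x →ₗ[ℝ] GenTangent E x)
    (a : ComplexGenSection E M) (x : M) : Prop :=
  J x (a.re x) = -a.im x ∧ J x (a.im x) = a.re x

/-- Smooth local sections over `U` of the `+i`-eigenbundle of `J`. -/
def IsSectionOfPlusEigenbundle (J : ∀ x : M, GenTangent E x →ₗ[ℝ] GenTangent E x)
    (U : Set M) (a : ComplexGenSection E M) : Prop :=
  SmoothGenSectionOn U a.re ∧ SmoothGenSectionOn U a.im ∧ ∀ x ∈ U, InPlusEigenbundle J a x

/-- Integrability: the sheaf of smooth sections of the `+i`-eigenbundle is closed under the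
Courant bracket (the bracket of smooth sections is automatically smooth). -/
def IsIntegrableGen (J : ∀ x : M, GenTangent E x →ₗ[ℝ] GenTangent E x) : Prop :=
  ∀ U : Set M, IsOpen U → ∀ a b : ComplexGenSection E M,
    IsSectionOfPlusEigenbundle J U a → IsSectionOfPlusEigenbundle J U b →
      ∀ x ∈ U, InPlusEigenbundle J (complexCourantBracket a b) x

end Courant

/-! ### Torus bundles with zero section -/

/-- The standard torus `ℝⁿ / ℤⁿ`. -/
abbrev StdTorus (n : ℕ) : Type := Fin n → UnitAddCircle

/-- The projection `ℝⁿ → ℝⁿ / ℤⁿ`. -/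
def torusMk {n : ℕ} (ξ : Fin n → ℝ) : StdTorus n := fun i => (ξ i : UnitAddCircle)

/-- Some point of `ℝⁿ` above a point of the torus. -/
def torusLift {n : ℕ} (t : StdTorus n) : Fin n → ℝ := fun i => Quotient.out (t i)

/-- A smooth `n`-torus bundle `Z → M` with zero section, i.e. a smooth bundle of Lie groups modelled
on `ℝⁿ / ℤⁿ`: its local trivializations `p⁻¹(U) ≅ U × ℝⁿ/ℤⁿ` are diffeomorphisms (which is
expressed through the smooth covering `U × ℝⁿ → U × ℝⁿ/ℤⁿ`), they take the zero section to `0`, and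
the transition maps are group automorphisms on each fibre. -/
structure TorusBundle (n : ℕ) (E : Type*) [NormedAddCommGroup E] [NormedSpace ℝ E]
    (F : Type*) [NormedAddCommGroup F] [NormedSpace ℝ F]
    (M : Type*) [TopologicalSpace M] [ChartedSpace E M]
    (Z : Type*) [TopologicalSpace Z] [ChartedSpace F Z] where
  /-- the projection `p : Z → M` -/
  proj : Z → M
  /-- the zero section `s : M → Z` -/
  zero : M → Z
  contMDiff_proj : ContMDiff 𝓘(ℝ, F) 𝓘(ℝ, E) ∞ proj
  contMDiff_zero : ContMDiff 𝓘(ℝ, E) 𝓘(ℝ, F) ∞ zero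
  proj_zero : ∀ m, proj (zero m) = m
  atlas : Set (Trivialization (StdTorus n) proj)
  exists_mem_atlas : ∀ m : M, ∃ e ∈ atlas, m ∈ e.baseSet
  isLocalDiffeomorphOn : ∀ e ∈ atlas,
    IsLocalDiffeomorphOn (𝓘(ℝ, E).prod 𝓘(ℝ, Fin n → ℝ)) 𝓘(ℝ, F) ∞
      (fun x : M × (Fin n → ℝ) => e.toOpenPartialHomeomorph.symm (x.1, torusMk x.2))
      (e.baseSet ×ˢ univ)
  triv_zero : ∀ e ∈ atlas, ∀ m ∈ e.baseSet, e (zero m) = (m, 0)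
  transition_add : ∀ e ∈ atlas, ∀ e' ∈ atlas, ∀ m ∈ e.baseSet ∩ e'.baseSet, ∀ t t' : StdTorus n,
    (e' (e.toOpenPartialHomeomorph.symm (m, t + t'))).2 =
      (e' (e.toOpenPartialHomeomorph.symm (m, t))).2 +
        (e' (e.toOpenPartialHomeomorph.symm (m, t'))).2

namespace TorusBundle

variable {n : ℕ} {E : Type*} [NormedAddCommGroup E] [NormedSpace ℝ E]
  {F : Type*} [NormedAddCommGroup F] [NormedSpace ℝ F]
  {M : Type*} [TopologicalSpace M] [ChartedSpace E M]
  {Z : Type*} [TopologicalSpace Z] [ChartedSpace F Z]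
  (B : TorusBundle n E F M Z)

/-- A local trivialization around `m`. -/
def trivAt (m : M) : Trivialization (StdTorus n) B.proj := (B.exists_mem_atlas m).choose

lemma trivAt_mem_atlas (m : M) : B.trivAt m ∈ B.atlas := (B.exists_mem_atlas m).choose_spec.1

lemma mem_baseSet_trivAt (m : M) : m ∈ (B.trivAt m).baseSet :=
  (B.exists_mem_atlas m).choose_spec.2

/-- The parametrization `(m, ξ) ↦ e⁻¹(m, ξ mod ℤⁿ)` of `p⁻¹(U)` by `U × ℝⁿ` given by a local
trivialization. -/
def param (e : Trivialization (StdTorus n) B.proj) (x : M × (Fin n → ℝ)) : Z :=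
  e.toOpenPartialHomeomorph.symm (x.1, torusMk x.2)

/-- The differential of `param` at `(m, ξ)`. -/
def dParam (e : Trivialization (StdTorus n) B.proj) (m : M) (ξ : Fin n → ℝ) :
    TangentSpace 𝓘(ℝ, E) m × (Fin n → ℝ) →L[ℝ] TangentSpace 𝓘(ℝ, F) (B.param e (m, ξ)) :=
  mfderiv (𝓘(ℝ, E).prod 𝓘(ℝ, Fin n → ℝ)) 𝓘(ℝ, F) (B.param e) (m, ξ)

/-- The vertical tangent space `(T_{Z/M})_z = ker dp_z`. -/
abbrev vert (z : Z) : Submodule ℝ (TangentSpace 𝓘(ℝ, F) z) :=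
  LinearMap.ker (mfderiv 𝓘(ℝ, F) 𝓘(ℝ, E) B.proj z).toLinearMap

/-- The fibre at `m` of `V = s^* T_{Z/M}`. -/
abbrev V (m : M) : Submodule ℝ (TangentSpace 𝓘(ℝ, F) (B.zero m)) := B.vert (B.zero m)

lemma param_zero {e : Trivialization (StdTorus n) B.proj} (he : e ∈ B.atlas) {m : M}
    (hm : m ∈ e.baseSet) : B.param e (m, 0) = B.zero m := by
  have h1 : B.zero m ∈ e.source := by
    rw [e.mem_source, B.proj_zero]; exact hm
  have h2 : e.toOpenPartialHomeomorph (B.zero m) = (m, 0) := B.triv_zero e he m hm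
  have h3 : (torusMk (0 : Fin n → ℝ)) = 0 := by
    funext i; simp [torusMk]
  unfold param
  simp only [h3]
  rw [← h2]
  exact e.toOpenPartialHomeomorph.left_inv h1

lemma proj_param {e : Trivialization (StdTorus n) B.proj} {m : M}
    (hm : m ∈ e.baseSet) (ξ : Fin n → ℝ) : B.proj (B.param e (m, ξ)) = m :=
  e.proj_symm_apply' hm

lemma mfderiv_proj_dParam {e : Trivialization (StdTorus n) B.proj} (he : e ∈ B.atlas) {m : M}
    (hm : m ∈ e.baseSet) (ξ η : Fin n → ℝ) :
    mfderiv 𝓘(ℝ, F) 𝓘(ℝ, E) B.proj (B.param e (m, ξ)) (B.dParam e m ξ (0, η)) = 0 := by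
  have hΦ : MDifferentiableAt (𝓘(ℝ, E).prod 𝓘(ℝ, Fin n → ℝ)) 𝓘(ℝ, F) (B.param e) (m, ξ) :=
    (B.isLocalDiffeomorphOn e he ⟨(m, ξ), hm, mem_univ _⟩).mdifferentiableAt (by simp)
  have hp : MDifferentiableAt 𝓘(ℝ, F) 𝓘(ℝ, E) B.proj (B.param e (m, ξ)) :=
    B.contMDiff_proj.mdifferentiableAt (by simp)
  have hc := mfderiv_comp (m, ξ) hp hΦ
  have he' : (B.proj ∘ B.param e) =ᶠ[𝓝 (m, ξ)] Prod.fst := by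
    filter_upwards [(e.open_baseSet.prod isOpen_univ).mem_nhds
      (show (m, ξ) ∈ e.baseSet ×ˢ univ from ⟨hm, mem_univ _⟩)] with x hx
    exact B.proj_param hx.1 x.2
  rw [he'.mfderiv_eq, mfderiv_fst] at hc
  exact (DFunLike.congr_fun hc ((0, η) : E × (Fin n → ℝ))).symm

/-- The frame of `V` at `m` given by the trivialization around `m`: it sends the standard basis of
`ℝⁿ` to the tangent vectors `∂/∂ξ_i` of the fibre at the origin. The image of `ℤⁿ` is the lattice
`Λ_m = H₁(Z_m, ℤ)` in `V_m`. -/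
def frame (m : M) : (Fin n → ℝ) →L[ℝ] B.V m :=
  (((B.dParam (B.trivAt m) m 0).comp (ContinuousLinearMap.inr ℝ _ _) :
    (Fin n → ℝ) →L[ℝ] TangentSpace 𝓘(ℝ, F) (B.zero m))).codRestrict (B.V m) (fun η => by
      have h := B.mfderiv_proj_dParam (B.trivAt_mem_atlas m) (B.mem_baseSet_trivAt m) 0 η
      rw [B.param_zero (B.trivAt_mem_atlas m) (B.mem_baseSet_trivAt m)] at h
      exact h)

variable [IsManifold 𝓘(ℝ, E) ∞ M] [IsManifold 𝓘(ℝ, F) ∞ Z]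

/-- The section `σ` of `V` is smooth on `U` (as a map to `T_Z`, of which `V` is the pullback of a
subbundle along `s`). -/
def SmoothVOn (U : Set M) (σ : ∀ m, B.V m) : Prop :=
  ContMDiffOn 𝓘(ℝ, E) 𝓘(ℝ, F).tangent ∞
    (fun m => (⟨B.zero m, (σ m : TangentSpace 𝓘(ℝ, F) (B.zero m))⟩ : TangentBundle 𝓘(ℝ, F) Z)) U

/-- The section `θ` of `V^∨` is smooth on `U`: its pairing with every smooth local section of `V` is
a smooth function. -/
def SmoothVDualOn (U : Set M) (θ : ∀ m, B.V m →L[ℝ] ℝ) : Prop :=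
  ∀ U' ⊆ U, IsOpen U' → ∀ σ : ∀ m, B.V m, B.SmoothVOn U' σ →
    ContMDiffOn 𝓘(ℝ, E) 𝓘(ℝ, ℝ) ∞ (fun m => θ m (σ m)) U'

/-- The components of `u ∈ V_m` in the frame given by the trivialization `e` over a neighbourhood
of `m`. -/
def coord (e : Trivialization (StdTorus n) B.proj) (m : M) (u : B.V m) : Fin n → ℝ :=
  ((B.dParam e m 0).inverse (u : TangentSpace 𝓘(ℝ, F) (B.zero m))).2

/-- The Gauss–Manin connection `∇` on `V`. The frames of `V` over open sets `U` given by the local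
trivializations are `ℤ`-bases of the local system `H₁(Z_m, ℤ)` of lattices (they are related by
locally constant matrices in `GL(n, ℤ)`), and `∇` is `1 ⊗ d` in such a frame. -/
def gaussManin (σ : ∀ m, B.V m) (m : M) : TangentSpace 𝓘(ℝ, E) m →L[ℝ] B.V m :=
  (B.frame m).comp
    (mfderiv 𝓘(ℝ, E) 𝓘(ℝ, Fin n → ℝ) (fun m' => B.coord (B.trivAt m) m' (σ m')) m :
      TangentSpace 𝓘(ℝ, E) m →L[ℝ] (Fin n → ℝ))

/-- The sheaf `𝓢` of flat sections: smooth sections `σ` of `V` over `U` with `∇σ = 0`. -/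
def IsFlatOn (U : Set M) (σ : ∀ m, B.V m) : Prop :=
  B.SmoothVOn U σ ∧ ∀ m ∈ U, B.gaussManin σ m = 0

/-- The dual local system `𝓢^∨ = Hom(𝓢, ℝ)`: sections `θ` of `V^∨` over `U` whose pairing with every
local flat section of `V` is locally constant. -/
def IsFlatDualOn (U : Set M) (θ : ∀ m, B.V m →L[ℝ] ℝ) : Prop :=
  ∀ U' ⊆ U, IsOpen U' → ∀ σ : ∀ m, B.V m, B.IsFlatOn U' σ →
    ∀ m ∈ U', ∀ᶠ m' in 𝓝 m, θ m' (σ m') = θ m (σ m)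

/-! #### The splitting of the tangent sequence of `Z` -/

/-- The vertical coordinates `ξ` of a point `z`, in the trivialization around `p z`. -/
def vertCoord (z : Z) : Fin n → ℝ := torusLift (B.trivAt (B.proj z) z).2

/-- The differential at `z` of the parametrization by `U × ℝⁿ` around `p z`. -/
def dParamAt (z : Z) :
    TangentSpace 𝓘(ℝ, E) (B.proj z) × (Fin n → ℝ) →L[ℝ] TangentSpace 𝓘(ℝ, F) z :=
  B.dParam (B.trivAt (B.proj z)) (B.proj z) (B.vertCoord z)

/-- The map `j : p^* V → T_Z`, i.e. the identification of `V_{p z}` with the vertical tangent space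
at `z` by translation in the fibre. -/
def incl (z : Z) : B.V (B.proj z) →L[ℝ] TangentSpace 𝓘(ℝ, F) z :=
  ((B.dParamAt z).comp (ContinuousLinearMap.inr ℝ _ _)).comp (B.frame (B.proj z)).inverse

/-- The splitting `D : T_Z → p^* V` of the tangent sequence given by the Gauss–Manin connection: the
map `D = ∑ f_i ⊗ dξ_i`, where `f_i` is a flat frame of `V` and `ξ_i` are the corresponding vertical
coordinates. -/
def vertProj (z : Z) : TangentSpace 𝓘(ℝ, F) z →L[ℝ] B.V (B.proj z) :=
  (B.frame (B.proj z)).comp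
    ((ContinuousLinearMap.snd ℝ _ _).comp (B.dParamAt z).inverse)

/-- The horizontal lift `α : p^* T_M → T_Z`, the splitting of `dp` with image `ker D`:
`α(∂/∂x_i) = ∂/∂y_i` in the coordinates `(y_i, ξ_i)` with `y_i = x_i ∘ p`. -/
def horLift (z : Z) : TangentSpace 𝓘(ℝ, E) (B.proj z) →L[ℝ] TangentSpace 𝓘(ℝ, F) z :=
  (B.dParamAt z).comp (ContinuousLinearMap.inl ℝ _ _)

/-- The fibre at `m` of the vector bundle `V ⊕ T_M`. -/
abbrev VT (m : M) : Type _ := B.V m × TangentSpace 𝓘(ℝ, E) m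

/-- The fibre at `m` of `(V ⊕ T_M) ⊕ (V ⊕ T_M)^∨`. -/
abbrev GenVT (m : M) : Type _ := B.VT m × (B.VT m →L[ℝ] ℝ)

/-- `(j, α) : p^* V ⊕ p^* T_M → T_Z`. -/
def split (z : Z) : B.VT (B.proj z) →L[ℝ] TangentSpace 𝓘(ℝ, F) z :=
  (B.incl z).coprod (B.horLift z)

/-- `(D, dp) : T_Z → p^* V ⊕ p^* T_M`. -/
def unsplit (z : Z) : TangentSpace 𝓘(ℝ, F) z →L[ℝ] B.VT (B.proj z) :=
  (B.vertProj z).prod (mfderiv 𝓘(ℝ, F) 𝓘(ℝ, E) B.proj z)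

/-- The isomorphism `F = (D, dp) ⊕ (j, α)^∨` from `T_Z ⊕ T_Z^∨` to
`p^* ((V ⊕ T_M) ⊕ (V ⊕ T_M)^∨)`. -/
def toBase (z : Z) : GenTangent F z →ₗ[ℝ] B.GenVT (B.proj z) where
  toFun a := (B.unsplit z a.1, a.2.comp (B.split z))
  map_add' a b := by ext <;> simp
  map_smul' c a := by ext <;> simp

/-- The inverse `F⁻¹ = (j, α) ⊕ (D, dp)^∨`. -/
def fromBase (z : Z) : B.GenVT (B.proj z) →ₗ[ℝ] GenTangent F z where
  toFun a := (B.split z a.1, a.2.comp (B.unsplit z))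
  map_add' a b := by ext <;> simp
  map_smul' c a := by ext <;> simp

/-! #### Semi-flat generalized almost complex structures -/

/-- The subspace `V ⊕ V^∨` of `(V ⊕ T_M) ⊕ (V ⊕ T_M)^∨` at `m`. -/
def genV (m : M) : Submodule ℝ (B.GenVT m) where
  carrier := {a | a.1.2 = 0 ∧ ∀ v, a.2 (0, v) = 0}
  add_mem' ha hb := by simp_all
  zero_mem' := by simp
  smul_mem' c a ha := by simp_all

/-- The subspace `T_M ⊕ T_M^∨` of `(V ⊕ T_M) ⊕ (V ⊕ T_M)^∨` at `m`. -/
def genT (m : M) : Submodule ℝ (B.GenVT m) where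
  carrier := {a | a.1.1 = 0 ∧ ∀ u, a.2 (u, 0) = 0}
  add_mem' ha hb := by simp_all
  zero_mem' := by simp
  smul_mem' c a ha := by simp_all

/-- The inclusion `V ⊕ V^∨ → (V ⊕ T_M) ⊕ (V ⊕ T_M)^∨`. -/
def ofV (m : M) (u : B.V m) (θ : B.V m →L[ℝ] ℝ) : B.GenVT m :=
  ((u, 0), θ.comp (ContinuousLinearMap.fst ℝ _ _))

/-- The projection `(V ⊕ T_M) ⊕ (V ⊕ T_M)^∨ → T_M ⊕ T_M^∨`. -/
def toT (m : M) (a : B.GenVT m) : GenTangent E m :=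
  (a.1.2, a.2.comp (ContinuousLinearMap.inr ℝ _ _))

/-- Smooth local sections over `U` of `(V ⊕ T_M) ⊕ (V ⊕ T_M)^∨`. -/
def SmoothGenVTOn (U : Set M) (a : ∀ m, B.GenVT m) : Prop :=
  B.SmoothVOn U (fun m => (a m).1.1) ∧
  B.SmoothVDualOn U (fun m => (a m).2.comp (ContinuousLinearMap.inl ℝ _ _)) ∧
  SmoothGenSectionOn U (fun m => B.toT m (a m))

/-- An adapted generalized almost complex structure on the vector bundle `V ⊕ T_M`: a smooth bundle
automorphism (i.e. smooth sections are taken to smooth sections) `J` of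
`(V ⊕ T_M) ⊕ (V ⊕ T_M)^∨` which is orthogonal, has square `-1`, and satisfies
`J (V ⊕ V^∨) = T_M ⊕ T_M^∨`. -/
structure AdaptedGACS where
  J : ∀ m, B.GenVT m →ₗ[ℝ] B.GenVT m
  smooth : ∀ U : Set M, IsOpen U → ∀ a : ∀ m, B.GenVT m,
    B.SmoothGenVTOn U a → B.SmoothGenVTOn U (fun m => J m (a m))
  isGenComplex : ∀ m, IsGenComplexLinear (J m)
  adapted : ∀ m, (B.genV m).map (J m) = B.genT m

variable {B}

/-- The semi-flat generalized almost complex structure `F⁻¹ ∘ p^* J ∘ F` on `Z`. -/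
def AdaptedGACS.semiFlat (J : B.AdaptedGACS) (z : Z) : GenTangent F z →ₗ[ℝ] GenTangent F z :=
  B.fromBase z ∘ₗ J.J (B.proj z) ∘ₗ B.toBase z

/-- The section `J (σ + θ)` of `T_M ⊕ T_M^∨`, for a section `σ + θ` of `V ⊕ V^∨`. -/
def AdaptedGACS.image (J : B.AdaptedGACS) (σ : ∀ m, B.V m) (θ : ∀ m, B.V m →L[ℝ] ℝ) (m : M) :
    GenTangent E m :=
  B.toT m (J.J m (B.ofV m (σ m) (θ m)))

/-- `[J (𝓢 ⊕ 𝓢^∨), J (𝓢 ⊕ 𝓢^∨)] = 0`: over every open set, all Courant brackets of images under `J`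
of sections of `𝓢 ⊕ 𝓢^∨` vanish. -/
def AdaptedGACS.BracketsVanish (J : B.AdaptedGACS) : Prop :=
  ∀ U : Set M, IsOpen U →
    ∀ (σ σ' : ∀ m, B.V m) (θ θ' : ∀ m, B.V m →L[ℝ] ℝ),
      B.IsFlatOn U σ → B.IsFlatDualOn U θ → B.IsFlatOn U σ' → B.IsFlatDualOn U θ' →
        ∀ m ∈ U, courantBracket (J.image σ θ) (J.image σ' θ') m = 0

end TorusBundle

end

/-!
In a local trivialization and a chart of `M`, a semi-flat structure `J` becomes a family of
structures on `E × ℝⁿ` which depends only on the base coordinate `y`. With `V ⊕ V^∨` framed by flat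
sections, `J` sends a constant `d` to `k y d`, where `k y` is an isomorphism onto `E ⊕ E^∨`. The
sections of the `+i`-eigenbundle `L` are the `J v + i v` for sections `v` of the complexification of
`V ⊕ V^∨`. Since `L` is isotropic, the terms of a Courant bracket of two of them which differentiate
`v` lie in `L`, so only constant `v` matter. Nothing depends on the fibre coordinates and `E ⊕ E^∨`
is orthogonal to `V ⊕ V^∨`, hence `[k d, d'] = 0 = [d, d']` and
`[J d + i d, J d' + i d'] = [k d, k d']`. The right-hand side is a section of `E ⊕ E^∨`, which meets
`L` only in `0`.
-/

noncomputable section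

/-! ### Pullback of generalized sections along local diffeomorphisms -/

section LocalDiffeomorphisms

variable {EX : Type*} [NormedAddCommGroup EX] [NormedSpace ℝ EX] {HX : Type*} [TopologicalSpace HX]
  {IX : ModelWithCorners ℝ EX HX} {X : Type*} [TopologicalSpace X] [ChartedSpace HX X]
  {EY : Type*} [NormedAddCommGroup EY] [NormedSpace ℝ EY] {HY : Type*} [TopologicalSpace HY]
  {IY : ModelWithCorners ℝ EY HY} {Y : Type*} [TopologicalSpace Y] [ChartedSpace HY Y]
  {k : ℕ∞ω} {f : X → Y} {x : X}

lemma eventually_isLocalDiffeomorphAt (hf : IsLocalDiffeomorphAt IX IY k f x) :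
    ∀ᶠ y in 𝓝 x, IsLocalDiffeomorphAt IX IY k f y := by
  obtain ⟨Φ, hx, hfΦ⟩ := hf
  filter_upwards [Φ.open_source.mem_nhds hx] with y hy using ⟨Φ, hy, hfΦ⟩

lemma isInvertible_mfderiv (hf : IsLocalDiffeomorphAt IX IY k f x) (hk : k ≠ 0) :
    (mfderiv IX IY f x).IsInvertible :=
  ⟨hf.mfderivToContinuousLinearEquiv hk, rfl⟩

lemma localInverse_apply_self (hf : IsLocalDiffeomorphAt IX IY k f x) :
    hf.localInverse (f x) = x :=
  hf.localInverse_left_inv hf.localInverse_mem_target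

lemma tendsto_localInverse (hf : IsLocalDiffeomorphAt IX IY k f x) :
    Filter.Tendsto hf.localInverse (𝓝 (f x)) (𝓝 x) := by
  have hcont := hf.localInverse_contMDiffAt.continuousAt.tendsto
  rwa [localInverse_apply_self] at hcont

lemma contMDiffAt_mfderiv_vectorField [IsManifold IX ∞ X] [IsManifold IY ∞ Y]
    {EW : Type*} [NormedAddCommGroup EW] [NormedSpace ℝ EW] {HW : Type*} [TopologicalSpace HW]
    {IW : ModelWithCorners ℝ EW HW} {W : Type*} [TopologicalSpace W] [ChartedSpace HW W]
    [IsManifold IW 1 W]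
    {g : W → X} {w : W} (hf : ContMDiffAt IX IY ∞ f (g w)) {v : ∀ w, TangentSpace IX (g w)}
    (hv : ContMDiffAt IW IX.tangent ∞ (fun w => (⟨g w, v w⟩ : TangentBundle IX X)) w) :
    ContMDiffAt IW IY.tangent ∞
      (fun w => (⟨f (g w), mfderiv IX IY f (g w) (v w)⟩ : TangentBundle IY Y)) w := by
  have hg : ContMDiffAt IW IX ∞ g w := (contMDiff_proj _).contMDiffAt.comp w hv
  have huncurry : ContMDiffAt (IW.prod IX) IY ∞ (Function.uncurry fun (_ : W) x => f x)
      (w, g w) :=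
    ContMDiffAt.comp (w, g w) (g := f) hf contMDiffAt_snd
  exact ContMDiffAt.clm_apply_of_inCoordinates
    (ContMDiffAt.mfderiv (fun _ => f) g huncurry hg (m := ∞) (by simp)) hv (hf.comp w hg)

end LocalDiffeomorphisms

section Charts

variable {F : Type*} [NormedAddCommGroup F] [NormedSpace ℝ F]
  {N : Type*} [TopologicalSpace N] [ChartedSpace F N] [IsManifold 𝓘(ℝ, F) ∞ N]

lemma isLocalDiffeomorphAt_extChartAt_symm {z : N} {u : F}
    (hu : u ∈ (extChartAt 𝓘(ℝ, F) z).target) :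
    IsLocalDiffeomorphAt 𝓘(ℝ, F) 𝓘(ℝ, F) ∞ (extChartAt 𝓘(ℝ, F) z).symm u :=
  ⟨{ toPartialEquiv := (extChartAt 𝓘(ℝ, F) z).symm
     open_source := isOpen_extChartAt_target z
     open_target := isOpen_extChartAt_source z
     contMDiffOn_toFun := contMDiffOn_extChartAt_symm z
     contMDiffOn_invFun := by
      simpa [extChartAt_source] using contMDiffOn_extChartAt (I := 𝓘(ℝ, F)) (x := z) (n := ∞) },
    hu, fun _ _ => rfl⟩

lemma isLocalDiffeomorphAt_extChartAt {z y : N} (hy : y ∈ (extChartAt 𝓘(ℝ, F) z).source) :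
    IsLocalDiffeomorphAt 𝓘(ℝ, F) 𝓘(ℝ, F) ∞ (extChartAt 𝓘(ℝ, F) z) y :=
  ⟨{ toPartialEquiv := extChartAt 𝓘(ℝ, F) z
     open_source := isOpen_extChartAt_source z
     open_target := isOpen_extChartAt_target z
     contMDiffOn_toFun := by
      simpa only [extChartAt_source] using
        contMDiffOn_extChartAt (I := 𝓘(ℝ, F)) (x := z) (n := ∞)
     contMDiffOn_invFun := contMDiffOn_extChartAt_symm z },
    hy, fun _ _ => rfl⟩

end Charts

lemma contMDiffAt_clm_of_apply {G : Type*} [NormedAddCommGroup G] [NormedSpace ℝ G]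
    [FiniteDimensional ℝ G] {F : Type*} [NormedAddCommGroup F] [NormedSpace ℝ F]
    {N : Type*} [TopologicalSpace N] [ChartedSpace F N]
    {R : Type*} [NormedAddCommGroup R] [NormedSpace ℝ R] {f : N → G →L[ℝ] R} {x : N} {k : ℕ∞ω}
    (h : ∀ w, ContMDiffAt 𝓘(ℝ, F) 𝓘(ℝ, R) k (fun y => f y w) x) :
    ContMDiffAt 𝓘(ℝ, F) 𝓘(ℝ, G →L[ℝ] R) k f x := by
  let b : G ≃L[ℝ] Fin (Module.finrank ℝ G) → ℝ := ContinuousLinearEquiv.ofFinrankEq (by simp)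
  let toPi : (G →L[ℝ] R) ≃L[ℝ] (Fin (Module.finrank ℝ G) → R) :=
    (b.arrowCongr (1 : R ≃L[ℝ] R)).trans (ContinuousLinearEquiv.piRing (𝕜 := ℝ) (E := R) _)
  have hpi : ContMDiffAt 𝓘(ℝ, F) 𝓘(ℝ, Fin (Module.finrank ℝ G) → R) k (fun y => toPi (f y)) x :=
    contMDiffAt_pi_space.2 fun i => h _
  simpa only [Function.comp_def, ContinuousLinearEquiv.symm_apply_apply] using
    toPi.symm.contDiff.contMDiff.contMDiffAt.comp x hpi

section SmoothSections

variable {F : Type*} [NormedAddCommGroup F] [NormedSpace ℝ F]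
  {N : Type*} [TopologicalSpace N] [ChartedSpace F N] [IsManifold 𝓘(ℝ, F) ∞ N]

/-- Smoothness at a point of a section of `T_N ⊕ T_N^∨`, the pointwise form of
`SmoothGenSectionOn`. -/
def SmoothGenSectionAt (a : ∀ x : N, GenTangent F x) (x : N) : Prop :=
  ContMDiffAt 𝓘(ℝ, F) 𝓘(ℝ, F).tangent ∞
    (fun x => (⟨x, (a x).1⟩ : TangentBundle 𝓘(ℝ, F) N)) x ∧
  ContMDiffAt 𝓘(ℝ, F) (𝓘(ℝ, F).prod 𝓘(ℝ, F →L[ℝ] ℝ)) ∞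
    (fun x => (⟨x, (a x).2⟩ : TotalSpace (F →L[ℝ] ℝ)
      (fun x : N => TangentSpace 𝓘(ℝ, F) x →L[ℝ] Trivial N ℝ x))) x

lemma smoothGenSectionOn_iff {U : Set N} (hU : IsOpen U) {a : ∀ x : N, GenTangent F x} :
    SmoothGenSectionOn U a ↔ ∀ x ∈ U, SmoothGenSectionAt a x :=
  ⟨fun h _ hx => ⟨h.1.contMDiffAt (hU.mem_nhds hx), h.2.contMDiffAt (hU.mem_nhds hx)⟩,
    fun h => ⟨fun x hx => (h x hx).1.contMDiffWithinAt, fun x hx => (h x hx).2.contMDiffWithinAt⟩⟩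

lemma SmoothGenSectionAt.congr {a b : ∀ x : N, GenTangent F x} {x : N}
    (ha : SmoothGenSectionAt a x) (hab : ∀ᶠ y in 𝓝 x, b y = a y) : SmoothGenSectionAt b x :=
  ⟨ha.1.congr_of_eventuallyEq (hab.mono fun y hy => by simp only [hy]),
    ha.2.congr_of_eventuallyEq (hab.mono fun y hy => by simp only [hy])⟩

lemma SmoothGenSectionAt.contMDiffAt_apply {E : Type*} [NormedAddCommGroup E] [NormedSpace ℝ E]
    {P : Type*} [TopologicalSpace P] [ChartedSpace E P] {f : P → N} {x : P}
    {a : ∀ y : N, GenTangent F y} (ha : SmoothGenSectionAt a (f x))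
    {v : ∀ x, TangentSpace 𝓘(ℝ, F) (f x)}
    (hv : ContMDiffAt 𝓘(ℝ, E) 𝓘(ℝ, F).tangent ∞
      (fun x => (⟨f x, v x⟩ : TangentBundle 𝓘(ℝ, F) N)) x) :
    ContMDiffAt 𝓘(ℝ, E) 𝓘(ℝ, ℝ) ∞ (fun x => (a (f x)).2 (v x)) x :=
  have hf : ContMDiffAt 𝓘(ℝ, E) 𝓘(ℝ, F) ∞ f x := (contMDiffAt_totalSpace.1 hv).1
  have happly : ContMDiffAt 𝓘(ℝ, E) (𝓘(ℝ, F).prod 𝓘(ℝ, ℝ)) ∞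
      (fun x => TotalSpace.mk' ℝ (E := Trivial N ℝ) (f x) ((a (f x)).2 (v x))) x :=
    ContMDiffAt.clm_bundle_apply (F₁ := F) (F₂ := ℝ)
      (E₁ := fun x : N => TangentSpace 𝓘(ℝ, F) x) (E₂ := Trivial N ℝ) (ha.2.comp x hf) hv
  (contMDiffAt_totalSpace.1 happly).2

lemma contMDiffAt_oneForm_of_apply [FiniteDimensional ℝ F]
    {η : ∀ x : N, TangentSpace 𝓘(ℝ, F) x →L[ℝ] ℝ} {x : N}
    (h : ∀ v : ∀ x : N, TangentSpace 𝓘(ℝ, F) x,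
      ContMDiffAt 𝓘(ℝ, F) 𝓘(ℝ, F).tangent ∞ (fun y => (⟨y, v y⟩ : TangentBundle 𝓘(ℝ, F) N)) x →
        ContMDiffAt 𝓘(ℝ, F) 𝓘(ℝ, ℝ) ∞ (fun y => η y (v y)) x) :
    ContMDiffAt 𝓘(ℝ, F) (𝓘(ℝ, F).prod 𝓘(ℝ, F →L[ℝ] ℝ)) ∞
      (fun x => (⟨x, η x⟩ : TotalSpace (F →L[ℝ] ℝ)
        (fun x : N => TangentSpace 𝓘(ℝ, F) x →L[ℝ] Trivial N ℝ x))) x := by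
  refine (contMDiffAt_hom_bundle _).2 ⟨contMDiffAt_id, contMDiffAt_clm_of_apply fun w => ?_⟩
  let e := trivializationAt F (TangentSpace 𝓘(ℝ, F) : N → Type _) x
  have hx : x ∈ e.baseSet := mem_baseSet_trivializationAt _ _ _
  have hconst : ContMDiffAt 𝓘(ℝ, F) 𝓘(ℝ, F).tangent ∞
      (fun y => (⟨y, e.symm y w⟩ : TangentBundle 𝓘(ℝ, F) N)) x := by
    have hsymm : ContMDiffAt (𝓘(ℝ, F).prod 𝓘(ℝ, F)) (𝓘(ℝ, F).prod 𝓘(ℝ, F)) ∞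
        e.toOpenPartialHomeomorph.symm (x, w) :=
      e.contMDiffOn_symm.contMDiffAt (e.open_target.mem_nhds (e.mem_target.2 hx))
    refine (hsymm.comp x (contMDiffAt_id.prodMk (contMDiffAt_const (I := 𝓘(ℝ, F))
      (c := w)))).congr_of_eventuallyEq ?_
    filter_upwards [e.open_baseSet.mem_nhds hx] with y hy using e.mk_symm hy w
  refine (h _ hconst).congr_of_eventuallyEq ?_
  filter_upwards [e.open_baseSet.mem_nhds hx] with y hy
  rw [ContinuousLinearMap.inCoordinates_eq hy (by simp)]
  simp only [Trivial.fiberBundle_trivializationAt', Trivial.continuousLinearEquivAt_trivialization,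
    ContinuousLinearEquiv.coe_refl, ContinuousLinearMap.id_comp, ContinuousLinearMap.comp_apply,
    ContinuousLinearEquiv.coe_coe, Trivialization.continuousLinearEquivAt_symm_apply]
  rfl

end SmoothSections

section GenMap

variable {W W' : Type*} [AddCommGroup W] [Module ℝ W] [TopologicalSpace W]
  [AddCommGroup W'] [Module ℝ W'] [TopologicalSpace W']

/-- The map `S ⊕ T^∨ : W ⊕ W^∨ → W' ⊕ W'^∨`. It is the isomorphism induced by `S` when `T` is the
inverse of `S`. -/
def genMap (S : W →L[ℝ] W') (T : W' →L[ℝ] W) : W × (W →L[ℝ] ℝ) →ₗ[ℝ] W' × (W' →L[ℝ] ℝ) where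
  toFun a := (S a.1, a.2.comp T)
  map_add' _ _ := Prod.ext (map_add S _ _) rfl
  map_smul' _ _ := Prod.ext (map_smul S _ _) rfl

variable {S : W →L[ℝ] W'} {T : W' →L[ℝ] W}

lemma genMap_genMap_cancel (hTS : ∀ w, T (S w) = w) (a : W × (W →L[ℝ] ℝ)) :
    genMap T S (genMap S T a) = a :=
  Prod.ext (hTS a.1) (ContinuousLinearMap.ext fun w => congrArg a.2 (hTS w))

lemma genPairing_genMap (hTS : ∀ w, T (S w) = w) (a b : W × (W →L[ℝ] ℝ)) :
    genPairing (genMap S T a) (genMap S T b) = genPairing a b := by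
  have heval (a b : W × (W →L[ℝ] ℝ)) : (genMap S T a).2 (genMap S T b).1 = a.2 b.1 :=
    congrArg a.2 (hTS b.1)
  rw [genPairing, genPairing, heval, heval]

lemma IsGenComplexLinear.conj_genMap {J : W × (W →L[ℝ] ℝ) →ₗ[ℝ] W × (W →L[ℝ] ℝ)}
    (hJ : IsGenComplexLinear J) (hTS : ∀ w, T (S w) = w) (hST : ∀ w, S (T w) = w) :
    IsGenComplexLinear (genMap S T ∘ₗ J ∘ₗ genMap T S) := by
  refine ⟨fun a => ?_, fun a b => ?_⟩
  · simp only [LinearMap.comp_apply, genMap_genMap_cancel hTS, hJ.1, map_neg,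
      genMap_genMap_cancel hST]
  · simp only [LinearMap.comp_apply, genPairing_genMap hTS, hJ.2, genPairing_genMap hST]

end GenMap

section Pullback

variable {F₁ : Type*} [NormedAddCommGroup F₁] [NormedSpace ℝ F₁]
  {X : Type*} [TopologicalSpace X] [ChartedSpace F₁ X]
  {F₂ : Type*} [NormedAddCommGroup F₂] [NormedSpace ℝ F₂]
  {Y : Type*} [TopologicalSpace Y] [ChartedSpace F₂ Y]
  {F₃ : Type*} [NormedAddCommGroup F₃] [NormedSpace ℝ F₃]
  {W : Type*} [TopologicalSpace W] [ChartedSpace F₃ W]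
  {f : X → Y} {x : X} {a b : ∀ y : Y, GenTangent F₂ y}

variable (F₁) in
/-- The pullback of a section of `T_Y ⊕ T_Y^∨` along a local diffeomorphism `f : X → Y`. Its values
are typed in `F₁ ⊕ F₁^∨`, which is the fibre `T_x ⊕ T_x^∨` by definition, so that the pullback to a
vector space can be differentiated. -/
def genPullback (f : X → Y) (a : ∀ y : Y, GenTangent F₂ y) (x : X) : F₁ × (F₁ →L[ℝ] ℝ) :=
  genMap (mfderiv 𝓘(ℝ, F₁) 𝓘(ℝ, F₂) f x).inverse (mfderiv 𝓘(ℝ, F₁) 𝓘(ℝ, F₂) f x) (a (f x))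

lemma genPullback_add (a b : ∀ y : Y, GenTangent F₂ y) :
    genPullback F₁ f (fun y => a y + b y) x = genPullback F₁ f a x + genPullback F₁ f b x :=
  (genMap _ (mfderiv 𝓘(ℝ, F₁) 𝓘(ℝ, F₂) f x)).map_add _ _

lemma genPullback_sub (a b : ∀ y : Y, GenTangent F₂ y) :
    genPullback F₁ f (fun y => a y - b y) x = genPullback F₁ f a x - genPullback F₁ f b x :=
  (genMap _ (mfderiv 𝓘(ℝ, F₁) 𝓘(ℝ, F₂) f x)).map_sub _ _

lemma genPullback_neg (a : ∀ y : Y, GenTangent F₂ y) :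
    genPullback F₁ f (fun y => -a y) x = -genPullback F₁ f a x :=
  (genMap _ (mfderiv 𝓘(ℝ, F₁) 𝓘(ℝ, F₂) f x)).map_neg _

lemma mfderiv_genPullback_fst (hf : IsLocalDiffeomorphAt 𝓘(ℝ, F₁) 𝓘(ℝ, F₂) ∞ f x) :
    mfderiv 𝓘(ℝ, F₁) 𝓘(ℝ, F₂) f x (genPullback F₁ f a x).1 = (a (f x)).1 :=
  (isInvertible_mfderiv hf (by simp)).self_apply_inverse _

lemma genPullback_snd_apply_fst (hf : IsLocalDiffeomorphAt 𝓘(ℝ, F₁) 𝓘(ℝ, F₂) ∞ f x) :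
    (genPullback F₁ f b x).2 (genPullback F₁ f a x).1 = (b (f x)).2 (a (f x)).1 :=
  congrArg (b (f x)).2 (mfderiv_genPullback_fst hf)

lemma genPullback_congr {g : X → Y} (hfg : f =ᶠ[𝓝 x] g) (a : ∀ y : Y, GenTangent F₂ y) :
    genPullback F₁ f a x = genPullback F₁ g a x := by
  unfold genPullback
  rw [hfg.mfderiv_eq, hfg.self_of_nhds]

lemma genPullback_id (a : ∀ y : Y, GenTangent F₂ y) (y : Y) : genPullback F₂ id a y = a y := by
  unfold genPullback
  rw [mfderiv_id]
  exact Prod.ext (DFunLike.congr_fun (ContinuousLinearMap.inverse_id (R := ℝ) (M := F₂)) _) rfl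

lemma genPullback_comp {g : W → X} {w : W}
    (hf : IsLocalDiffeomorphAt 𝓘(ℝ, F₁) 𝓘(ℝ, F₂) ∞ f (g w))
    (hg : IsLocalDiffeomorphAt 𝓘(ℝ, F₃) 𝓘(ℝ, F₁) ∞ g w) :
    genPullback F₃ (f ∘ g) a w = genPullback F₃ g (genPullback F₁ f a) w := by
  unfold genPullback
  rw [mfderiv_comp w (hf.mdifferentiableAt (by simp)) (hg.mdifferentiableAt (by simp))]
  exact Prod.ext
    ((isInvertible_mfderiv hg (by simp)).inverse_comp_apply_of_right) rfl

lemma genPullback_localInverse (hf : IsLocalDiffeomorphAt 𝓘(ℝ, F₁) 𝓘(ℝ, F₂) ∞ f x)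
    (a : ∀ y : Y, GenTangent F₂ y) :
    ∀ᶠ y in 𝓝 (f x), genPullback F₂ hf.localInverse (genPullback F₁ f a) y = a y := by
  filter_upwards [hf.localInverse_eventuallyEq_right.eventuallyEq_nhds,
    (tendsto_localInverse hf).eventually (eventually_isLocalDiffeomorphAt hf),
    eventually_isLocalDiffeomorphAt hf.localInverse_isLocalDiffeomorphAt] with y hid hfy hgy
  rw [← genPullback_comp hfy hgy, genPullback_congr hid, genPullback_id]

lemma genPullback_injective (hf : IsLocalDiffeomorphAt 𝓘(ℝ, F₁) 𝓘(ℝ, F₂) ∞ f x)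
    (h : genPullback F₁ f a x = genPullback F₁ f b x) : a (f x) = b (f x) := by
  have hinv := isInvertible_mfderiv hf (by simp)
  refine Prod.ext ?_ ?_
  · rw [← mfderiv_genPullback_fst hf, ← mfderiv_genPullback_fst hf, h]
  · ext w
    rw [← hinv.self_apply_inverse w]
    exact congrArg (· ((mfderiv 𝓘(ℝ, F₁) 𝓘(ℝ, F₂) f x).inverse w)) (congrArg Prod.snd h)

variable [IsManifold 𝓘(ℝ, F₁) ∞ X] [IsManifold 𝓘(ℝ, F₂) ∞ Y]

lemma SmoothGenSectionAt.genPullback [FiniteDimensional ℝ F₁] (ha : SmoothGenSectionAt a (f x))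
    (hf : IsLocalDiffeomorphAt 𝓘(ℝ, F₁) 𝓘(ℝ, F₂) ∞ f x) :
    SmoothGenSectionAt (N := X) (genPullback F₁ f a) x :=
  ⟨ha.1.mpullback_vectorField_preimage hf.contMDiffAt (isInvertible_mfderiv hf (by simp)) (by simp),
    contMDiffAt_oneForm_of_apply fun _ hv =>
      ha.contMDiffAt_apply (contMDiffAt_mfderiv_vectorField hf.contMDiffAt hv)⟩

lemma smoothGenSectionAt_of_genPullback [FiniteDimensional ℝ F₂]
    (hf : IsLocalDiffeomorphAt 𝓘(ℝ, F₁) 𝓘(ℝ, F₂) ∞ f x)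
    (ha : SmoothGenSectionAt (N := X) (genPullback F₁ f a) x) : SmoothGenSectionAt a (f x) := by
  rw [← localInverse_apply_self hf] at ha
  exact (ha.genPullback hf.localInverse_isLocalDiffeomorphAt).congr
    ((genPullback_localInverse hf a).mono fun _ hy => hy.symm)

end Pullback

section VectorSpace

variable {G : Type*} [NormedAddCommGroup G] [NormedSpace ℝ G] [FiniteDimensional ℝ G]
  {F : Type*} [NormedAddCommGroup F] [NormedSpace ℝ F]
  {N : Type*} [TopologicalSpace N] [ChartedSpace F N] [IsManifold 𝓘(ℝ, F) ∞ N]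

lemma smoothGenSectionAt_iff_contDiffAt {a : G → G × (G →L[ℝ] ℝ)} {x : G} :
    SmoothGenSectionAt (N := G) a x ↔ ContDiffAt ℝ ∞ a x := by
  constructor
  · intro h
    refine (contMDiffAt_vectorSpace_iff_contDiffAt.1 h.1).prodMk
      (contMDiffAt_clm_of_apply fun w => ?_).contDiffAt
    exact h.contMDiffAt_apply (f := id) (v := fun _ => w)
      (contMDiffAt_vectorSpace_iff_contDiffAt.2 contDiffAt_const)
  · intro h
    refine ⟨contMDiffAt_vectorSpace_iff_contDiffAt.2 h.fst, contMDiffAt_oneForm_of_apply fun v hv =>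
      (h.snd.clm_apply (contMDiffAt_vectorSpace_iff_contDiffAt.1 hv)).contMDiffAt⟩

lemma SmoothGenSectionAt.contDiffAt_genPullback {f : G → N} {x : G} {a : ∀ y : N, GenTangent F y}
    (ha : SmoothGenSectionAt a (f x)) (hf : IsLocalDiffeomorphAt 𝓘(ℝ, G) 𝓘(ℝ, F) ∞ f x) :
    ContDiffAt ℝ ∞ (_root_.genPullback G f a) x :=
  smoothGenSectionAt_iff_contDiffAt.1 (ha.genPullback hf)

end VectorSpace

/-! ### Naturality of the Courant bracket -/

section JetBracket

variable {G : Type*} [NormedAddCommGroup G] [NormedSpace ℝ G]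

/-- The Courant bracket on a vector space, as a function of the values `h`, `h'` and the
derivatives `A`, `A'` of the two sections. -/
def jetBracket (h h' : G × (G →L[ℝ] ℝ)) (A A' : G →L[ℝ] G × (G →L[ℝ] ℝ)) : G × (G →L[ℝ] ℝ) :=
  ((A' h.1).1 - (A h'.1).1,
    (A' h.1).2 - (A h'.1).2 + (1 / 2 : ℝ) •
      (((ContinuousLinearMap.snd ℝ _ _).comp A).flip h'.1
        + h'.2.comp ((ContinuousLinearMap.fst ℝ _ _).comp A)
        - h.2.comp ((ContinuousLinearMap.fst ℝ _ _).comp A')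
        - ((ContinuousLinearMap.snd ℝ _ _).comp A').flip h.1))

lemma jetBracket_snd_apply (h h' : G × (G →L[ℝ] ℝ)) (A A' : G →L[ℝ] G × (G →L[ℝ] ℝ)) (w : G) :
    (jetBracket h h' A A').2 w =
      (A' h.1 - A h'.1).2 w - genPairing (A w) h' + genPairing h (A' w) := by
  have hdef : (jetBracket h h' A A').2 w = (A' h.1).2 w - (A h'.1).2 w + (1 / 2 : ℝ) *
      ((A w).2 h'.1 + h'.2 (A w).1 - h.2 (A' w).1 - (A' w).2 h.1) := rfl
  rw [hdef]
  simp only [genPairing, Prod.snd_sub, sub_apply]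
  ring

end JetBracket

section Naturality

lemma two_le_infty : minSmoothness ℝ 2 ≤ (∞ : WithTop ℕ∞) := by
  rw [minSmoothness_of_isRCLikeNormedField]
  exact WithTop.coe_le_coe.2 (le_top : (2 : ℕ∞) ≤ ⊤)

variable {G : Type*} [NormedAddCommGroup G] [NormedSpace ℝ G]
  {F : Type*} [NormedAddCommGroup F] [NormedSpace ℝ F]

/-- The second derivatives of `κ` drop out of `d(κ^* β)` because they are symmetric. -/
lemma fderiv_comp_fderiv_sub_swap {κ : G → F} {β : F → F →L[ℝ] ℝ} {x : G}
    (hκ : ContDiffAt ℝ ∞ κ x) (hβ : DifferentiableAt ℝ β (κ x)) (u v : G) :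
    fderiv ℝ (fun y => (β (κ y)).comp (fderiv ℝ κ y)) x u v
        - fderiv ℝ (fun y => (β (κ y)).comp (fderiv ℝ κ y)) x v u =
      fderiv ℝ β (κ x) (fderiv ℝ κ x u) (fderiv ℝ κ x v)
        - fderiv ℝ β (κ x) (fderiv ℝ κ x v) (fderiv ℝ κ x u) := by
  have hDκ : DifferentiableAt ℝ (fderiv ℝ κ) x :=
    (hκ.fderiv_right (m := ∞) (by simp)).differentiableAt (by simp)
  have hβκ : HasFDerivAt (fun y => β (κ y)) ((fderiv ℝ β (κ x)).comp (fderiv ℝ κ x)) x :=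
    hβ.hasFDerivAt.comp x (hκ.differentiableAt (by simp)).hasFDerivAt
  have hsymm : fderiv ℝ (fderiv ℝ κ) x u v = fderiv ℝ (fderiv ℝ κ) x v u :=
    hκ.isSymmSndFDerivAt two_le_infty u v
  rw [(hβκ.clm_comp hDκ.hasFDerivAt).fderiv]
  simp [hsymm]

variable {N : Type*} [TopologicalSpace N] [ChartedSpace F N] [IsManifold 𝓘(ℝ, F) ∞ N]
  {f : G → N} {x : G} {a b : ∀ z : N, GenTangent F z}

lemma genPullback_snd_eventuallyEq_oneFormInChart
    (hf : IsLocalDiffeomorphAt 𝓘(ℝ, G) 𝓘(ℝ, F) ∞ f x) (b : ∀ z : N, GenTangent F z) :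
    (fun y => (genPullback G f b y).2) =ᶠ[𝓝 x] fun y =>
      (oneFormInChart (fun z => (b z).2) (f x) (extChartAt 𝓘(ℝ, F) (f x) (f y))).comp
        (fderiv ℝ (extChartAt 𝓘(ℝ, F) (f x) ∘ f) y) := by
  let χ := extChartAt 𝓘(ℝ, F) (f x)
  have hsource : ∀ᶠ y in 𝓝 x, f y ∈ χ.source :=
    hf.contMDiffAt.continuousAt.preimage_mem_nhds (extChartAt_source_mem_nhds (f x))
  filter_upwards [eventually_isLocalDiffeomorphAt hf, hsource.eventually_nhds] with y hfy hy
  have hcomp : f =ᶠ[𝓝 y] χ.symm ∘ (χ ∘ f) := hy.mono fun y' hy' => (χ.left_inv hy').symm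
  have hys := hy.self_of_nhds
  have hκ : IsLocalDiffeomorphAt 𝓘(ℝ, G) 𝓘(ℝ, F) ∞ (χ ∘ f) y :=
    hfy.comp _ _ (isLocalDiffeomorphAt_extChartAt hys)
  have hχ : IsLocalDiffeomorphAt 𝓘(ℝ, F) 𝓘(ℝ, F) ∞ χ.symm ((χ ∘ f) y) :=
    isLocalDiffeomorphAt_extChartAt_symm (χ.map_source hys)
  rw [genPullback_congr hcomp, genPullback_comp hχ hκ]
  simp only [genPullback, mfderiv_eq_fderiv]
  rfl

variable [FiniteDimensional ℝ G]

lemma contractExtDeriv_apply_mfderiv [FiniteDimensional ℝ F]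
    (hf : IsLocalDiffeomorphAt 𝓘(ℝ, G) 𝓘(ℝ, F) ∞ f x) (a : ∀ z : N, GenTangent F z)
    (hb : SmoothGenSectionAt b (f x)) (w : G) :
    contractExtDeriv (fun z => (a z).1) (fun z => (b z).2) (f x)
        (mfderiv 𝓘(ℝ, G) 𝓘(ℝ, F) f x w) =
      (fderiv ℝ (genPullback G f b) x (genPullback G f a x).1).2 w
        - (fderiv ℝ (genPullback G f b) x w).2 (genPullback G f a x).1 := by
  let χ := extChartAt 𝓘(ℝ, F) (f x)
  have hmem : f x ∈ χ.source := mem_extChartAt_source (f x)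
  have hχ : MDifferentiableAt 𝓘(ℝ, F) 𝓘(ℝ, F) χ (f x) := mdifferentiableAt_extChartAt (by simp)
  have hκ : ContDiffAt ℝ ∞ (χ ∘ f) x :=
    ((contMDiffAt_extChartAt (n := ∞)).comp x hf.contMDiffAt).contDiffAt
  have hβ : DifferentiableAt ℝ (oneFormInChart (fun z => (b z).2) (f x)) ((χ ∘ f) x) :=
    (SmoothGenSectionAt.contDiffAt_genPullback (f := χ.symm) (a := b)
      (by rwa [χ.left_inv hmem])
      (isLocalDiffeomorphAt_extChartAt_symm (χ.map_source hmem))).snd.differentiableAt (by simp)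
  have hsnd (u v : G) : (fderiv ℝ (genPullback G f b) x u).2 v =
      fderiv ℝ (fun y => (oneFormInChart (fun z => (b z).2) (f x) ((χ ∘ f) y)).comp
        (fderiv ℝ (χ ∘ f) y)) x u v := by
    refine Eq.trans ?_ (DFunLike.congr_fun (DFunLike.congr_fun
      (genPullback_snd_eventuallyEq_oneFormInChart hf b).fderiv_eq u) v)
    rw [fderiv.snd ((hb.contDiffAt_genPullback hf).differentiableAt (by simp))]
    rfl
  have hdχ (v : G) : mfderiv 𝓘(ℝ, F) 𝓘(ℝ, F) χ (f x) (mfderiv 𝓘(ℝ, G) 𝓘(ℝ, F) f x v)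
      = fderiv ℝ (χ ∘ f) x v := by
    rw [← mfderiv_eq_fderiv]
    exact (DFunLike.congr_fun (mfderiv_comp x hχ (hf.mdifferentiableAt (by simp))) v).symm
  have ha : mfderiv 𝓘(ℝ, F) 𝓘(ℝ, F) χ (f x) (a (f x)).1
      = fderiv ℝ (χ ∘ f) x (genPullback G f a x).1 := by
    rw [← hdχ]
    exact congrArg _ (mfderiv_genPullback_fst hf).symm
  rw [hsnd, hsnd, fderiv_comp_fderiv_sub_swap hκ hβ, ← ha, ← hdχ]
  rfl

lemma genPullback_courantBracket_fst [FiniteDimensional ℝ F]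
    (hf : IsLocalDiffeomorphAt 𝓘(ℝ, G) 𝓘(ℝ, F) ∞ f x)
    (ha : SmoothGenSectionAt a (f x)) (hb : SmoothGenSectionAt b (f x)) :
    (genPullback G f (courantBracket a b) x).1 =
      (fderiv ℝ (genPullback G f b) x (genPullback G f a x).1
        - fderiv ℝ (genPullback G f a) x (genPullback G f b x).1).1 := by
  have : IsManifold 𝓘(ℝ, F) (minSmoothness ℝ 2) N := IsManifold.of_le (n := ∞) two_le_infty
  have hfst {c : ∀ z : N, GenTangent F z} (hc : SmoothGenSectionAt c (f x)) :
      fderiv ℝ (fun y => (genPullback G f c y).1) x =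
        (ContinuousLinearMap.fst ℝ _ _).comp (fderiv ℝ (genPullback G f c) x) :=
    fderiv.fst ((hc.contDiffAt_genPullback hf).differentiableAt (by simp))
  have hlie (v w : ∀ y : G, TangentSpace 𝓘(ℝ, G) y) :
      VectorField.mlieBracket 𝓘(ℝ, G) v w x = VectorField.lieBracket ℝ v w x := by
    rw [← VectorField.mlieBracketWithin_univ, VectorField.mlieBracketWithin_eq_lieBracketWithin]
    exact congrFun VectorField.lieBracketWithin_univ x
  have hpull : (genPullback G f (courantBracket a b) x).1 =
      VectorField.lieBracket ℝ (fun y => (genPullback G f a y).1)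
        (fun y => (genPullback G f b y).1) x :=
    (VectorField.mpullback_mlieBracket (n := ∞) (ha.1.mdifferentiableAt (by simp))
      (hb.1.mdifferentiableAt (by simp)) hf.contMDiffAt two_le_infty).trans (hlie _ _)
  rw [hpull]
  change fderiv ℝ (fun y => (genPullback G f b y).1) x _
    - fderiv ℝ (fun y => (genPullback G f a y).1) x _ = _
  rw [hfst ha, hfst hb]
  rfl

lemma dFun_apply_mfderiv (hf : IsLocalDiffeomorphAt 𝓘(ℝ, G) 𝓘(ℝ, F) ∞ f x)
    (ha : SmoothGenSectionAt a (f x)) (hb : SmoothGenSectionAt b (f x)) (w : G) :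
    dFun (fun z => (b z).2 (a z).1) (f x) (mfderiv 𝓘(ℝ, G) 𝓘(ℝ, F) f x w) =
      (fderiv ℝ (genPullback G f b) x w).2 (genPullback G f a x).1
        + (genPullback G f b x).2 (fderiv ℝ (genPullback G f a) x w).1 := by
  have hba : MDifferentiableAt 𝓘(ℝ, F) 𝓘(ℝ, ℝ) (fun z => (b z).2 (a z).1) (f x) :=
    (SmoothGenSectionAt.contMDiffAt_apply (f := id) (x := f x) hb ha.1).mdifferentiableAt (by simp)
  have hPa := (ha.contDiffAt_genPullback hf).differentiableAt (by simp)
  have hPb := (hb.contDiffAt_genPullback hf).differentiableAt (by simp)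
  have hcomp : (fun z => (b z).2 (a z).1) ∘ f =ᶠ[𝓝 x]
      fun y => (genPullback G f b y).2 (genPullback G f a y).1 := by
    filter_upwards [eventually_isLocalDiffeomorphAt hf] with y hy
      using (genPullback_snd_apply_fst hy).symm
  have hchain : dFun (fun z => (b z).2 (a z).1) (f x) (mfderiv 𝓘(ℝ, G) 𝓘(ℝ, F) f x w) =
      mfderiv 𝓘(ℝ, G) 𝓘(ℝ, ℝ) ((fun z => (b z).2 (a z).1) ∘ f) x w :=
    (DFunLike.congr_fun (mfderiv_comp x hba (hf.mdifferentiableAt (by simp))) w).symm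
  rw [hchain, hcomp.mfderiv_eq, mfderiv_eq_fderiv, fderiv_clm_apply hPb.snd hPa.fst,
    fderiv.fst hPa, fderiv.snd hPb]
  exact add_comm _ _

theorem genPullback_courantBracket [FiniteDimensional ℝ F]
    (hf : IsLocalDiffeomorphAt 𝓘(ℝ, G) 𝓘(ℝ, F) ∞ f x)
    (ha : SmoothGenSectionAt a (f x)) (hb : SmoothGenSectionAt b (f x)) :
    genPullback G f (courantBracket a b) x =
      jetBracket (genPullback G f a x) (genPullback G f b x)
        (fderiv ℝ (genPullback G f a) x) (fderiv ℝ (genPullback G f b) x) := by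
  refine Prod.ext (genPullback_courantBracket_fst hf ha hb) (ContinuousLinearMap.ext fun w => ?_)
  have hmdiff {c d : ∀ z : N, GenTangent F z} (hc : SmoothGenSectionAt c (f x))
      (hd : SmoothGenSectionAt d (f x)) :
      MDifferentiableAt 𝓘(ℝ, F) 𝓘(ℝ, ℝ) (fun z => (d z).2 (c z).1) (f x) :=
    (SmoothGenSectionAt.contMDiffAt_apply (f := id) (x := f x) hd hc.1).mdifferentiableAt (by simp)
  have hda := dFun_apply_mfderiv hf ha hb w
  have hdb := dFun_apply_mfderiv hf hb ha w
  have hia := contractExtDeriv_apply_mfderiv hf a hb w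
  have hib := contractExtDeriv_apply_mfderiv hf b ha w
  set v := mfderiv 𝓘(ℝ, G) 𝓘(ℝ, F) f x w
  have hsub : dFun (fun z => (a z).2 (b z).1 - (b z).2 (a z).1) (f x) v
      = dFun (fun z => (a z).2 (b z).1) (f x) v - dFun (fun z => (b z).2 (a z).1) (f x) v :=
    DFunLike.congr_fun (mfderiv_sub (hmdiff hb ha) (hmdiff ha hb)) v
  have hvalue : (genPullback G f (courantBracket a b) x).2 w =
      (contractExtDeriv (fun z => (a z).1) (fun z => (b z).2) (f x) v
        + dFun (fun z => (b z).2 (a z).1) (f x) v)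
      - (contractExtDeriv (fun z => (b z).1) (fun z => (a z).2) (f x) v
        + dFun (fun z => (a z).2 (b z).1) (f x) v)
      + (1 / 2 : ℝ) * dFun (fun z => (a z).2 (b z).1 - (b z).2 (a z).1) (f x) v := rfl
  rw [hvalue, hsub, hia, hib, hda, hdb, jetBracket_snd_apply]
  simp only [genPairing, Prod.snd_sub, sub_apply]
  ring

end Naturality

/-! ### Brackets of sections of the eigenbundle in a frame -/

section Leibniz

variable {G : Type*} [NormedAddCommGroup G] [NormedSpace ℝ G]

lemma genPairing_neg_left (a b : G × (G →L[ℝ] ℝ)) : genPairing (-a) b = -genPairing a b := by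
  simp only [genPairing, Prod.fst_neg, Prod.snd_neg, neg_apply, map_neg]
  ring

lemma jetBracket_add (h h' : G × (G →L[ℝ] ℝ)) (A A' B B' : G →L[ℝ] G × (G →L[ℝ] ℝ)) :
    jetBracket h h' (A + B) (A' + B') = jetBracket h h' A A' + jetBracket h h' B B' := by
  refine Prod.ext ?_ (ContinuousLinearMap.ext fun w => ?_)
  · simp only [jetBracket, add_apply, Prod.fst_add]
    abel
  · simp only [jetBracket_snd_apply, genPairing, add_apply, Prod.fst_add, Prod.snd_add,
      Prod.snd_sub, sub_apply, map_add]
    ring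

lemma jetBracket_zero_left (h : G × (G →L[ℝ] ℝ)) (A : G →L[ℝ] G × (G →L[ℝ] ℝ)) :
    jetBracket 0 h 0 A = 0 := by
  refine Prod.ext ?_ (ContinuousLinearMap.ext fun w => ?_)
  · simp [jetBracket]
  · simp [jetBracket_snd_apply, genPairing]

lemma jetBracket_zero_right (h : G × (G →L[ℝ] ℝ)) (A : G →L[ℝ] G × (G →L[ℝ] ℝ)) :
    jetBracket h 0 A 0 = 0 := by
  refine Prod.ext ?_ (ContinuousLinearMap.ext fun w => ?_)
  · simp [jetBracket]
  · simp [jetBracket_snd_apply, genPairing]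

lemma jetBracket_neg_neg (h h' : G × (G →L[ℝ] ℝ)) (A A' : G →L[ℝ] G × (G →L[ℝ] ℝ)) :
    jetBracket (-h) (-h') (-A) (-A') = jetBracket h h' A A' := by
  refine Prod.ext ?_ (ContinuousLinearMap.ext fun w => ?_)
  · simp [jetBracket]
  · simp [jetBracket_snd_apply, genPairing]

lemma jetBracket_neg_right (h h' : G × (G →L[ℝ] ℝ)) (A A' : G →L[ℝ] G × (G →L[ℝ] ℝ)) :
    jetBracket h (-h') A (-A') = -jetBracket h h' A A' := by
  refine Prod.ext ?_ (ContinuousLinearMap.ext fun w => ?_)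
  · simp [jetBracket, neg_add_eq_sub]
  · simp only [jetBracket_snd_apply, genPairing, neg_apply, Prod.fst_neg, Prod.snd_neg,
      Prod.snd_sub, sub_apply, map_neg]
    ring

lemma jetBracket_neg_left (h h' : G × (G →L[ℝ] ℝ)) (A A' : G →L[ℝ] G × (G →L[ℝ] ℝ)) :
    jetBracket (-h) h' (-A) A' = -jetBracket h h' A A' := by
  refine Prod.ext ?_ (ContinuousLinearMap.ext fun w => ?_)
  · simp [jetBracket, neg_add_eq_sub]
  · simp only [jetBracket_snd_apply, genPairing, neg_apply, Prod.fst_neg, Prod.snd_neg,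
      Prod.snd_sub, sub_apply, map_neg]
    ring

variable {T : Type*} [NormedAddCommGroup T] [NormedSpace ℝ T]

/-- When `P : T → G ⊕ G^∨` is orthogonal for the complex structure `j`, the pairing terms in the
Leibniz rule for the Courant bracket cancel on the `+i`-eigenbundle `{P s - i P (j s)}`. -/
lemma exists_jetBracket_comp_eq {P : T →L[ℝ] G × (G →L[ℝ] ℝ)} {j : T →L[ℝ] T}
    (hj : ∀ v, j (j v) = -v)
    (horth : ∀ v w, genPairing (P (j v)) (P (j w)) = genPairing (P v) (P w)) (s t : T)
    (S S' : G →L[ℝ] T) :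
    ∃ u, jetBracket (P s) (P t) (P ∘L S) (P ∘L S')
          - jetBracket (P (j s)) (P (j t)) (P ∘L j ∘L S) (P ∘L j ∘L S') = P u ∧
        jetBracket (P s) (P (j t)) (P ∘L S) (P ∘L j ∘L S')
          + jetBracket (P (j s)) (P t) (P ∘L j ∘L S) (P ∘L S') = P (j u) := by
  have hanti (v w : T) : genPairing (P v) (P (j w)) = -genPairing (P (j v)) (P w) := by
    rw [← horth (j v) w, hj, map_neg, genPairing_neg_left, neg_neg]
  refine ⟨S' (P s).1 - S (P t).1 - j (S' (P (j s)).1) + j (S (P (j t)).1),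
    Prod.ext ?_ (ContinuousLinearMap.ext fun w => ?_),
    Prod.ext ?_ (ContinuousLinearMap.ext fun w => ?_)⟩
  · simp only [jetBracket, ContinuousLinearMap.comp_apply, Prod.fst_sub, Prod.fst_add, map_sub,
      map_add]
    abel
  · simp only [Prod.snd_sub, Prod.snd_add, sub_apply, add_apply, jetBracket_snd_apply,
      ContinuousLinearMap.comp_apply, map_sub, map_add, horth]
    ring
  · simp only [jetBracket, ContinuousLinearMap.comp_apply, Prod.fst_sub, Prod.fst_add, map_sub,
      map_add, hj, Prod.fst_neg, map_neg]
    abel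
  · simp only [Prod.snd_sub, Prod.snd_add, sub_apply, add_apply, jetBracket_snd_apply,
      ContinuousLinearMap.comp_apply, map_sub, map_add, hj, hanti, map_neg, Prod.snd_neg, neg_apply]
    ring

end Leibniz

section SemiFlatFrame

variable (E R : Type*) [NormedAddCommGroup E] [NormedSpace ℝ E]
  [NormedAddCommGroup R] [NormedSpace ℝ R]

/-- The inclusion `R ⊕ R^∨ → (E ⊕ R) ⊕ (E ⊕ R)^∨` of the fibre directions of `E × R → E`. -/
def fibreIncl : R × (R →L[ℝ] ℝ) →L[ℝ] (E × R) × (E × R →L[ℝ] ℝ) :=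
  (ContinuousLinearMap.inr ℝ E R).prodMap (.precomp ℝ (ContinuousLinearMap.snd ℝ E R))

/-- The inclusion `E ⊕ E^∨ → (E ⊕ R) ⊕ (E ⊕ R)^∨` of the base directions of `E × R → E`. -/
def baseIncl : E × (E →L[ℝ] ℝ) →L[ℝ] (E × R) × (E × R →L[ℝ] ℝ) :=
  (ContinuousLinearMap.inl ℝ E R).prodMap (.precomp ℝ (ContinuousLinearMap.fst ℝ E R))

/-- The projection `(E ⊕ R) ⊕ (E ⊕ R)^∨ → R ⊕ R^∨`, a left inverse of `fibreIncl`. -/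
def fibrePart : (E × R) × (E × R →L[ℝ] ℝ) →L[ℝ] R × (R →L[ℝ] ℝ) :=
  (ContinuousLinearMap.snd ℝ E R).prodMap (.precomp ℝ (ContinuousLinearMap.inr ℝ E R))

/-- The projection `(E ⊕ R) ⊕ (E ⊕ R)^∨ → E ⊕ E^∨`, a left inverse of `baseIncl`. -/
def basePart : (E × R) × (E × R →L[ℝ] ℝ) →L[ℝ] E × (E →L[ℝ] ℝ) :=
  (ContinuousLinearMap.fst ℝ E R).prodMap (.precomp ℝ (ContinuousLinearMap.inl ℝ E R))

/-- The complex structure `(c, d) ↦ (-d, c)` on `S ⊕ S`. -/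
def quarterTurn (S : Type*) [NormedAddCommGroup S] [NormedSpace ℝ S] : S × S →L[ℝ] S × S :=
  (-ContinuousLinearMap.snd ℝ S S).prod (ContinuousLinearMap.fst ℝ S S)

variable {E R}

lemma quarterTurn_quarterTurn {S : Type*} [NormedAddCommGroup S] [NormedSpace ℝ S] (v : S × S) :
    quarterTurn S (quarterTurn S v) = -v :=
  rfl

lemma quarterTurn_apply_snd {S : Type*} [NormedAddCommGroup S] [NormedSpace ℝ S] (v : S × S) :
    (quarterTurn S v).2 = v.1 :=
  rfl

lemma fibrePart_fibreIncl (c : R × (R →L[ℝ] ℝ)) : fibrePart E R (fibreIncl E R c) = c :=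
  rfl

lemma fibrePart_baseIncl (h : E × (E →L[ℝ] ℝ)) : fibrePart E R (baseIncl E R h) = 0 :=
  Prod.ext rfl (ContinuousLinearMap.ext fun _ => map_zero h.2)

lemma basePart_baseIncl (h : E × (E →L[ℝ] ℝ)) : basePart E R (baseIncl E R h) = h :=
  rfl

lemma baseIncl_injective : Function.Injective (baseIncl E R) :=
  Function.LeftInverse.injective basePart_baseIncl

lemma fibreIncl_fibrePart_add_baseIncl_basePart (a : (E × R) × (E × R →L[ℝ] ℝ)) :
    fibreIncl E R (fibrePart E R a) + baseIncl E R (basePart E R a) = a := by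
  refine Prod.ext ?_ ?_
  · simp [fibreIncl, baseIncl, fibrePart, basePart]
  · ext w <;> simp [fibreIncl, baseIncl, fibrePart, basePart, ← Prod.zero_eq_mk]

lemma jetBracket_fibreIncl_add_baseIncl (c c' : R × (R →L[ℝ] ℝ)) (h h' : E × (E →L[ℝ] ℝ))
    (A A' : E →L[ℝ] E × (E →L[ℝ] ℝ)) :
    jetBracket (fibreIncl E R c + baseIncl E R h) (fibreIncl E R c' + baseIncl E R h')
        (baseIncl E R ∘L A ∘L .fst ℝ E R) (baseIncl E R ∘L A' ∘L .fst ℝ E R) =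
      baseIncl E R (jetBracket h h' A A') := by
  refine Prod.ext ?_ (ContinuousLinearMap.ext fun w => ?_)
  · simp [jetBracket, fibreIncl, baseIncl]
  · simp [jetBracket_snd_apply, genPairing, fibreIncl, baseIncl]

/-- The frame of `(E ⊕ R) ⊕ (E ⊕ R)^∨` formed by `R ⊕ R^∨` and its image `k` in `E ⊕ E^∨` under a
semi-flat structure. -/
def semiFlatFrame (k : R × (R →L[ℝ] ℝ) →L[ℝ] E × (E →L[ℝ] ℝ)) :
    (R × (R →L[ℝ] ℝ)) × (R × (R →L[ℝ] ℝ)) →L[ℝ] (E × R) × (E × R →L[ℝ] ℝ) :=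
  fibreIncl E R ∘L .fst ℝ _ _ + baseIncl E R ∘L k ∘L .snd ℝ _ _

/-- A generalized complex structure `J` on `E × R` which maps `R ⊕ R^∨` isomorphically to
`E ⊕ E^∨`, by the map `k`. -/
structure IsSemiFlatModel (J : (E × R) × (E × R →L[ℝ] ℝ) →ₗ[ℝ] (E × R) × (E × R →L[ℝ] ℝ))
    (k : R × (R →L[ℝ] ℝ) →L[ℝ] E × (E →L[ℝ] ℝ)) : Prop where
  isGenComplexLinear : IsGenComplexLinear J
  apply_fibreIncl : ∀ c, J (fibreIncl E R c) = baseIncl E R (k c)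
  surjective : Function.Surjective k

namespace IsSemiFlatModel

variable {J : (E × R) × (E × R →L[ℝ] ℝ) →ₗ[ℝ] (E × R) × (E × R →L[ℝ] ℝ)}
  {k : R × (R →L[ℝ] ℝ) →L[ℝ] E × (E →L[ℝ] ℝ)} (h : IsSemiFlatModel J k)
include h

lemma apply_baseIncl (c : R × (R →L[ℝ] ℝ)) : J (baseIncl E R (k c)) = -fibreIncl E R c := by
  rw [← h.apply_fibreIncl, h.isGenComplexLinear.1]

lemma apply_semiFlatFrame (v : (R × (R →L[ℝ] ℝ)) × (R × (R →L[ℝ] ℝ))) :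
    J (semiFlatFrame k v) = semiFlatFrame k (quarterTurn _ v) := by
  have hframe : J (fibreIncl E R v.1 + baseIncl E R (k v.2)) =
      fibreIncl E R (-v.2) + baseIncl E R (k v.1) := by
    rw [map_add, h.apply_fibreIncl, h.apply_baseIncl, map_neg, add_comm]
  exact hframe

lemma genPairing_semiFlatFrame_quarterTurn (v w : (R × (R →L[ℝ] ℝ)) × (R × (R →L[ℝ] ℝ))) :
    genPairing (semiFlatFrame k (quarterTurn _ v)) (semiFlatFrame k (quarterTurn _ w)) =
      genPairing (semiFlatFrame k v) (semiFlatFrame k w) := by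
  rw [← h.apply_semiFlatFrame, ← h.apply_semiFlatFrame, h.isGenComplexLinear.2]

lemma eq_semiFlatFrame {a b : (E × R) × (E × R →L[ℝ] ℝ)} (hab : J a = -b) :
    a = semiFlatFrame k (fibrePart E R a, fibrePart E R b) ∧
      b = -semiFlatFrame k (quarterTurn _ (fibrePart E R a, fibrePart E R b)) := by
  obtain ⟨c, g, rfl⟩ : ∃ c g, fibreIncl E R c + baseIncl E R g = a :=
    ⟨_, _, fibreIncl_fibrePart_add_baseIncl_basePart a⟩
  obtain ⟨d, rfl⟩ := h.surjective g
  obtain rfl : b = -semiFlatFrame k (quarterTurn _ (c, d)) := by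
    rw [← h.apply_semiFlatFrame, eq_neg_iff_add_eq_zero, add_comm, ← eq_neg_iff_add_eq_zero]
    exact hab
  have ha : fibrePart E R (fibreIncl E R c + baseIncl E R (k d)) = c := by
    rw [map_add, fibrePart_fibreIncl, fibrePart_baseIncl, add_zero]
  have hb : fibrePart E R (-semiFlatFrame k (quarterTurn _ (c, d))) = d := by
    have hneg : -(fibreIncl E R (-d) + baseIncl E R (k c)) =
        fibreIncl E R d + baseIncl E R (k (-c)) := by
      simp only [map_neg, neg_add, neg_neg]
    change fibrePart E R (-(fibreIncl E R (-d) + baseIncl E R (k c))) = d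
    rw [hneg, map_add, fibrePart_fibreIncl, fibrePart_baseIncl, add_zero]
  rw [ha, hb]
  exact ⟨rfl, rfl⟩

end IsSemiFlatModel

end SemiFlatFrame

lemma hasFDerivAt_comp_add_comp_clm_apply {E R S T H : Type*}
    [NormedAddCommGroup E] [NormedSpace ℝ E] [NormedAddCommGroup R] [NormedSpace ℝ R]
    [NormedAddCommGroup S] [NormedSpace ℝ S] [NormedAddCommGroup T] [NormedSpace ℝ T]
    [NormedAddCommGroup H] [NormedSpace ℝ H] (ι : S →L[ℝ] H) (τ : T →L[ℝ] H)
    {k : E → S →L[ℝ] T} {s : E × R → S × S} {x : E × R}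
    (hk : DifferentiableAt ℝ k x.1) (hs : DifferentiableAt ℝ s x) :
    HasFDerivAt (fun y => ι (s y).1 + τ (k y.1 (s y).2))
      ((ι ∘L .fst ℝ S S + τ ∘L k x.1 ∘L .snd ℝ S S) ∘L fderiv ℝ s x
        + τ ∘L (fderiv ℝ k x.1).flip (s x).2 ∘L .fst ℝ E R) x := by
  have hkfst : HasFDerivAt (fun y : E × R => k y.1) (fderiv ℝ k x.1 ∘L .fst ℝ E R) x :=
    hk.hasFDerivAt.comp x hasFDerivAt_fst
  refine ((ι.hasFDerivAt.comp x hs.hasFDerivAt.fst).add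
    (τ.hasFDerivAt.comp x (hkfst.clm_apply hs.hasFDerivAt.snd))).congr_fderiv ?_
  refine ContinuousLinearMap.ext fun w => ?_
  simp only [add_apply, ContinuousLinearMap.comp_apply, map_add,
    ContinuousLinearMap.flip_apply, ContinuousLinearMap.coe_fst', ContinuousLinearMap.coe_snd']
  abel

section LocalModel

variable {E R : Type*} [NormedAddCommGroup E] [NormedSpace ℝ E]
  [NormedAddCommGroup R] [NormedSpace ℝ R]

/-- The Courant bracket at `y` of the sections `k d` and `k d'` of `E ⊕ E^∨`, for constant `d` and
`d'`. -/
def frameBracket (k : E → R × (R →L[ℝ] ℝ) →L[ℝ] E × (E →L[ℝ] ℝ)) (y : E)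
    (d d' : R × (R →L[ℝ] ℝ)) : E × (E →L[ℝ] ℝ) :=
  jetBracket (k y d) (k y d') ((fderiv ℝ k y).flip d) ((fderiv ℝ k y).flip d')

variable {k : E → R × (R →L[ℝ] ℝ) →L[ℝ] E × (E →L[ℝ] ℝ)} {x : E × R}
  {J : E → (E × R) × (E × R →L[ℝ] ℝ) →ₗ[ℝ] (E × R) × (E × R →L[ℝ] ℝ)}

lemma hasFDerivAt_semiFlatFrame (hk : DifferentiableAt ℝ k x.1)
    {s : E × R → (R × (R →L[ℝ] ℝ)) × (R × (R →L[ℝ] ℝ))} (hs : DifferentiableAt ℝ s x) :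
    HasFDerivAt (fun y => semiFlatFrame (k y.1) (s y))
      (semiFlatFrame (k x.1) ∘L fderiv ℝ s x
        + baseIncl E R ∘L (fderiv ℝ k x.1).flip (s x).2 ∘L .fst ℝ E R) x :=
  hasFDerivAt_comp_add_comp_clm_apply (fibreIncl E R) (baseIncl E R) hk hs

lemma jetBracket_semiFlatFrame (y : E) (v w : (R × (R →L[ℝ] ℝ)) × (R × (R →L[ℝ] ℝ)))
    (S S' : E × R →L[ℝ] (R × (R →L[ℝ] ℝ)) × (R × (R →L[ℝ] ℝ))) :
    jetBracket (semiFlatFrame (k y) v) (semiFlatFrame (k y) w)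
        (semiFlatFrame (k y) ∘L S + baseIncl E R ∘L (fderiv ℝ k y).flip v.2 ∘L .fst ℝ E R)
        (semiFlatFrame (k y) ∘L S' + baseIncl E R ∘L (fderiv ℝ k y).flip w.2 ∘L .fst ℝ E R) =
      jetBracket (semiFlatFrame (k y) v) (semiFlatFrame (k y) w) (semiFlatFrame (k y) ∘L S)
        (semiFlatFrame (k y) ∘L S') + baseIncl E R (frameBracket k y v.2 w.2) := by
  rw [jetBracket_add]
  exact congrArg _ (jetBracket_fibreIncl_add_baseIncl v.1 w.1 _ _ _ _)

lemma exists_eigensection_jet_eq (hk : DifferentiableAt ℝ k x.1)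
    (hmodel : ∀ᶠ y in 𝓝 x.1, IsSemiFlatModel (J y) (k y))
    {re im : E × R → (E × R) × (E × R →L[ℝ] ℝ)}
    (hre : DifferentiableAt ℝ re x) (him : DifferentiableAt ℝ im x)
    (heig : ∀ᶠ y in 𝓝 x, J y.1 (re y) = -im y) :
    ∃ (s : (R × (R →L[ℝ] ℝ)) × (R × (R →L[ℝ] ℝ)))
      (S : E × R →L[ℝ] (R × (R →L[ℝ] ℝ)) × (R × (R →L[ℝ] ℝ))),
      s = (fibrePart E R (re x), fibrePart E R (im x)) ∧
      re x = semiFlatFrame (k x.1) s ∧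
      im x = -semiFlatFrame (k x.1) (quarterTurn _ s) ∧
      fderiv ℝ re x = semiFlatFrame (k x.1) ∘L S
        + baseIncl E R ∘L (fderiv ℝ k x.1).flip s.2 ∘L .fst ℝ E R ∧
      fderiv ℝ im x = -(semiFlatFrame (k x.1) ∘L quarterTurn _ ∘L S
        + baseIncl E R ∘L (fderiv ℝ k x.1).flip (quarterTurn _ s).2 ∘L .fst ℝ E R) := by
  let s y := (fibrePart E R (re y), fibrePart E R (im y))
  let q := quarterTurn (R × (R →L[ℝ] ℝ))
  have hs : DifferentiableAt ℝ s x :=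
    ((fibrePart E R).differentiableAt.comp x hre).prodMk
      ((fibrePart E R).differentiableAt.comp x him)
  have hqs : HasFDerivAt (fun y => q (s y)) (q ∘L fderiv ℝ s x) x :=
    q.hasFDerivAt.comp x hs.hasFDerivAt
  have hmodel' : ∀ᶠ y in 𝓝 x, IsSemiFlatModel (J y.1) (k y.1) :=
    continuousAt_fst.eventually hmodel
  have hre_eq : re =ᶠ[𝓝 x] fun y => semiFlatFrame (k y.1) (s y) := by
    filter_upwards [hmodel', heig] with y hy hab using (hy.eq_semiFlatFrame hab).1
  have him_eq : im =ᶠ[𝓝 x] fun y => -semiFlatFrame (k y.1) (q (s y)) := by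
    filter_upwards [hmodel', heig] with y hy hab using (hy.eq_semiFlatFrame hab).2
  refine ⟨s x, fderiv ℝ s x, rfl, hre_eq.self_of_nhds, him_eq.self_of_nhds, ?_, ?_⟩
  · rw [hre_eq.fderiv_eq]
    exact (hasFDerivAt_semiFlatFrame hk hs).fderiv
  · rw [him_eq.fderiv_eq, ← hqs.fderiv]
    exact (hasFDerivAt_semiFlatFrame hk hqs.differentiableAt).neg.fderiv

/-- Two sections of the `+i`-eigenbundle are `P s - i P (q s)` and `P t - i P (q t)`, with `P` the
semi-flat frame and `q` the quarter turn. Modulo the eigenbundle, only the derivative of `P`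
contributes to their bracket. -/
lemma exists_jetBracket_eigensections_eq (hk : DifferentiableAt ℝ k x.1)
    (hmodel : ∀ᶠ y in 𝓝 x.1, IsSemiFlatModel (J y) (k y))
    {re im re' im' : E × R → (E × R) × (E × R →L[ℝ] ℝ)}
    (hre : DifferentiableAt ℝ re x) (him : DifferentiableAt ℝ im x)
    (hre' : DifferentiableAt ℝ re' x) (him' : DifferentiableAt ℝ im' x)
    (heig : ∀ᶠ y in 𝓝 x, J y.1 (re y) = -im y) (heig' : ∀ᶠ y in 𝓝 x, J y.1 (re' y) = -im' y) :
    ∃ u, jetBracket (re x) (re' x) (fderiv ℝ re x) (fderiv ℝ re' x)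
          - jetBracket (im x) (im' x) (fderiv ℝ im x) (fderiv ℝ im' x) =
        semiFlatFrame (k x.1) u + baseIncl E R
          (frameBracket k x.1 (fibrePart E R (im x)) (fibrePart E R (im' x))
            - frameBracket k x.1 (fibrePart E R (re x)) (fibrePart E R (re' x))) ∧
      jetBracket (re x) (im' x) (fderiv ℝ re x) (fderiv ℝ im' x)
          + jetBracket (im x) (re' x) (fderiv ℝ im x) (fderiv ℝ re' x) =
        -(semiFlatFrame (k x.1) (quarterTurn _ u) + baseIncl E R
          (frameBracket k x.1 (fibrePart E R (im x)) (fibrePart E R (re' x))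
            + frameBracket k x.1 (fibrePart E R (re x)) (fibrePart E R (im' x)))) := by
  obtain ⟨s, S, hs, hre_x, him_x, hdre, hdim⟩ :=
    exists_eigensection_jet_eq hk hmodel hre him heig
  obtain ⟨t, S', ht, hre_x', him_x', hdre', hdim'⟩ :=
    exists_eigensection_jet_eq hk hmodel hre' him' heig'
  have hs_re : fibrePart E R (re x) = s.1 := congrArg Prod.fst hs.symm
  have hs_im : fibrePart E R (im x) = s.2 := congrArg Prod.snd hs.symm
  have ht_re : fibrePart E R (re' x) = t.1 := congrArg Prod.fst ht.symm
  have ht_im : fibrePart E R (im' x) = t.2 := congrArg Prod.snd ht.symm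
  obtain ⟨u, hu_re, hu_im⟩ := exists_jetBracket_comp_eq quarterTurn_quarterTurn
    hmodel.self_of_nhds.genPairing_semiFlatFrame_quarterTurn s t S S'
  rw [hs_re, hs_im, ht_re, ht_im, hdre, hdre', hdim, hdim', hre_x, hre_x', him_x, him_x',
    jetBracket_neg_neg, jetBracket_neg_right, jetBracket_neg_left, jetBracket_semiFlatFrame,
    jetBracket_semiFlatFrame, jetBracket_semiFlatFrame, jetBracket_semiFlatFrame,
    quarterTurn_apply_snd, quarterTurn_apply_snd]
  refine ⟨u, ?_, ?_⟩
  · rw [← hu_re, map_sub]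
    abel
  · rw [← hu_im, map_add]
    abel

lemma apply_jetBracket_eigensections_iff (hk : DifferentiableAt ℝ k x.1)
    (hmodel : ∀ᶠ y in 𝓝 x.1, IsSemiFlatModel (J y) (k y))
    {re im re' im' : E × R → (E × R) × (E × R →L[ℝ] ℝ)}
    (hre : DifferentiableAt ℝ re x) (him : DifferentiableAt ℝ im x)
    (hre' : DifferentiableAt ℝ re' x) (him' : DifferentiableAt ℝ im' x)
    (heig : ∀ᶠ y in 𝓝 x, J y.1 (re y) = -im y) (heig' : ∀ᶠ y in 𝓝 x, J y.1 (re' y) = -im' y) :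
    J x.1 (jetBracket (re x) (re' x) (fderiv ℝ re x) (fderiv ℝ re' x)
          - jetBracket (im x) (im' x) (fderiv ℝ im x) (fderiv ℝ im' x)) =
        -(jetBracket (re x) (im' x) (fderiv ℝ re x) (fderiv ℝ im' x)
          + jetBracket (im x) (re' x) (fderiv ℝ im x) (fderiv ℝ re' x)) ↔
      J x.1 (baseIncl E R
          (frameBracket k x.1 (fibrePart E R (im x)) (fibrePart E R (im' x))
            - frameBracket k x.1 (fibrePart E R (re x)) (fibrePart E R (re' x)))) =
        baseIncl E R
          (frameBracket k x.1 (fibrePart E R (im x)) (fibrePart E R (re' x))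
            + frameBracket k x.1 (fibrePart E R (re x)) (fibrePart E R (im' x))) := by
  obtain ⟨u, hu_re, hu_im⟩ :=
    exists_jetBracket_eigensections_eq hk hmodel hre him hre' him' heig heig'
  rw [hu_re, hu_im, neg_neg, map_add, hmodel.self_of_nhds.apply_semiFlatFrame, add_right_inj]

lemma frameBracket_zero_left (y : E) (d : R × (R →L[ℝ] ℝ)) : frameBracket k y 0 d = 0 := by
  have hvalue : k y 0 = 0 := (k y).map_zero
  have hderiv : (fderiv ℝ k y).flip 0 = 0 := (fderiv ℝ k y).flip.map_zero
  rw [frameBracket, hvalue, hderiv, jetBracket_zero_left]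

lemma frameBracket_zero_right (y : E) (d : R × (R →L[ℝ] ℝ)) : frameBracket k y d 0 = 0 := by
  have hvalue : k y 0 = 0 := (k y).map_zero
  have hderiv : (fderiv ℝ k y).flip 0 = 0 := (fderiv ℝ k y).flip.map_zero
  rw [frameBracket, hvalue, hderiv, jetBracket_zero_right]

end LocalModel

/-! ### Changes of trivialization -/

section Torus

variable {n : ℕ}

lemma torusMk_torusLift (t : StdTorus n) : torusMk (torusLift t) = t :=
  funext fun i => Quotient.out_eq (t i)

lemma torusMk_single_one (i : Fin n) : torusMk (Pi.single i 1 : Fin n → ℝ) = 0 := by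
  funext j
  by_cases h : j = i
  · subst h; simp [torusMk]
  · simp [torusMk, Pi.single_eq_of_ne h]

lemma eq_of_torusMk_eq_of_norm_sub_lt {ξ η : Fin n → ℝ} (h : torusMk ξ = torusMk η)
    (hlt : ‖ξ - η‖ < 1) : ξ = η := by
  funext i
  have hcoe : ((ξ i - η i : ℝ) : UnitAddCircle) = 0 := sub_eq_zero.2 (congrFun h i)
  obtain ⟨k, hk⟩ := (AddCircle.coe_eq_zero_iff (1 : ℝ)).1 hcoe
  have habs : |ξ i - η i| < 1 := (norm_le_pi_norm (ξ - η) i).trans_lt hlt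
  have hk0 : k = 0 := by
    rw [← hk, zsmul_one] at habs
    exact Int.abs_lt_one_iff.1 (by exact_mod_cast habs)
  simpa [hk0, sub_eq_zero, eq_comm] using hk

lemma exists_nat_norm_inv_smul_lt {R : Type*} [NormedAddCommGroup R] [NormedSpace ℝ R] (ξ : R)
    {r : ℝ} (hr : 0 < r) : ∃ N : ℕ, N ≠ 0 ∧ ‖(N : ℝ)⁻¹ • ξ‖ < r := by
  obtain ⟨N, hN⟩ := exists_nat_gt (‖ξ‖ / r)
  have hN0 : (0 : ℝ) < N := lt_of_le_of_lt (by positivity) hN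
  refine ⟨N, by exact_mod_cast hN0.ne', ?_⟩
  rw [norm_smul, norm_inv, Real.norm_natCast, inv_mul_lt_iff₀ hN0]
  rwa [div_lt_iff₀ hr] at hN

/-- Additivity on a ball gives `N g (ξ / N) = g ξ`, and the left side tends to the derivative. -/
lemma eq_fderiv_of_locally_additive {R T : Type*} [NormedAddCommGroup R] [NormedSpace ℝ R]
    [NormedAddCommGroup T] [NormedSpace ℝ T] {g : R → T} {r : ℝ}
    (hadd : ∀ ξ η, ‖ξ‖ < r → ‖η‖ < r → g (ξ + η) = g ξ + g η)
    (hd : DifferentiableAt ℝ g 0) {ξ : R} (hξ : ‖ξ‖ < r) : g ξ = fderiv ℝ g 0 ξ := by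
  have hr : ‖(0 : R)‖ < r := by simpa using (norm_nonneg ξ).trans_lt hξ
  have hg0 : g 0 = 0 := by simpa using hadd 0 0 hr hr
  have hscale (N : ℕ) : ((N + 1 : ℕ) : ℝ) • g (((N + 1 : ℕ) : ℝ)⁻¹ • ξ) = g ξ := by
    have hsmall (t : ℝ) (h0 : 0 ≤ t) (h1 : t ≤ 1) : ‖t • ξ‖ < r := by
      rw [norm_smul, Real.norm_of_nonneg h0]
      exact (mul_le_of_le_one_left (norm_nonneg _) h1).trans_lt hξ
    have hmul (j : ℕ) (hj : j ≤ N + 1) : g ((j * ((N + 1 : ℕ) : ℝ)⁻¹) • ξ) =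
        (j : ℝ) • g (((N + 1 : ℕ) : ℝ)⁻¹ • ξ) := by
      induction j with
      | zero => simp [hg0]
      | succ j ih =>
        have hj' : (j : ℝ) ≤ (N + 1 : ℕ) := by exact_mod_cast (Nat.le_succ j).trans hj
        rw [Nat.cast_succ, add_mul, add_smul, one_mul,
          hadd _ _ (hsmall _ (by positivity) (mul_inv_le_one_of_le₀ hj' (by positivity)))
            (hsmall _ (by positivity) (Nat.cast_inv_le_one _)),
          ih ((Nat.le_succ j).trans hj), add_smul, one_smul]
    rw [← hmul (N + 1) le_rfl, mul_inv_cancel₀ (by positivity), one_smul]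
  have hlim := hd.hasFDerivAt.lim ξ (c := fun N : ℕ => ((N + 1 : ℕ) : ℝ)) (l := Filter.atTop)
    (by simpa only [Real.norm_natCast] using
      (Filter.tendsto_add_atTop_iff_nat 1).2 tendsto_natCast_atTop_atTop)
  simp only [zero_add, hg0, sub_zero, hscale] at hlim
  exact tendsto_nhds_unique tendsto_const_nhds hlim

lemma exists_linear_lift_of_local_lift {R : Type*} [NormedAddCommGroup R] [NormedSpace ℝ R]
    (τ : R →+ StdTorus n) {g : R → Fin n → ℝ} {r : ℝ} (hr : 0 < r)
    (hlift : ∀ ξ, ‖ξ‖ < r → ‖g ξ‖ < 1 / 4 ∧ τ ξ = torusMk (g ξ))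
    (hd : DifferentiableAt ℝ g 0) :
    ∃ A : R →L[ℝ] (Fin n → ℝ), (∀ ξ, ‖ξ‖ < r / 2 → g ξ = A ξ) ∧ ∀ ξ, τ ξ = torusMk (A ξ) := by
  have hlinear (ξ : R) (hξ : ‖ξ‖ < r / 2) : g ξ = fderiv ℝ g 0 ξ := by
    refine eq_fderiv_of_locally_additive (fun ξ η hξ hη => ?_) hd hξ
    obtain ⟨hsmall, hτ⟩ := hlift ξ (by linarith)
    obtain ⟨hsmall', hτ'⟩ := hlift η (by linarith)
    obtain ⟨hsmall'', hτ''⟩ := hlift (ξ + η) ((norm_add_le _ _).trans_lt (by linarith))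
    refine eq_of_torusMk_eq_of_norm_sub_lt ?_ ((norm_sub_le _ _).trans_lt ?_)
    · rw [← hτ'', map_add, hτ, hτ']; rfl
    · linarith [norm_add_le (g ξ) (g η)]
  refine ⟨fderiv ℝ g 0, hlinear, fun ξ => ?_⟩
  obtain ⟨N, hN0, hNr⟩ := exists_nat_norm_inv_smul_lt ξ (half_pos hr)
  have hξ : ξ = N • ((N : ℝ)⁻¹ • ξ) := by
    rw [← Nat.cast_smul_eq_nsmul ℝ, smul_smul, mul_inv_cancel₀ (by exact_mod_cast hN0), one_smul]
  rw [hξ, map_nsmul, map_nsmul, (hlift _ (by linarith)).2, hlinear _ hNr]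
  rfl

end Torus

namespace TorusBundle

variable {n : ℕ} {E : Type*} [NormedAddCommGroup E] [NormedSpace ℝ E]
  {F : Type*} [NormedAddCommGroup F] [NormedSpace ℝ F]
  {M : Type*} [TopologicalSpace M] [ChartedSpace E M]
  {Z : Type*} [TopologicalSpace Z] [ChartedSpace F Z]
  {B : TorusBundle n E F M Z} {e e' : Trivialization (StdTorus n) B.proj} {m : M}

lemma param_eq_iff (hm : m ∈ e.baseSet) (hm' : m ∈ e'.baseSet) {ξ ξ' : Fin n → ℝ} :
    B.param e (m, ξ) = B.param e' (m, ξ') ↔ (e' (B.param e (m, ξ))).2 = torusMk ξ' := by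
  have happly : e' (B.param e' (m, ξ')) = (m, torusMk ξ') := e'.apply_symm_apply' hm'
  have hmem : B.param e (m, ξ) ∈ e'.source := by
    rwa [e'.mem_source, B.proj_param hm]
  refine ⟨fun h => by rw [h, happly], fun h => ?_⟩
  refine e'.injOn hmem (e'.mem_source.2 (by rwa [B.proj_param hm'])) (Eq.trans ?_ happly.symm)
  exact Prod.ext ((e'.coe_fst hmem).trans (B.proj_param hm ξ)) h

lemma param_torusLift {z : Z} (hz : B.proj z ∈ e.baseSet) :
    B.param e (B.proj z, torusLift (e z).2) = z := by
  have hmem : z ∈ e.source := e.mem_source.2 hz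
  refine Eq.trans ?_ (e.toOpenPartialHomeomorph.left_inv hmem)
  rw [param, torusMk_torusLift]
  exact congrArg _ (Prod.ext (e.coe_fst hmem).symm rfl)

lemma isLocalDiffeomorphAt_param (he : e ∈ B.atlas) (hm : m ∈ e.baseSet) (ξ : Fin n → ℝ) :
    IsLocalDiffeomorphAt (𝓘(ℝ, E).prod 𝓘(ℝ, Fin n → ℝ)) 𝓘(ℝ, F) ∞ (B.param e) (m, ξ) :=
  B.isLocalDiffeomorphOn e he ⟨(m, ξ), hm, mem_univ _⟩

/-- The change of trivialization on the fibre at `m`, as a homomorphism from the universal covering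
of the torus. -/
def transition (he : e ∈ B.atlas) (he' : e' ∈ B.atlas) (hm : m ∈ e.baseSet)
    (hm' : m ∈ e'.baseSet) : (Fin n → ℝ) →+ StdTorus n :=
  AddMonoidHom.mk' (fun ξ => (e' (B.param e (m, ξ))).2) fun ξ η =>
    B.transition_add e he e' he' m ⟨hm, hm'⟩ (torusMk ξ) (torusMk η)

lemma transition_of_torusMk_eq_zero (he : e ∈ B.atlas) (he' : e' ∈ B.atlas) (hm : m ∈ e.baseSet)
    (hm' : m ∈ e'.baseSet) {ξ : Fin n → ℝ} (hξ : torusMk ξ = 0) :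
    transition he he' hm hm' ξ = 0 := by
  have hparam : B.param e (m, ξ) = B.param e (m, 0) := by
    rw [param, param, hξ]; rfl
  exact (congrArg (fun z => (e' z).2) hparam).trans (map_zero (transition he he' hm hm'))

/-- The lift is the second component of a local inverse of `B.param e'` near the zero section,
composed with `B.param e`. -/
lemma exists_local_lift_transition (he : e ∈ B.atlas) (he' : e' ∈ B.atlas) (hm : m ∈ e.baseSet)
    (hm' : m ∈ e'.baseSet) : ∃ γ : M × (Fin n → ℝ) → (Fin n → ℝ), γ (m, 0) = 0 ∧
      ∀ᶠ x in 𝓝 (m, 0),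
        ContMDiffAt (𝓘(ℝ, E).prod 𝓘(ℝ, Fin n → ℝ)) 𝓘(ℝ, Fin n → ℝ) ∞ γ x ∧
        (e' (B.param e x)).2 = torusMk (γ x) := by
  have hdiffeo := isLocalDiffeomorphAt_param he' hm' 0
  let Θ := hdiffeo.localInverse
  have hzero : B.param e (m, 0) = B.param e' (m, 0) := by
    rw [B.param_zero he hm, B.param_zero he' hm']
  have hparam := (isLocalDiffeomorphAt_param he hm 0).contMDiffAt.continuousAt.tendsto
  rw [hzero] at hparam
  refine ⟨fun x => (Θ (B.param e x)).2, ?_, ?_⟩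
  · simp only [hzero, Θ, localInverse_apply_self]
  filter_upwards [hparam.eventually (Θ.open_source.mem_nhds hdiffeo.localInverse_mem_source),
    (((tendsto_localInverse hdiffeo).comp hparam).eventually
      (continuousAt_fst.eventually (e'.open_baseSet.mem_nhds hm'))),
    continuousAt_fst.eventually (e.open_baseSet.mem_nhds hm)] with x hsource hbase' hbase
  have hΘ := hdiffeo.localInverse_contMDiffOn.contMDiffAt (Θ.open_source.mem_nhds hsource)
  refine ⟨(hΘ.comp x (isLocalDiffeomorphAt_param he hbase x.2).contMDiffAt).snd, ?_⟩
  have hright : B.param e' (Θ (B.param e x)) = B.param e x :=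
    hdiffeo.localInverse_right_inv hsource
  have hfst : (Θ (B.param e x)).1 = x.1 := by
    rw [← B.proj_param hbase x.2, ← B.proj_param (m := (Θ (B.param e x)).1) hbase']
    exact congrArg B.proj hright
  refine (param_eq_iff (ξ := x.2) hbase (hfst ▸ hbase')).1 (hright.symm.trans ?_)
  exact congrArg (B.param e') (Prod.ext hfst rfl)

lemma exists_continuousAt_linear_lift_transition (he : e ∈ B.atlas) (he' : e' ∈ B.atlas)
    (hm : m ∈ e.baseSet) (hm' : m ∈ e'.baseSet) :
    ∃ A : M → (Fin n → ℝ) →L[ℝ] (Fin n → ℝ), (∀ ξ, ContinuousAt (fun m => A m ξ) m) ∧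
      ∀ᶠ m in 𝓝 m, ∀ ξ, (e' (B.param e (m, ξ))).2 = torusMk (A m ξ) := by
  obtain ⟨γ, hγ0, hγ⟩ := exists_local_lift_transition he he' hm hm'
  have hsmall : ∀ᶠ x in 𝓝 (m, 0), ‖γ x‖ < 1 / 4 :=
    hγ.self_of_nhds.1.continuousAt.norm.eventually (Iio_mem_nhds (by simp [hγ0]))
  have hball := hγ.and hsmall
  rw [nhds_prod_eq, Metric.eventually_prod_nhds_iff] at hball
  obtain ⟨P, hP, r, hr, hball⟩ := hball
  simp only [dist_zero_right] at hball
  have hlinear : ∀ᶠ m' in 𝓝 m, ∃ A : (Fin n → ℝ) →L[ℝ] (Fin n → ℝ),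
      (∀ ξ, ‖ξ‖ < r / 2 → γ (m', ξ) = A ξ) ∧
        ∀ ξ, (e' (B.param e (m', ξ))).2 = torusMk (A ξ) := by
    filter_upwards [hP, e.open_baseSet.mem_nhds hm, e'.open_baseSet.mem_nhds hm'] with m' hPm hb hb'
    refine exists_linear_lift_of_local_lift (transition he he' hb hb') hr
      (fun ξ hξ => ⟨(hball hPm hξ).2, (hball hPm hξ).1.2⟩) ?_
    have hsmooth : ContMDiffAt 𝓘(ℝ, Fin n → ℝ) 𝓘(ℝ, Fin n → ℝ) ∞ (fun ξ => γ (m', ξ)) 0 :=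
      ContMDiffAt.comp 0 (hball hPm (by simpa using hr)).1.1
        (contMDiffAt_const.prodMk contMDiffAt_id)
    exact hsmooth.contDiffAt.differentiableAt (by simp)
  choose! A hA using fun m' (h : ∃ A : (Fin n → ℝ) →L[ℝ] (Fin n → ℝ),
      (∀ ξ, ‖ξ‖ < r / 2 → γ (m', ξ) = A ξ) ∧
        ∀ ξ, (e' (B.param e (m', ξ))).2 = torusMk (A ξ)) => h
  refine ⟨A, fun ξ => ?_, hlinear.mono fun m' h => (hA m' h).2⟩
  obtain ⟨N, hN0, hNr⟩ := exists_nat_norm_inv_smul_lt ξ (half_pos hr)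
  have hcont : ContinuousAt (fun m' => (N : ℝ) • γ (m', (N : ℝ)⁻¹ • ξ)) m :=
    ((hball hP.self_of_nhds (by linarith)).1.1.continuousAt.comp
      (f := fun m' => (m', (N : ℝ)⁻¹ • ξ)) (by fun_prop)).const_smul (N : ℝ)
  refine hcont.congr (hlinear.mono fun m' h => ?_)
  beta_reduce
  rw [(hA m' h).1 _ hNr, map_smul, smul_smul, mul_inv_cancel₀ (by exact_mod_cast hN0), one_smul]

/-- A continuous family of matrices in `GL(n, ℤ)` is locally constant. -/
lemma exists_transition (he : e ∈ B.atlas) (he' : e' ∈ B.atlas) (hm : m ∈ e.baseSet)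
    (hm' : m ∈ e'.baseSet) : ∃ A : (Fin n → ℝ) →L[ℝ] (Fin n → ℝ), ∀ᶠ m in 𝓝 m,
      m ∈ e.baseSet ∧ m ∈ e'.baseSet ∧ ∀ ξ, (e' (B.param e (m, ξ))).2 = torusMk (A ξ) := by
  obtain ⟨A, hcont, hA⟩ := exists_continuousAt_linear_lift_transition he he' hm hm'
  have hbase := e.open_baseSet.mem_nhds hm
  have hbase' := e'.open_baseSet.mem_nhds hm'
  have hint : ∀ᶠ m' in 𝓝 m, ∀ i, torusMk (A m' (Pi.single i 1)) = 0 := by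
    filter_upwards [hA, hbase, hbase'] with m' h hb hb' i
    rw [← h]
    exact transition_of_torusMk_eq_zero he he' hb hb' (torusMk_single_one i)
  have hclose : ∀ᶠ m' in 𝓝 m, ∀ i, ‖A m' (Pi.single i 1) - A m (Pi.single i 1)‖ < 1 :=
    Filter.eventually_all.2 fun i =>
      ((hcont _).sub continuousAt_const).norm.eventually (Iio_mem_nhds (by simp))
  refine ⟨A m, ?_⟩
  filter_upwards [hA, hbase, hbase', hint, hclose] with m' h hb hb' hint' hclose'
  have hconst : A m' = A m := by
    refine ContinuousLinearMap.coe_injective (LinearMap.pi_ext' fun i => LinearMap.ext_ring ?_)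
    exact eq_of_torusMk_eq_of_norm_sub_lt ((hint' i).trans (hint.self_of_nhds i).symm) (hclose' i)
  exact ⟨hb, hb', fun ξ => hconst ▸ h ξ⟩

end TorusBundle

lemma eventually_eq_of_mfderiv_eq_zero {E : Type*} [NormedAddCommGroup E] [NormedSpace ℝ E]
    {M : Type*} [TopologicalSpace M] [ChartedSpace E M] [IsManifold 𝓘(ℝ, E) ∞ M] {m : M}
    {R : Type*} [NormedAddCommGroup R] [NormedSpace ℝ R] {c : M → R}
    (hd : ∀ᶠ m' in 𝓝 m, MDifferentiableAt 𝓘(ℝ, E) 𝓘(ℝ, R) c m' ∧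
      mfderiv 𝓘(ℝ, E) 𝓘(ℝ, R) c m' = 0) : ∀ᶠ m' in 𝓝 m, c m' = c m := by
  let χ := extChartAt 𝓘(ℝ, E) m
  have hderiv : ∀ᶠ u in 𝓝 (χ m), HasFDerivAt (c ∘ χ.symm) (0 : E →L[ℝ] R) u := by
    have hpull := (continuousAt_extChartAt_symm (I := 𝓘(ℝ, E)) m).eventually
      (by rwa [extChartAt_to_inv])
    filter_upwards [extChartAt_target_mem_nhds m, hpull] with u hu hzero
    have hsymm : MDifferentiableAt 𝓘(ℝ, E) 𝓘(ℝ, E) χ.symm u :=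
      (isLocalDiffeomorphAt_extChartAt_symm hu).mdifferentiableAt (by simp)
    have hchain := HasMFDerivAt.comp u hzero.1.hasMFDerivAt hsymm.hasMFDerivAt
    rw [hzero.2] at hchain
    exact hchain.hasFDerivAt
  obtain ⟨r, hr, hball⟩ := Metric.mem_nhds_iff.1 hderiv
  filter_upwards [(continuousAt_extChartAt (I := 𝓘(ℝ, E)) m).preimage_mem_nhds
    (Metric.ball_mem_nhds _ hr), extChartAt_source_mem_nhds (I := 𝓘(ℝ, E)) m] with m' hm' hsource
  have hconst := Metric.isOpen_ball.is_const_of_fderiv_eq_zero (convex_ball _ _).isPreconnected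
    (fun u hu => (hball hu).differentiableAt.differentiableWithinAt)
    (fun u hu => (hball hu).fderiv) hm' (Metric.mem_ball_self hr)
  exact ((congrArg c (χ.left_inv hsource)).symm.trans hconst).trans
    (congrArg c (χ.left_inv (mem_extChartAt_source m)))

namespace TorusBundle

variable {n : ℕ} {E : Type*} [NormedAddCommGroup E] [NormedSpace ℝ E]
  {F : Type*} [NormedAddCommGroup F] [NormedSpace ℝ F]
  {M : Type*} [TopologicalSpace M] [ChartedSpace E M]
  {Z : Type*} [TopologicalSpace Z] [ChartedSpace F Z]
  {B : TorusBundle n E F M Z} {e e' : Trivialization (StdTorus n) B.proj} {m : M}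

lemma dParam_eq_of_eventually (he' : e' ∈ B.atlas) (hm' : m ∈ e'.baseSet)
    {A : (Fin n → ℝ) →L[ℝ] (Fin n → ℝ)} {ξ k : Fin n → ℝ}
    (h : ∀ᶠ x in 𝓝 (m, ξ), B.param e x = B.param e' (x.1, A x.2 + k)) (v : E) (s : Fin n → ℝ) :
    (B.dParam e m ξ (v, s) : F) = B.dParam e' m (A ξ + k) (v, A s) := by
  have hlift : HasMFDerivAt (𝓘(ℝ, E).prod 𝓘(ℝ, Fin n → ℝ)) 𝓘(ℝ, Fin n → ℝ)
      (fun x : M × (Fin n → ℝ) => A x.2 + k) (m, ξ)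
      (A.comp (ContinuousLinearMap.snd ℝ E (Fin n → ℝ))) :=
    HasMFDerivAt.comp (I' := 𝓘(ℝ, Fin n → ℝ)) (g := fun ξ => A ξ + k) (m, ξ)
      ((A.hasFDerivAt (x := ξ)).add_const k).hasMFDerivAt (hasMFDerivAt_snd (m, ξ))
  have hparam' := (isLocalDiffeomorphAt_param he' hm' (A ξ + k)).mdifferentiableAt (by simp)
  have hchain := HasMFDerivAt.comp (m, ξ) hparam'.hasMFDerivAt
    ((hasMFDerivAt_fst (I := 𝓘(ℝ, E)) (I' := 𝓘(ℝ, Fin n → ℝ)) (m, ξ)).prodMk hlift)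
  have heq : B.param e =ᶠ[𝓝 (m, ξ)] B.param e' ∘ fun x => (x.1, A x.2 + k) := h
  have hderiv := (heq.mfderiv_eq (I := 𝓘(ℝ, E).prod 𝓘(ℝ, Fin n → ℝ))
    (I' := 𝓘(ℝ, F))).trans hchain.mfderiv
  exact DFunLike.congr_fun hderiv ((v, s) : E × (Fin n → ℝ))

lemma exists_dParam_transition (he : e ∈ B.atlas) (he' : e' ∈ B.atlas) (hm : m ∈ e.baseSet)
    (hm' : m ∈ e'.baseSet) : ∃ A : (Fin n → ℝ) →L[ℝ] (Fin n → ℝ), ∀ᶠ m in 𝓝 m,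
      ∀ ξ ξ', B.param e (m, ξ) = B.param e' (m, ξ') → ∀ (v : E) (s : Fin n → ℝ),
        (B.dParam e m ξ (v, s) : F) = B.dParam e' m ξ' (v, A s) := by
  obtain ⟨A, hA⟩ := exists_transition he he' hm hm'
  refine ⟨A, ?_⟩
  filter_upwards [eventually_eventually_nhds.2 hA] with m₁ hev ξ ξ' hξ v s
  obtain ⟨hb, hb', htrans⟩ := hev.self_of_nhds
  have hmk (η : Fin n → ℝ) : torusMk (A η + (ξ' - A ξ)) = torusMk (A η) := by
    have hξ' : torusMk (A ξ) = torusMk ξ' := (htrans ξ).symm.trans ((param_eq_iff hb hb').1 hξ)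
    funext i
    have hi : ((A ξ i : ℝ) : UnitAddCircle) = (ξ' i : ℝ) := congrFun hξ' i
    simp [torusMk, hi]
  have heq : ∀ᶠ x in 𝓝 (m₁, ξ), B.param e x = B.param e' (x.1, A x.2 + (ξ' - A ξ)) := by
    filter_upwards [continuousAt_fst.eventually hev] with x hx
    exact (param_eq_iff hx.1 hx.2.1).2 ((hx.2.2 x.2).trans (hmk x.2).symm)
  have hderiv := dParam_eq_of_eventually he' hb' heq v s
  rwa [add_sub_cancel] at hderiv

lemma isInvertible_dParam (he : e ∈ B.atlas) (hm : m ∈ e.baseSet) (ξ : Fin n → ℝ) :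
    (B.dParam e m ξ).IsInvertible :=
  isInvertible_mfderiv (isLocalDiffeomorphAt_param he hm ξ) (by simp)

lemma mfderiv_proj_dParam_apply (he : e ∈ B.atlas) (hm : m ∈ e.baseSet) (ξ s : Fin n → ℝ)
    (v : E) :
    (mfderiv 𝓘(ℝ, F) 𝓘(ℝ, E) B.proj (B.param e (m, ξ)) (B.dParam e m ξ (v, s)) : E) = v := by
  have hchain := mfderiv_comp (m, ξ)
    (B.contMDiff_proj.mdifferentiableAt (x := B.param e (m, ξ)) (by simp))
    ((isLocalDiffeomorphAt_param he hm ξ).mdifferentiableAt (by simp))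
  have hfst : (B.proj ∘ B.param e) =ᶠ[𝓝 (m, ξ)] Prod.fst := by
    filter_upwards [continuousAt_fst.eventually (e.open_baseSet.mem_nhds hm)] with x hx
    exact B.proj_param hx x.2
  rw [hfst.mfderiv_eq, mfderiv_fst] at hchain
  exact (DFunLike.congr_fun hchain ((v, s) : E × (Fin n → ℝ))).symm

/-! ### Flat frames -/

/-- `B.coord e m` as a continuous linear map. -/
def coordCLM (e : Trivialization (StdTorus n) B.proj) (m : M) : B.V m →L[ℝ] (Fin n → ℝ) :=
  ((ContinuousLinearMap.snd ℝ E (Fin n → ℝ)).comp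
    ((B.dParam e m 0).inverse : F →L[ℝ] E × (Fin n → ℝ))).comp ((B.V m).subtypeL : B.V m →L[ℝ] F)

/-- The frame of `V` at `m` given by the local trivialization `e`; it is flat as `m` varies over the
base of `e`. It is defined as the inverse of the coordinates, which makes it total in `m`. -/
def flatFrame (e : Trivialization (StdTorus n) B.proj) (m : M) : (Fin n → ℝ) →L[ℝ] B.V m :=
  (coordCLM e m).inverse

lemma coordCLM_of_coe_eq (he : e ∈ B.atlas) (hm : m ∈ e.baseSet) {u : B.V m} {v : E}
    {s : Fin n → ℝ} (hu : (u.1 : F) = B.dParam e m 0 (v, s)) : coordCLM e m u = s :=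
  (congrArg (fun w : F => ((B.dParam e m 0).inverse w).2) hu).trans
    (congrArg Prod.snd
      ((isInvertible_dParam he hm 0).inverse_apply_self ((v, s) : E × (Fin n → ℝ))))

lemma coe_eq_dParam_coordCLM (he : e ∈ B.atlas) (hm : m ∈ e.baseSet) (u : B.V m) :
    (u.1 : F) = B.dParam e m 0 (0, coordCLM e m u) := by
  let w : E × (Fin n → ℝ) := (B.dParam e m 0).inverse (u.1 : F)
  have hw : (B.dParam e m 0 w : F) = u.1 :=
    (isInvertible_dParam he hm 0).self_apply_inverse (u.1 : F)
  have hvert : mfderiv 𝓘(ℝ, F) 𝓘(ℝ, E) B.proj (B.param e (m, 0)) (u.1 : F) = (0 : E) := by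
    have hker : ∀ z, z = B.zero m → mfderiv 𝓘(ℝ, F) 𝓘(ℝ, E) B.proj z (u.1 : F) = (0 : E) := by
      rintro z rfl; exact u.2
    exact hker _ (B.param_zero he hm)
  have hfst : w.1 = 0 := (mfderiv_proj_dParam_apply he hm 0 w.2 w.1).symm.trans
    ((congrArg (mfderiv 𝓘(ℝ, F) 𝓘(ℝ, E) B.proj (B.param e (m, 0))) hw).trans hvert)
  exact hw.symm.trans (congrArg (B.dParam e m 0) (Prod.ext hfst rfl))

lemma isInvertible_coordCLM (he : e ∈ B.atlas) (hm : m ∈ e.baseSet) :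
    (coordCLM e m).IsInvertible := by
  have hvert (s : Fin n → ℝ) : (B.dParam e m 0 (0, s) : F) ∈ B.V m := by
    have hker := B.mfderiv_proj_dParam he hm 0 s
    rwa [B.param_zero he hm] at hker
  let frame : (Fin n → ℝ) →L[ℝ] B.V m := ((B.dParam e m 0).comp
    (ContinuousLinearMap.inr ℝ _ _) : (Fin n → ℝ) →L[ℝ] F).codRestrict (B.V m) hvert
  exact ⟨ContinuousLinearEquiv.equivOfInverse (coordCLM e m) frame
    (fun u => Subtype.ext (coe_eq_dParam_coordCLM he hm u).symm)
    (fun s => coordCLM_of_coe_eq he hm (u := frame s) (v := 0) rfl), rfl⟩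

lemma coordCLM_flatFrame (he : e ∈ B.atlas) (hm : m ∈ e.baseSet) (s : Fin n → ℝ) :
    coordCLM e m (flatFrame e m s) = s :=
  (isInvertible_coordCLM he hm).self_apply_inverse s

lemma flatFrame_coordCLM (he : e ∈ B.atlas) (hm : m ∈ e.baseSet) (u : B.V m) :
    flatFrame e m (coordCLM e m u) = u :=
  (isInvertible_coordCLM he hm).inverse_apply_self u

lemma coe_flatFrame (he : e ∈ B.atlas) (hm : m ∈ e.baseSet) (s : Fin n → ℝ) :
    ((flatFrame e m s).1 : F) = B.dParam e m 0 (0, s) := by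
  rw [coe_eq_dParam_coordCLM he hm (flatFrame e m s), coordCLM_flatFrame he hm]

variable (B) in
lemma frame_eq_flatFrame (m : M) : B.frame m = flatFrame (B.trivAt m) m :=
  ContinuousLinearMap.ext fun s =>
    Subtype.ext (coe_flatFrame (B.trivAt_mem_atlas m) (B.mem_baseSet_trivAt m) s).symm

lemma exists_coordCLM_transition (he : e ∈ B.atlas) (he' : e' ∈ B.atlas) (hm : m ∈ e.baseSet)
    (hm' : m ∈ e'.baseSet) : ∃ A : (Fin n → ℝ) →L[ℝ] (Fin n → ℝ),
      ∀ᶠ m in 𝓝 m, ∀ u, coordCLM e' m u = A (coordCLM e m u) := by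
  obtain ⟨A, hA⟩ := exists_dParam_transition he he' hm hm'
  refine ⟨A, ?_⟩
  filter_upwards [hA, e.open_baseSet.mem_nhds hm, e'.open_baseSet.mem_nhds hm'] with m₁ h hb hb' u
  refine coordCLM_of_coe_eq (v := 0) he' hb' ((coe_eq_dParam_coordCLM he hb u).trans ?_)
  exact h 0 0 ((B.param_zero he hb).trans (B.param_zero he' hb').symm) 0 _

lemma eventually_mfderiv_snd_localInverse_param (he : e ∈ B.atlas) (hm : m ∈ e.baseSet) :
    ∀ᶠ m' in 𝓝 m, ∀ u : B.V m', (mfderiv 𝓘(ℝ, F) 𝓘(ℝ, Fin n → ℝ)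
      (fun z => ((isLocalDiffeomorphAt_param he hm 0).localInverse z).2) (B.zero m') u.1 :
        Fin n → ℝ) = coordCLM e m' u := by
  have hdiffeo := isLocalDiffeomorphAt_param he hm 0
  let Θ := hdiffeo.localInverse
  have hdomain : ∀ᶠ x in 𝓝 (m, (0 : Fin n → ℝ)), x ∈ Θ.target ∧ B.param e x ∈ Θ.source :=
    Filter.Eventually.and (Θ.open_target.mem_nhds hdiffeo.localInverse_mem_target)
      (hdiffeo.contMDiffAt.continuousAt.eventually
        (Θ.open_source.mem_nhds hdiffeo.localInverse_mem_source))
  filter_upwards [e.open_baseSet.mem_nhds hm,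
    (Continuous.prodMk_left (0 : Fin n → ℝ)).continuousAt.eventually hdomain]
    with m' hm' hmem u
  let q : Z → Fin n → ℝ := fun z => (Θ z).2
  have hq : MDifferentiableAt 𝓘(ℝ, F) 𝓘(ℝ, Fin n → ℝ) q (B.param e (m', 0)) :=
    (hdiffeo.localInverse_contMDiffOn.contMDiffAt
      (Θ.open_source.mem_nhds hmem.2)).snd.mdifferentiableAt (by simp)
  have hchain := mfderiv_comp (m', (0 : Fin n → ℝ)) hq
    ((isLocalDiffeomorphAt_param he hm' 0).mdifferentiableAt (by simp))
  have hsnd : (q ∘ B.param e) =ᶠ[𝓝 (m', 0)] Prod.snd := by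
    filter_upwards [Θ.open_target.mem_nhds hmem.1] with x hx
    exact congrArg Prod.snd (hdiffeo.localInverse_left_inv hx)
  rw [hsnd.mfderiv_eq, mfderiv_snd] at hchain
  have hbase : ∀ z, z = B.zero m' → (mfderiv 𝓘(ℝ, F) 𝓘(ℝ, Fin n → ℝ) q (B.zero m') u.1 :
      Fin n → ℝ) = mfderiv 𝓘(ℝ, F) 𝓘(ℝ, Fin n → ℝ) q z (u.1 : F) := by
    rintro z rfl; rfl
  exact ((hbase _ (B.param_zero he hm')).trans
    (congrArg (mfderiv 𝓘(ℝ, F) 𝓘(ℝ, Fin n → ℝ) q (B.param e (m', 0)))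
      (coe_eq_dParam_coordCLM he hm' u))).trans
    (DFunLike.congr_fun hchain ((0, coordCLM e m' u) : E × (Fin n → ℝ))).symm

variable [IsManifold 𝓘(ℝ, E) ∞ M] [IsManifold 𝓘(ℝ, F) ∞ Z]

lemma contMDiffAt_coordCLM (he : e ∈ B.atlas) {U : Set M} (hU : IsOpen U) {σ : ∀ m, B.V m}
    (hσ : B.SmoothVOn U σ) (hmU : m ∈ U) (hm : m ∈ e.baseSet) :
    ContMDiffAt 𝓘(ℝ, E) 𝓘(ℝ, Fin n → ℝ) ∞ (fun m' => coordCLM e m' (σ m')) m := by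
  have hdiffeo := isLocalDiffeomorphAt_param he hm 0
  have hq : ContMDiffAt 𝓘(ℝ, F) 𝓘(ℝ, Fin n → ℝ) ∞ (fun z => (hdiffeo.localInverse z).2)
      (B.zero m) := by
    rw [← B.param_zero he hm]
    exact (hdiffeo.localInverse_contMDiffOn.contMDiffAt
      (hdiffeo.localInverse.open_source.mem_nhds hdiffeo.localInverse_mem_source)).snd
  have hfield := contMDiffAt_mfderiv_vectorField hq (hσ.contMDiffAt (hU.mem_nhds hmU))
  refine ((contMDiff_snd_tangentBundle_modelSpace (n := ∞) (Fin n → ℝ)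
    𝓘(ℝ, Fin n → ℝ)).contMDiffAt.comp m hfield).congr_of_eventuallyEq ?_
  filter_upwards [eventually_mfderiv_snd_localInverse_param he hm] with m' hm'
  exact (hm' (σ m')).symm

lemma smoothVOn_flatFrame (he : e ∈ B.atlas) (s : Fin n → ℝ) :
    B.SmoothVOn e.baseSet (fun m => flatFrame e m s) := by
  intro m hm
  have hzero : ContMDiff 𝓘(ℝ, E) 𝓘(ℝ, E).tangent ∞
      (fun m : M => (⟨m, 0⟩ : TangentBundle 𝓘(ℝ, E) M)) :=
    Bundle.contMDiff_zeroSection ℝ (TangentSpace 𝓘(ℝ, E) : M → Type _)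
  have hconst : ContMDiff 𝓘(ℝ, E) 𝓘(ℝ, Fin n → ℝ).tangent ∞
      (fun _ : M => (⟨0, s⟩ : TangentBundle 𝓘(ℝ, Fin n → ℝ) (Fin n → ℝ))) := contMDiff_const
  have hfield : ContMDiff 𝓘(ℝ, E) (𝓘(ℝ, E).prod 𝓘(ℝ, Fin n → ℝ)).tangent ∞
      (fun m : M => (⟨(m, 0), (0, s)⟩ :
        TangentBundle (𝓘(ℝ, E).prod 𝓘(ℝ, Fin n → ℝ)) (M × (Fin n → ℝ)))) :=
    contMDiff_equivTangentBundleProd_symm.comp (hzero.prodMk hconst)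
  refine (contMDiffAt_mfderiv_vectorField (g := fun m => (m, (0 : Fin n → ℝ)))
    (isLocalDiffeomorphAt_param he hm 0).contMDiffAt
    hfield.contMDiffAt).contMDiffWithinAt.congr_of_mem (fun m' hm' => ?_) hm
  exact Bundle.TotalSpace.ext (B.param_zero he hm').symm (heq_of_eq (coe_flatFrame he hm' s))

lemma mfderiv_coordCLM_eq_zero_of_transition (he : e ∈ B.atlas) (he' : e' ∈ B.atlas) {U : Set M}
    (hU : IsOpen U) {σ : ∀ m, B.V m} (hσ : B.SmoothVOn U σ) (hmU : m ∈ U) (hm : m ∈ e.baseSet)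
    (hm' : m ∈ e'.baseSet)
    (hzero : mfderiv 𝓘(ℝ, E) 𝓘(ℝ, Fin n → ℝ) (fun m' => coordCLM e m' (σ m')) m = 0) :
    mfderiv 𝓘(ℝ, E) 𝓘(ℝ, Fin n → ℝ) (fun m' => coordCLM e' m' (σ m')) m = 0 := by
  obtain ⟨A, hA⟩ := exists_coordCLM_transition he he' hm hm'
  have heq : (fun m' => coordCLM e' m' (σ m')) =ᶠ[𝓝 m] A ∘ fun m' => coordCLM e m' (σ m') :=
    hA.mono fun m' h => h (σ m')
  have hderiv := (contMDiffAt_coordCLM he hU hσ hmU hm).mdifferentiableAt (by simp)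
  rw [heq.mfderiv_eq, mfderiv_comp m
    (A.differentiableAt (x := coordCLM e m (σ m))).mdifferentiableAt hderiv, hzero]
  exact ContinuousLinearMap.comp_zero _

lemma gaussManin_eq_zero_iff (he : e ∈ B.atlas) {U : Set M} (hU : IsOpen U) {σ : ∀ m, B.V m}
    (hσ : B.SmoothVOn U σ) (hmU : m ∈ U) (hm : m ∈ e.baseSet) :
    B.gaussManin σ m = 0 ↔
      mfderiv 𝓘(ℝ, E) 𝓘(ℝ, Fin n → ℝ) (fun m' => coordCLM e m' (σ m')) m = 0 := by
  have he₀ := B.trivAt_mem_atlas m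
  have hm₀ := B.mem_baseSet_trivAt m
  have hcentre : B.gaussManin σ m = 0 ↔
      mfderiv 𝓘(ℝ, E) 𝓘(ℝ, Fin n → ℝ) (fun m' => coordCLM (B.trivAt m) m' (σ m')) m = 0 := by
    rw [gaussManin, frame_eq_flatFrame]
    refine ⟨fun h => ContinuousLinearMap.ext fun v => ?_,
      fun h => (congrArg _ h).trans (ContinuousLinearMap.comp_zero _)⟩
    exact (coordCLM_flatFrame he₀ hm₀ _).symm.trans
      ((congrArg (coordCLM (B.trivAt m) m) (DFunLike.congr_fun h v)).trans (map_zero _))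
  rw [hcentre]
  exact ⟨mfderiv_coordCLM_eq_zero_of_transition he₀ he hU hσ hmU hm₀ hm,
    mfderiv_coordCLM_eq_zero_of_transition he he₀ hU hσ hmU hm hm₀⟩

lemma isFlatOn_flatFrame (he : e ∈ B.atlas) (s : Fin n → ℝ) :
    B.IsFlatOn e.baseSet (fun m => flatFrame e m s) := by
  refine ⟨smoothVOn_flatFrame he s, fun m hm => ?_⟩
  rw [gaussManin_eq_zero_iff he e.open_baseSet (smoothVOn_flatFrame he s) hm hm]
  have hconst : (fun m' => coordCLM e m' (flatFrame e m' s)) =ᶠ[𝓝 m] fun _ => s := by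
    filter_upwards [e.open_baseSet.mem_nhds hm] with m' hm' using coordCLM_flatFrame he hm' s
  rw [hconst.mfderiv_eq]
  exact mfderiv_const

lemma IsFlatOn.eventually_coordCLM_eq (he : e ∈ B.atlas) {U : Set M} (hU : IsOpen U)
    {σ : ∀ m, B.V m} (hσ : B.IsFlatOn U σ) (hmU : m ∈ U) (hm : m ∈ e.baseSet) :
    ∀ᶠ m' in 𝓝 m, coordCLM e m' (σ m') = coordCLM e m (σ m) := by
  refine eventually_eq_of_mfderiv_eq_zero (E := E) (c := fun m' => coordCLM e m' (σ m')) ?_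
  filter_upwards [hU.mem_nhds hmU, e.open_baseSet.mem_nhds hm] with m' hm'U hm'
  exact ⟨(contMDiffAt_coordCLM he hU hσ.1 hm'U hm').mdifferentiableAt (by simp),
    (gaussManin_eq_zero_iff he hU hσ.1 hm'U hm').1 (hσ.2 m' hm'U)⟩

lemma IsFlatOn.eventually_eq_flatFrame (he : e ∈ B.atlas) {U : Set M} (hU : IsOpen U)
    {σ : ∀ m, B.V m} (hσ : B.IsFlatOn U σ) (hmU : m ∈ U) (hm : m ∈ e.baseSet) :
    ∃ s, ∀ᶠ m' in 𝓝 m, σ m' = flatFrame e m' s := by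
  refine ⟨coordCLM e m (σ m), ?_⟩
  filter_upwards [hσ.eventually_coordCLM_eq he hU hmU hm, e.open_baseSet.mem_nhds hm]
    with m' hcoord hm'
  rw [← hcoord, flatFrame_coordCLM he hm']

lemma smoothVDualOn_comp_coordCLM (he : e ∈ B.atlas) (φ : (Fin n → ℝ) →L[ℝ] ℝ) :
    B.SmoothVDualOn e.baseSet (fun m => φ.comp (coordCLM e m)) :=
  fun _ hU' hoU' _ hσ m hm => (φ.contDiff.contMDiff.contMDiffAt.comp m
    (contMDiffAt_coordCLM he hoU' hσ hm (hU' hm))).contMDiffWithinAt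

lemma isFlatDualOn_comp_coordCLM (he : e ∈ B.atlas) (φ : (Fin n → ℝ) →L[ℝ] ℝ) :
    B.IsFlatDualOn e.baseSet (fun m => φ.comp (coordCLM e m)) :=
  fun _ hU' hoU' _ hσ _ hm =>
    (hσ.eventually_coordCLM_eq he hoU' hm (hU' hm)).mono fun _ h => congrArg φ h

lemma IsFlatDualOn.eventually_eq_comp_coordCLM (he : e ∈ B.atlas) {U : Set M} (hU : IsOpen U)
    {θ : ∀ m, B.V m →L[ℝ] ℝ} (hθ : B.IsFlatDualOn U θ) (hmU : m ∈ U) (hm : m ∈ e.baseSet) :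
    ∃ φ : (Fin n → ℝ) →L[ℝ] ℝ, ∀ᶠ m' in 𝓝 m, θ m' = φ.comp (coordCLM e m') := by
  have hbasis (i : Fin n) : ∀ᶠ m' in 𝓝 m, θ m' (flatFrame e m' (Pi.single i 1)) =
      θ m (flatFrame e m (Pi.single i 1)) := by
    have hflat := isFlatOn_flatFrame he (Pi.single i (1 : ℝ))
    exact hθ (U ∩ e.baseSet) inter_subset_left (hU.inter e.open_baseSet) _
      ⟨hflat.1.mono inter_subset_right, fun m' hm' => hflat.2 m' hm'.2⟩ m ⟨hmU, hm⟩
  refine ⟨(θ m).comp (flatFrame e m), ?_⟩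
  filter_upwards [Filter.eventually_all.2 hbasis, e.open_baseSet.mem_nhds hm] with m' hi hm'
  have hframe : (θ m').comp (flatFrame e m') = (θ m).comp (flatFrame e m) :=
    ContinuousLinearMap.coe_injective (LinearMap.pi_ext' fun i => LinearMap.ext_ring (hi i))
  ext u
  rw [← hframe]
  exact congrArg (θ m') (flatFrame_coordCLM he hm' u).symm

end TorusBundle

namespace TorusBundle

section Splitting

variable {n : ℕ} {E : Type*} [NormedAddCommGroup E] [NormedSpace ℝ E]
  {F : Type*} [NormedAddCommGroup F] [NormedSpace ℝ F]
  {M : Type*} [TopologicalSpace M] [ChartedSpace E M]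
  {Z : Type*} [TopologicalSpace Z] [ChartedSpace F Z]
  {B : TorusBundle n E F M Z} {e : Trivialization (StdTorus n) B.proj} {m : M}

lemma param_vertCoord (z : Z) : B.param (B.trivAt (B.proj z)) (B.proj z, B.vertCoord z) = z :=
  param_torusLift (B.mem_baseSet_trivAt _)

lemma inverse_frame_apply (m : M) (u : B.V m) :
    (B.frame m).inverse u = coordCLM (B.trivAt m) m u := by
  have hinv := isInvertible_coordCLM (B.trivAt_mem_atlas m) (B.mem_baseSet_trivAt m)
  rw [frame_eq_flatFrame, flatFrame, hinv.inverse_inverse]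

lemma split_apply_eq (z : Z) (u : B.V (B.proj z)) (v : E) :
    (B.split z (u, v) : F) = B.dParamAt z (v, coordCLM (B.trivAt (B.proj z)) (B.proj z) u) := by
  have hsplit : (B.split z (u, v) : F) =
      B.dParamAt z ((0, (B.frame (B.proj z)).inverse u) + (v, 0)) :=
    (map_add (B.dParamAt z) _ _).symm
  rw [hsplit, inverse_frame_apply]
  exact congrArg (B.dParamAt z) (Prod.ext (zero_add v) (add_zero _))

lemma unsplit_dParamAt (z : Z) (v : E) (s : Fin n → ℝ) :
    B.unsplit z (B.dParamAt z (v, s)) = (flatFrame (B.trivAt (B.proj z)) (B.proj z) s, v) := by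
  refine Prod.ext ?_ ?_
  · rw [← frame_eq_flatFrame]
    exact congrArg (fun x : E × (Fin n → ℝ) => B.frame (B.proj z) x.2)
      ((isInvertible_dParam (B.trivAt_mem_atlas (B.proj z)) (B.mem_baseSet_trivAt (B.proj z))
        (B.vertCoord z)).inverse_apply_self (v, s))
  · have hbase : ∀ z', z' = z → ∀ w : F, (mfderiv 𝓘(ℝ, F) 𝓘(ℝ, E) B.proj z' w : E) =
        mfderiv 𝓘(ℝ, F) 𝓘(ℝ, E) B.proj z w := by
      rintro z' rfl w
      rfl
    exact (hbase _ (param_vertCoord z) _).symm.trans (mfderiv_proj_dParam_apply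
      (B.trivAt_mem_atlas (B.proj z)) (B.mem_baseSet_trivAt (B.proj z)) (B.vertCoord z) s v)

lemma unsplit_split (z : Z) (w : B.VT (B.proj z)) : B.unsplit z (B.split z w) = w :=
  (congrArg (B.unsplit z) (split_apply_eq z w.1 w.2)).trans <| (unsplit_dParamAt z _ _).trans <|
    Prod.ext (flatFrame_coordCLM (B.trivAt_mem_atlas _) (B.mem_baseSet_trivAt _) w.1) rfl

lemma split_unsplit (z : Z) (w : TangentSpace 𝓘(ℝ, F) z) : B.split z (B.unsplit z w) = w := by
  have he := B.trivAt_mem_atlas (B.proj z)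
  have hm := B.mem_baseSet_trivAt (B.proj z)
  obtain ⟨x, rfl⟩ : ∃ x : E × (Fin n → ℝ), B.dParamAt z x = w :=
    ⟨_, (isInvertible_dParam he hm (B.vertCoord z)).self_apply_inverse w⟩
  refine (congrArg (B.split z) (unsplit_dParamAt z x.1 x.2)).trans ?_
  refine (split_apply_eq z _ _).trans ?_
  exact congrArg (B.dParamAt z) (Prod.ext rfl (coordCLM_flatFrame he hm x.2))

/-- The splitting is independent of the trivialization used to define it, because the transition
maps are locally constant automorphisms of the torus. -/
lemma split_flatFrame (he : e ∈ B.atlas) (hm : m ∈ e.baseSet) {z : Z} {ξ : Fin n → ℝ}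
    (hz : B.param e (m, ξ) = z) (v : E) (s : Fin n → ℝ) :
    (B.split z (flatFrame e (B.proj z) s, v) : F) = B.dParam e m ξ (v, s) := by
  obtain rfl : B.proj z = m := hz ▸ B.proj_param hm ξ
  have he' := B.trivAt_mem_atlas (B.proj z)
  have hm' := B.mem_baseSet_trivAt (B.proj z)
  obtain ⟨A, hA⟩ := exists_dParam_transition he he' hm hm'
  have hdParam := hA.self_of_nhds
  have hcoord : coordCLM (B.trivAt (B.proj z)) (B.proj z) (flatFrame e (B.proj z) s) = A s :=
    coordCLM_of_coe_eq he' hm' <| (coe_flatFrame he hm s).trans <|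
      hdParam 0 0 (by rw [B.param_zero he hm, B.param_zero he' hm']) 0 s
  refine (split_apply_eq z _ v).trans ?_
  rw [hcoord]
  exact (hdParam ξ (B.vertCoord z) (hz.trans (param_vertCoord z).symm) v s).symm

end Splitting

section SemiFlat

variable {n : ℕ} {E : Type*} [NormedAddCommGroup E] [NormedSpace ℝ E]
  {F : Type*} [NormedAddCommGroup F] [NormedSpace ℝ F]
  {M : Type*} [TopologicalSpace M] [ChartedSpace E M] [IsManifold 𝓘(ℝ, E) ∞ M]
  {Z : Type*} [TopologicalSpace Z] [ChartedSpace F Z] [IsManifold 𝓘(ℝ, F) ∞ Z]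
  {B : TorusBundle n E F M Z}

lemma AdaptedGACS.isGenComplexLinear_semiFlat (J : B.AdaptedGACS) (z : Z) :
    IsGenComplexLinear (J.semiFlat z) :=
  (J.isGenComplex (B.proj z)).conj_genMap (unsplit_split z) (split_unsplit z)

end SemiFlat

end TorusBundle

section ChartFrame

variable {E : Type*} [NormedAddCommGroup E] [NormedSpace ℝ E]
  {M : Type*} [TopologicalSpace M] [ChartedSpace E M]

/-- The frame of `T_M` at `m` given by the chart of `M` at `c`. -/
def chartFrame (c m : M) : E →L[ℝ] TangentSpace 𝓘(ℝ, E) m :=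
  (mfderiv 𝓘(ℝ, E) 𝓘(ℝ, E) (extChartAt 𝓘(ℝ, E) c).symm (extChartAt 𝓘(ℝ, E) c m) : E →L[ℝ] E)

lemma chartFrame_extChartAt_symm {c : M} {y : E} (hy : y ∈ (extChartAt 𝓘(ℝ, E) c).target) :
    chartFrame (E := E) c ((extChartAt 𝓘(ℝ, E) c).symm y) =
      mfderiv 𝓘(ℝ, E) 𝓘(ℝ, E) (extChartAt 𝓘(ℝ, E) c).symm y := by
  have hbase : ∀ y', y' = y →
      (mfderiv 𝓘(ℝ, E) 𝓘(ℝ, E) (extChartAt 𝓘(ℝ, E) c).symm y' : E →L[ℝ] E) =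
        mfderiv 𝓘(ℝ, E) 𝓘(ℝ, E) (extChartAt 𝓘(ℝ, E) c).symm y := by
    rintro y' rfl
    rfl
  exact hbase _ ((extChartAt 𝓘(ℝ, E) c).right_inv hy)

lemma isInvertible_chartFrame [IsManifold 𝓘(ℝ, E) ∞ M] {c m : M}
    (hm : m ∈ (extChartAt 𝓘(ℝ, E) c).source) : (chartFrame c m : E →L[ℝ] E).IsInvertible :=
  isInvertible_mfderiv (isLocalDiffeomorphAt_extChartAt_symm
    ((extChartAt 𝓘(ℝ, E) c).map_source hm)) (k := ∞) (by simp)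

end ChartFrame

namespace TorusBundle

section LocalFrame

variable {n : ℕ} {E : Type*} [NormedAddCommGroup E] [NormedSpace ℝ E]
  {F : Type*} [NormedAddCommGroup F] [NormedSpace ℝ F]
  {M : Type*} [TopologicalSpace M] [ChartedSpace E M]
  {Z : Type*} [TopologicalSpace Z] [ChartedSpace F Z]
  (B : TorusBundle n E F M Z) {c m : M}

/-- The neighbourhood of `c` over which the local trivialization around `c` and the chart at `c`
are both defined. -/
def coordSource (c : M) : Set M := (extChartAt 𝓘(ℝ, E) c).source ∩ (B.trivAt c).baseSet

/-- The image of `coordSource c` under the chart at `c`. -/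
def coordTarget (c : M) : Set E :=
  (extChartAt 𝓘(ℝ, E) c).target ∩ (extChartAt 𝓘(ℝ, E) c).symm ⁻¹' (B.trivAt c).baseSet

/-- The frame of `V ⊕ T_M` at `m` given by the local trivialization around `c` and the chart
at `c`. The model space `E × ℝⁿ` has the base directions first. -/
def localFrame (c m : M) : E × (Fin n → ℝ) →L[ℝ] B.VT m :=
  ((flatFrame (B.trivAt c) m).comp (.snd ℝ E (Fin n → ℝ))).prod
    ((chartFrame c m).comp (.fst ℝ E (Fin n → ℝ)))

/-- The components of the elements of `V ⊕ T_M` in the frame `localFrame`. -/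
def localCoord (c m : M) : B.VT m →L[ℝ] E × (Fin n → ℝ) :=
  ((chartFrame c m).inverse.comp (.snd ℝ (B.V m) (TangentSpace 𝓘(ℝ, E) m))).prod
    ((coordCLM (B.trivAt c) m).comp (.fst ℝ (B.V m) (TangentSpace 𝓘(ℝ, E) m)))

/-- The frame of `(V ⊕ T_M) ⊕ (V ⊕ T_M)^∨` induced by `localFrame`. -/
def genFrame (c m : M) : (E × (Fin n → ℝ)) × (E × (Fin n → ℝ) →L[ℝ] ℝ) →ₗ[ℝ] B.GenVT m :=
  genMap (B.localFrame c m) (B.localCoord c m)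

/-- The components of the elements of `(V ⊕ T_M) ⊕ (V ⊕ T_M)^∨` in the frame `genFrame`. -/
def genCoord (c m : M) : B.GenVT m →ₗ[ℝ] (E × (Fin n → ℝ)) × (E × (Fin n → ℝ) →L[ℝ] ℝ) :=
  genMap (B.localCoord c m) (B.localFrame c m)

variable {B}

lemma isOpen_coordSource (c : M) : IsOpen (B.coordSource c) :=
  (isOpen_extChartAt_source c).inter (B.trivAt c).open_baseSet

lemma mem_coordSource (c : M) : c ∈ B.coordSource c :=
  ⟨mem_extChartAt_source c, B.mem_baseSet_trivAt c⟩

lemma isOpen_coordTarget (c : M) : IsOpen (B.coordTarget c) :=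
  (continuousOn_extChartAt_symm c).isOpen_inter_preimage (isOpen_extChartAt_target c)
    (B.trivAt c).open_baseSet

lemma extChartAt_mem_coordTarget (hm : m ∈ B.coordSource c) :
    extChartAt 𝓘(ℝ, E) c m ∈ B.coordTarget c :=
  ⟨(extChartAt 𝓘(ℝ, E) c).map_source hm.1,
    (congrArg (· ∈ (B.trivAt c).baseSet) ((extChartAt 𝓘(ℝ, E) c).left_inv hm.1)).mpr hm.2⟩

lemma extChartAt_symm_mem_coordSource {y : E} (hy : y ∈ B.coordTarget c) :
    (extChartAt 𝓘(ℝ, E) c).symm y ∈ B.coordSource c :=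
  ⟨(extChartAt 𝓘(ℝ, E) c).map_target hy.1, hy.2⟩

lemma localFrame_localCoord [IsManifold 𝓘(ℝ, E) ∞ M] (hm : m ∈ B.coordSource c) (w : B.VT m) :
    B.localFrame c m (B.localCoord c m w) = w :=
  Prod.ext (flatFrame_coordCLM (B.trivAt_mem_atlas c) hm.2 w.1)
    ((isInvertible_chartFrame hm.1).self_apply_inverse w.2)

lemma localCoord_localFrame [IsManifold 𝓘(ℝ, E) ∞ M] (hm : m ∈ B.coordSource c)
    (w : E × (Fin n → ℝ)) : B.localCoord c m (B.localFrame c m w) = w :=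
  Prod.ext ((isInvertible_chartFrame hm.1).inverse_apply_self w.1)
    (coordCLM_flatFrame (B.trivAt_mem_atlas c) hm.2 w.2)

lemma genFrame_genCoord [IsManifold 𝓘(ℝ, E) ∞ M] (hm : m ∈ B.coordSource c) (a : B.GenVT m) :
    B.genFrame c m (B.genCoord c m a) = a :=
  genMap_genMap_cancel (localFrame_localCoord hm) a

lemma genCoord_genFrame [IsManifold 𝓘(ℝ, E) ∞ M] (hm : m ∈ B.coordSource c)
    (a : (E × (Fin n → ℝ)) × (E × (Fin n → ℝ) →L[ℝ] ℝ)) :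
    B.genCoord c m (B.genFrame c m a) = a :=
  genMap_genMap_cancel (localCoord_localFrame hm) a

lemma genFrame_fibreIncl (d : (Fin n → ℝ) × ((Fin n → ℝ) →L[ℝ] ℝ)) :
    B.genFrame c m (fibreIncl E (Fin n → ℝ) d) =
      B.ofV m (flatFrame (B.trivAt c) m d.1) (d.2.comp (coordCLM (B.trivAt c) m)) :=
  Prod.ext (Prod.ext rfl (chartFrame c m).map_zero) rfl

lemma basePart_genCoord (a : B.GenVT m) : basePart E (Fin n → ℝ) (B.genCoord c m a) =
    genMap (chartFrame c m).inverse (chartFrame c m) (B.toT m a) :=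
  Prod.ext rfl <| ContinuousLinearMap.ext fun v => congrArg (fun u => a.2 (u, chartFrame c m v))
    (flatFrame (B.trivAt c) m).map_zero

lemma ofV_mem_genV (u : B.V m) (θ : B.V m →L[ℝ] ℝ) : B.ofV m u θ ∈ B.genV m :=
  ⟨rfl, fun _ => θ.map_zero⟩

lemma toT_eq_zero_of_mem_genV {a : B.GenVT m} (ha : a ∈ B.genV m) : B.toT m a = 0 :=
  Prod.ext ha.1 (ContinuousLinearMap.ext ha.2)

lemma basePart_genCoord_eq_zero {a : B.GenVT m} (ha : a ∈ B.genV m) :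
    basePart E (Fin n → ℝ) (B.genCoord c m a) = 0 := by
  rw [basePart_genCoord, toT_eq_zero_of_mem_genV ha, map_zero]

lemma fibrePart_genCoord_eq_zero {a : B.GenVT m} (ha : a ∈ B.genT m) :
    fibrePart E (Fin n → ℝ) (B.genCoord c m a) = 0 := by
  refine Prod.ext ((congrArg (coordCLM (B.trivAt c) m) ha.1).trans (map_zero _)) ?_
  ext1 s
  exact (congrArg (fun v => a.2 (flatFrame (B.trivAt c) m s, v)) (chartFrame c m).map_zero).trans
    (ha.2 _)

lemma genFrame_baseIncl_mem_genT (h : E × (E →L[ℝ] ℝ)) :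
    B.genFrame c m (baseIncl E (Fin n → ℝ) h) ∈ B.genT m :=
  ⟨(flatFrame (B.trivAt c) m).map_zero, fun _ =>
    (congrArg h.2 (chartFrame c m).inverse.map_zero).trans h.2.map_zero⟩

end LocalFrame

section ModelInFrame

variable {n : ℕ} {E : Type*} [NormedAddCommGroup E] [NormedSpace ℝ E]
  {F : Type*} [NormedAddCommGroup F] [NormedSpace ℝ F]
  {M : Type*} [TopologicalSpace M] [ChartedSpace E M] [IsManifold 𝓘(ℝ, E) ∞ M]
  {Z : Type*} [TopologicalSpace Z] [ChartedSpace F Z] [IsManifold 𝓘(ℝ, F) ∞ Z]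
  {B : TorusBundle n E F M Z} (J : B.AdaptedGACS)

/-- An adapted structure at `m` in the frame `genFrame`. -/
def AdaptedGACS.inFrame (c m : M) : (E × (Fin n → ℝ)) × (E × (Fin n → ℝ) →L[ℝ] ℝ) →ₗ[ℝ]
    (E × (Fin n → ℝ)) × (E × (Fin n → ℝ) →L[ℝ] ℝ) :=
  B.genCoord c m ∘ₗ J.J m ∘ₗ B.genFrame c m

/-- The restriction `V ⊕ V^∨ → T_M ⊕ T_M^∨` at `m` of an adapted structure in the frame
`genFrame`. -/
def AdaptedGACS.imageInFrame (c m : M) :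
    (Fin n → ℝ) × ((Fin n → ℝ) →L[ℝ] ℝ) →L[ℝ] E × (E →L[ℝ] ℝ) :=
  ((basePart E (Fin n → ℝ)).toLinearMap ∘ₗ J.inFrame c m ∘ₗ
    (fibreIncl E (Fin n → ℝ)).toLinearMap).toContinuousLinearMap

/-- The image under an adapted structure of the flat section of `V ⊕ V^∨` with components `d` in the
local trivialization around `c`. -/
def AdaptedGACS.flatImage (c : M) (d : (Fin n → ℝ) × ((Fin n → ℝ) →L[ℝ] ℝ)) (m : M) :
    GenTangent E m :=
  J.image (fun m => flatFrame (B.trivAt c) m d.1) (fun m => d.2.comp (coordCLM (B.trivAt c) m)) m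

variable {J} {c m : M}

lemma AdaptedGACS.imageInFrame_apply (d : (Fin n → ℝ) × ((Fin n → ℝ) →L[ℝ] ℝ)) :
    J.imageInFrame c m d =
      genMap (chartFrame c m).inverse (chartFrame c m) (J.flatImage c d m) := by
  refine (basePart_genCoord (J.J m (B.genFrame c m (fibreIncl E (Fin n → ℝ) d)))).trans ?_
  rw [genFrame_fibreIncl]
  rfl

lemma AdaptedGACS.inFrame_fibreIncl (d : (Fin n → ℝ) × ((Fin n → ℝ) →L[ℝ] ℝ)) :
    J.inFrame c m (fibreIncl E (Fin n → ℝ) d) =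
      baseIncl E (Fin n → ℝ) (J.imageInFrame c m d) := by
  have himage : J.J m (B.genFrame c m (fibreIncl E (Fin n → ℝ) d)) ∈ B.genT m := by
    rw [← J.adapted m, genFrame_fibreIncl]
    exact Submodule.mem_map_of_mem (ofV_mem_genV _ _)
  refine (fibreIncl_fibrePart_add_baseIncl_basePart _).symm.trans ?_
  rw [AdaptedGACS.inFrame, LinearMap.comp_apply, LinearMap.comp_apply,
    fibrePart_genCoord_eq_zero himage, map_zero, zero_add]
  rfl

lemma AdaptedGACS.isSemiFlatModel_inFrame (hm : m ∈ B.coordSource c) :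
    IsSemiFlatModel (J.inFrame c m) (J.imageInFrame c m) where
  isGenComplexLinear :=
    (J.isGenComplex m).conj_genMap (localFrame_localCoord hm) (localCoord_localFrame hm)
  apply_fibreIncl := inFrame_fibreIncl
  surjective h := by
    have hmem : B.genFrame c m (baseIncl E (Fin n → ℝ) h) ∈ B.genT m :=
      genFrame_baseIncl_mem_genT h
    rw [← J.adapted m] at hmem
    obtain ⟨b, hb, hJb⟩ := hmem
    have hfibre : fibreIncl E (Fin n → ℝ) (fibrePart E (Fin n → ℝ) (B.genCoord c m b)) =
        B.genCoord c m b := by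
      conv_rhs => rw [← fibreIncl_fibrePart_add_baseIncl_basePart (B.genCoord c m b),
        basePart_genCoord_eq_zero hb, map_zero, add_zero]
    refine ⟨fibrePart E (Fin n → ℝ) (B.genCoord c m b), baseIncl_injective (R := Fin n → ℝ) ?_⟩
    rw [← inFrame_fibreIncl, hfibre, AdaptedGACS.inFrame, LinearMap.comp_apply,
      LinearMap.comp_apply, genFrame_genCoord hm, hJb, genCoord_genFrame hm]

end ModelInFrame

section ChartImage

variable {n : ℕ} {E : Type*} [NormedAddCommGroup E] [NormedSpace ℝ E]
  {F : Type*} [NormedAddCommGroup F] [NormedSpace ℝ F]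
  {M : Type*} [TopologicalSpace M] [ChartedSpace E M] [IsManifold 𝓘(ℝ, E) ∞ M]
  {Z : Type*} [TopologicalSpace Z] [ChartedSpace F Z] [IsManifold 𝓘(ℝ, F) ∞ Z]
  {B : TorusBundle n E F M Z} {J : B.AdaptedGACS} {c m : M} {y : E}

variable (J) in
/-- `imageInFrame` at the point with coordinates `y` in the chart at `c`. -/
def AdaptedGACS.chartImage (c : M) (y : E) :
    (Fin n → ℝ) × ((Fin n → ℝ) →L[ℝ] ℝ) →L[ℝ] E × (E →L[ℝ] ℝ) :=
  J.imageInFrame c ((extChartAt 𝓘(ℝ, E) c).symm y)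

lemma AdaptedGACS.genPullback_flatImage (hy : y ∈ (extChartAt 𝓘(ℝ, E) c).target)
    (d : (Fin n → ℝ) × ((Fin n → ℝ) →L[ℝ] ℝ)) :
    genPullback E (extChartAt 𝓘(ℝ, E) c).symm (J.flatImage c d) y = J.chartImage c y d := by
  rw [chartImage, imageInFrame_apply, chartFrame_extChartAt_symm hy]
  rfl

lemma AdaptedGACS.eventually_isSemiFlatModel (hy : y ∈ B.coordTarget c) :
    ∀ᶠ y in 𝓝 y, IsSemiFlatModel (J.inFrame c ((extChartAt 𝓘(ℝ, E) c).symm y))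
      (J.chartImage c y) := by
  filter_upwards [(isOpen_coordTarget c).mem_nhds hy] with y hy
  exact isSemiFlatModel_inFrame (extChartAt_symm_mem_coordSource hy)

variable [FiniteDimensional ℝ E]

lemma smoothGenSectionAt_zero (m : M) :
    SmoothGenSectionAt (fun m : M => (0 : GenTangent E m)) m := by
  have hpullback : genPullback E (extChartAt 𝓘(ℝ, E) m).symm (fun m : M => (0 : GenTangent E m)) =
      fun _ => 0 :=
    funext fun _ => (genMap _ _).map_zero
  rw [← extChartAt_to_inv (I := 𝓘(ℝ, E)) m]
  refine smoothGenSectionAt_of_genPullback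
    (isLocalDiffeomorphAt_extChartAt_symm (mem_extChartAt_target m)) ?_
  rw [hpullback]
  exact smoothGenSectionAt_iff_contDiffAt.2 contDiffAt_const

lemma AdaptedGACS.smoothGenSectionAt_flatImage (hm : m ∈ (B.trivAt c).baseSet)
    (d : (Fin n → ℝ) × ((Fin n → ℝ) →L[ℝ] ℝ)) : SmoothGenSectionAt (J.flatImage c d) m := by
  have hopen := (B.trivAt c).open_baseSet
  refine (smoothGenSectionOn_iff hopen).1 (J.smooth _ hopen _
    ⟨smoothVOn_flatFrame (B.trivAt_mem_atlas c) d.1,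
      smoothVDualOn_comp_coordCLM (B.trivAt_mem_atlas c) d.2,
      (smoothGenSectionOn_iff hopen).2 fun m _ => ?_⟩).2.2 m hm
  simp only [toT_eq_zero_of_mem_genV (ofV_mem_genV _ _)]
  exact smoothGenSectionAt_zero m

lemma AdaptedGACS.contDiffAt_chartImage (hy : y ∈ B.coordTarget c) :
    ContDiffAt ℝ ∞ (J.chartImage c) y := by
  refine (contMDiffAt_clm_of_apply fun d => ?_).contDiffAt
  refine (((smoothGenSectionAt_flatImage (J := J) hy.2 d).contDiffAt_genPullback
    (isLocalDiffeomorphAt_extChartAt_symm hy.1)).congr_of_eventuallyEq ?_).contMDiffAt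
  filter_upwards [(isOpen_coordTarget c).mem_nhds hy] with y hy
  exact (genPullback_flatImage hy.1 d).symm

end ChartImage

section CoordMap

variable {n : ℕ} {E : Type*} [NormedAddCommGroup E] [NormedSpace ℝ E]
  {F : Type*} [NormedAddCommGroup F] [NormedSpace ℝ F]
  {M : Type*} [TopologicalSpace M] [ChartedSpace E M]
  {Z : Type*} [TopologicalSpace Z] [ChartedSpace F Z]
  {B : TorusBundle n E F M Z} {c : M} {x : E × (Fin n → ℝ)}

variable (B) in
/-- The parametrization of `Z` by `E × ℝⁿ` given by the chart at `c` and the local trivialization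
around `c`. -/
def coordMap (c : M) (x : E × (Fin n → ℝ)) : Z :=
  B.param (B.trivAt c) ((extChartAt 𝓘(ℝ, E) c).symm x.1, x.2)

lemma proj_coordMap (hx : x.1 ∈ B.coordTarget c) :
    B.proj (B.coordMap c x) = (extChartAt 𝓘(ℝ, E) c).symm x.1 :=
  B.proj_param hx.2 x.2

lemma proj_coordMap_mem_coordSource (hx : x.1 ∈ B.coordTarget c) :
    B.proj (B.coordMap c x) ∈ B.coordSource c :=
  (proj_coordMap hx).symm ▸ extChartAt_symm_mem_coordSource hx

lemma eventually_mem_coordTarget (hx : x.1 ∈ B.coordTarget c) :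
    ∀ᶠ y in 𝓝 x, y.1 ∈ B.coordTarget c :=
  continuousAt_fst.eventually ((isOpen_coordTarget c).mem_nhds hx)

lemma exists_coordMap_eq {z : Z} (hz : B.proj z ∈ B.coordSource c) :
    ∃ x : E × (Fin n → ℝ), x.1 ∈ B.coordTarget c ∧ B.coordMap c x = z := by
  refine ⟨(extChartAt 𝓘(ℝ, E) c (B.proj z), torusLift (B.trivAt c z).2),
    extChartAt_mem_coordTarget hz, ?_⟩
  rw [coordMap, (extChartAt 𝓘(ℝ, E) c).left_inv hz.1]
  exact param_torusLift hz.2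

variable [IsManifold 𝓘(ℝ, E) ∞ M]

lemma isLocalDiffeomorphAt_extChartAt_symm_prod {R : Type*} [NormedAddCommGroup R]
    [NormedSpace ℝ R] {x : E × R} (hx : x.1 ∈ (extChartAt 𝓘(ℝ, E) c).target) :
    IsLocalDiffeomorphAt 𝓘(ℝ, E × R) (𝓘(ℝ, E).prod 𝓘(ℝ, R)) ∞
      (fun x : E × R => ((extChartAt 𝓘(ℝ, E) c).symm x.1, x.2)) x :=
  ⟨{ toPartialEquiv := (extChartAt 𝓘(ℝ, E) c).symm.prod (PartialEquiv.refl R)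
     open_source := (isOpen_extChartAt_target c).prod isOpen_univ
     open_target := (isOpen_extChartAt_source c).prod isOpen_univ
     contMDiffOn_toFun :=
       ((contMDiffOn_extChartAt_symm c).comp contDiff_fst.contMDiff.contMDiffOn
         fun _ hx => hx.1).prodMk contDiff_snd.contMDiff.contMDiffOn
     contMDiffOn_invFun := by
       have hchart : ContMDiffOn 𝓘(ℝ, E) 𝓘(ℝ, E) ∞ (extChartAt 𝓘(ℝ, E) c)
           (extChartAt 𝓘(ℝ, E) c).source := by
         simpa [extChartAt_source] using contMDiffOn_extChartAt (I := 𝓘(ℝ, E)) (x := c) (n := ∞)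
       exact (hchart.comp contMDiffOn_fst fun _ hx => hx.1).prodMk_space contMDiffOn_snd },
    ⟨hx, mem_univ _⟩, fun _ _ => rfl⟩

lemma isLocalDiffeomorphAt_coordMap (hx : x.1 ∈ B.coordTarget c) :
    IsLocalDiffeomorphAt 𝓘(ℝ, E × (Fin n → ℝ)) 𝓘(ℝ, F) ∞ (B.coordMap c) x :=
  IsLocalDiffeomorphAt.comp _ _ (isLocalDiffeomorphAt_extChartAt_symm_prod hx.1)
    (isLocalDiffeomorphAt_param (B.trivAt_mem_atlas c) hx.2 x.2)

lemma mfderiv_coordMap_apply (hx : x.1 ∈ B.coordTarget c) (w : E × (Fin n → ℝ)) :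
    (mfderiv 𝓘(ℝ, E × (Fin n → ℝ)) 𝓘(ℝ, F) (B.coordMap c) x w : F) =
      B.dParam (B.trivAt c) ((extChartAt 𝓘(ℝ, E) c).symm x.1) x.2
        (chartFrame c ((extChartAt 𝓘(ℝ, E) c).symm x.1) w.1, w.2) := by
  rw [chartFrame_extChartAt_symm hx.1]
  have hbase : HasMFDerivAt 𝓘(ℝ, E × (Fin n → ℝ)) 𝓘(ℝ, E)
      ((extChartAt 𝓘(ℝ, E) c).symm ∘ Prod.fst) x _ :=
    HasMFDerivAt.comp x
      ((isLocalDiffeomorphAt_extChartAt_symm hx.1).mdifferentiableAt (by simp)).hasMFDerivAt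
      (ContinuousLinearMap.fst ℝ E (Fin n → ℝ)).hasMFDerivAt
  have hcomp := HasMFDerivAt.comp (g := B.param (B.trivAt c)) x
    ((isLocalDiffeomorphAt_param (B.trivAt_mem_atlas c) hx.2 x.2).mdifferentiableAt
      (by simp)).hasMFDerivAt
    (hbase.prodMk (ContinuousLinearMap.snd ℝ E (Fin n → ℝ)).hasMFDerivAt)
  exact DFunLike.congr_fun hcomp.mfderiv w

lemma split_localFrame (hx : x.1 ∈ B.coordTarget c) (w : E × (Fin n → ℝ)) :
    B.split (B.coordMap c x) (B.localFrame c (B.proj (B.coordMap c x)) w) =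
      mfderiv 𝓘(ℝ, E × (Fin n → ℝ)) 𝓘(ℝ, F) (B.coordMap c) x w := by
  have hchart : ∀ m, m = (extChartAt 𝓘(ℝ, E) c).symm x.1 →
      (chartFrame c m w.1 : E) = chartFrame c ((extChartAt 𝓘(ℝ, E) c).symm x.1) w.1 := by
    rintro m rfl
    rfl
  refine (split_flatFrame (B.trivAt_mem_atlas c) hx.2 rfl _ w.2).trans
    ((mfderiv_coordMap_apply hx w).trans ?_).symm
  exact congrArg (fun v : E => B.dParam (B.trivAt c) _ x.2 (v, w.2))
    (hchart _ (proj_coordMap hx)).symm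

lemma genPullback_fromBase (hx : x.1 ∈ B.coordTarget c) (a : ∀ z, B.GenVT (B.proj z)) :
    genPullback (E × (Fin n → ℝ)) (B.coordMap c) (fun z => B.fromBase z (a z)) x =
      B.genCoord c (B.proj (B.coordMap c x)) (a (B.coordMap c x)) := by
  refine Prod.ext ?_ (ContinuousLinearMap.ext fun w => ?_)
  · have hsplit := split_localFrame hx (B.localCoord c _ (a (B.coordMap c x)).1)
    rw [localFrame_localCoord (proj_coordMap_mem_coordSource hx)] at hsplit
    exact (congrArg (mfderiv 𝓘(ℝ, E × (Fin n → ℝ)) 𝓘(ℝ, F) (B.coordMap c) x).inverse hsplit).trans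
      ((isInvertible_mfderiv (isLocalDiffeomorphAt_coordMap hx) (by simp)).inverse_apply_self _)
  · have hunsplit := congrArg (B.unsplit (B.coordMap c x)) (split_localFrame hx w)
    rw [unsplit_split] at hunsplit
    exact congrArg (a (B.coordMap c x)).2 hunsplit.symm

variable [IsManifold 𝓘(ℝ, F) ∞ Z] {J : B.AdaptedGACS}

lemma AdaptedGACS.genPullback_semiFlat (hx : x.1 ∈ B.coordTarget c)
    (a : ∀ z : Z, GenTangent F z) :
    genPullback (E × (Fin n → ℝ)) (B.coordMap c) (fun z => J.semiFlat z (a z)) x =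
      J.inFrame c ((extChartAt 𝓘(ℝ, E) c).symm x.1)
        (genPullback (E × (Fin n → ℝ)) (B.coordMap c) a x) := by
  have ha : (fun z => B.fromBase z (B.toBase z (a z))) = a :=
    funext fun z => genMap_genMap_cancel (split_unsplit z) (a z)
  have hpullback := genPullback_fromBase hx fun z => B.toBase z (a z)
  rw [ha] at hpullback
  refine (genPullback_fromBase hx fun z => J.J (B.proj z) (B.toBase z (a z))).trans ?_
  rw [hpullback, AdaptedGACS.inFrame, ← proj_coordMap hx, LinearMap.comp_apply,
    LinearMap.comp_apply, genFrame_genCoord (proj_coordMap_mem_coordSource hx)]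

lemma AdaptedGACS.semiFlat_apply_eq_iff (hx : x.1 ∈ B.coordTarget c)
    {a b : ∀ z : Z, GenTangent F z} :
    J.semiFlat (B.coordMap c x) (a (B.coordMap c x)) = b (B.coordMap c x) ↔
      J.inFrame c ((extChartAt 𝓘(ℝ, E) c).symm x.1)
          (genPullback (E × (Fin n → ℝ)) (B.coordMap c) a x) =
        genPullback (E × (Fin n → ℝ)) (B.coordMap c) b x := by
  rw [← genPullback_semiFlat hx]
  refine ⟨fun h => congrArg (genMap _ _) h, fun h => ?_⟩
  exact genPullback_injective (isLocalDiffeomorphAt_coordMap hx) h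

lemma AdaptedGACS.inPlusEigenbundle_semiFlat_iff (hx : x.1 ∈ B.coordTarget c)
    {a : ComplexGenSection F Z} :
    InPlusEigenbundle J.semiFlat a (B.coordMap c x) ↔
      J.inFrame c ((extChartAt 𝓘(ℝ, E) c).symm x.1)
          (genPullback (E × (Fin n → ℝ)) (B.coordMap c) a.re x) =
        -genPullback (E × (Fin n → ℝ)) (B.coordMap c) a.im x := by
  rw [← genPullback_neg, ← semiFlat_apply_eq_iff hx]
  refine ⟨And.left, fun hre => ⟨hre, ?_⟩⟩
  have hsq := (J.isGenComplexLinear_semiFlat (B.coordMap c x)).1 (a.re (B.coordMap c x))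
  rw [hre] at hsq
  exact neg_injective ((map_neg _ _).symm.trans hsq)

end CoordMap

end TorusBundle

section Locality

variable {E : Type*} [NormedAddCommGroup E] [NormedSpace ℝ E]
  {M : Type*} [TopologicalSpace M] [ChartedSpace E M] {x : M}

lemma contractExtDeriv_congr {X X' : ∀ y : M, TangentSpace 𝓘(ℝ, E) y}
    {η η' : ∀ y : M, TangentSpace 𝓘(ℝ, E) y →L[ℝ] ℝ} (hX : X x = X' x)
    (hη : ∀ᶠ y in 𝓝 x, η y = η' y) : contractExtDeriv X η x = contractExtDeriv X' η' x := by
  have hchart : oneFormInChart η x =ᶠ[𝓝 (extChartAt 𝓘(ℝ, E) x x)] oneFormInChart η' x := by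
    have hcont := continuousAt_extChartAt_symm (I := 𝓘(ℝ, E)) x
    rw [ContinuousAt, extChartAt_to_inv] at hcont
    filter_upwards [hcont.eventually hη] with u hu
    rw [oneFormInChart, oneFormInChart, hu]
  rw [contractExtDeriv, contractExtDeriv, hchart.fderiv_eq, hX]

lemma lieDerivOneForm_congr {X X' : ∀ y : M, TangentSpace 𝓘(ℝ, E) y}
    {η η' : ∀ y : M, TangentSpace 𝓘(ℝ, E) y →L[ℝ] ℝ} (hX : ∀ᶠ y in 𝓝 x, X y = X' y)
    (hη : ∀ᶠ y in 𝓝 x, η y = η' y) : lieDerivOneForm X η x = lieDerivOneForm X' η' x := by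
  have hpairing : (fun y => η y (X y)) =ᶠ[𝓝 x] fun y => η' y (X' y) := by
    filter_upwards [hX, hη] with y hXy hηy
    rw [hXy, hηy]
  rw [lieDerivOneForm, lieDerivOneForm, contractExtDeriv_congr hX.self_of_nhds hη, dFun, dFun,
    hpairing.mfderiv_eq]

lemma courantBracket_congr {a a' b b' : ∀ y : M, GenTangent E y}
    (ha : ∀ᶠ y in 𝓝 x, a y = a' y) (hb : ∀ᶠ y in 𝓝 x, b y = b' y) :
    courantBracket a b x = courantBracket a' b' x := by
  have hfst {c c' : ∀ y : M, GenTangent E y} (hc : ∀ᶠ y in 𝓝 x, c y = c' y) :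
      ∀ᶠ y in 𝓝 x, (c y).1 = (c' y).1 := hc.mono fun _ h => congrArg Prod.fst h
  have hsnd {c c' : ∀ y : M, GenTangent E y} (hc : ∀ᶠ y in 𝓝 x, c y = c' y) :
      ∀ᶠ y in 𝓝 x, (c y).2 = (c' y).2 := hc.mono fun _ h => congrArg Prod.snd h
  have hpairing : (fun y => (a y).2 (b y).1 - (b y).2 (a y).1) =ᶠ[𝓝 x]
      fun y => (a' y).2 (b' y).1 - (b' y).2 (a' y).1 := by
    filter_upwards [ha, hb] with y hay hby
    rw [hay, hby]
  have hlie := Filter.EventuallyEq.mlieBracket_vectorField_eq (I := 𝓘(ℝ, E)) (hfst ha) (hfst hb)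
  rw [courantBracket, courantBracket, hlie, lieDerivOneForm_congr (hfst ha) (hsnd hb),
    lieDerivOneForm_congr (hfst hb) (hsnd ha), dFun, dFun, hpairing.mfderiv_eq]

end Locality

namespace TorusBundle

section FlatBracket

variable {n : ℕ} {E : Type*} [NormedAddCommGroup E] [NormedSpace ℝ E] [FiniteDimensional ℝ E]
  {F : Type*} [NormedAddCommGroup F] [NormedSpace ℝ F]
  {M : Type*} [TopologicalSpace M] [ChartedSpace E M] [IsManifold 𝓘(ℝ, E) ∞ M]
  {Z : Type*} [TopologicalSpace Z] [ChartedSpace F Z] [IsManifold 𝓘(ℝ, F) ∞ Z]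
  {B : TorusBundle n E F M Z} {J : B.AdaptedGACS} {c : M} {y : E}

lemma AdaptedGACS.fderiv_genPullback_flatImage (hy : y ∈ B.coordTarget c)
    (d : (Fin n → ℝ) × ((Fin n → ℝ) →L[ℝ] ℝ)) :
    fderiv ℝ (genPullback E (extChartAt 𝓘(ℝ, E) c).symm (J.flatImage c d)) y =
      (fderiv ℝ (J.chartImage c) y).flip d := by
  have hflat : genPullback E (extChartAt 𝓘(ℝ, E) c).symm (J.flatImage c d) =ᶠ[𝓝 y]
      fun y => J.chartImage c y d := by
    filter_upwards [(isOpen_coordTarget c).mem_nhds hy] with y hy using genPullback_flatImage hy.1 d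
  rw [hflat.fderiv_eq]
  ext1 v
  rw [fderiv_clm_apply ((contDiffAt_chartImage hy).differentiableAt (by simp))
    (differentiableAt_const d)]
  simp

lemma AdaptedGACS.genPullback_courantBracket_flatImage (hy : y ∈ B.coordTarget c)
    (d d' : (Fin n → ℝ) × ((Fin n → ℝ) →L[ℝ] ℝ)) :
    genPullback E (extChartAt 𝓘(ℝ, E) c).symm
        (courantBracket (J.flatImage c d) (J.flatImage c d')) y =
      frameBracket (J.chartImage c) y d d' := by
  rw [genPullback_courantBracket (isLocalDiffeomorphAt_extChartAt_symm hy.1)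
    (smoothGenSectionAt_flatImage hy.2 d) (smoothGenSectionAt_flatImage hy.2 d'),
    fderiv_genPullback_flatImage hy, fderiv_genPullback_flatImage hy,
    genPullback_flatImage hy.1, genPullback_flatImage hy.1, frameBracket]

lemma AdaptedGACS.courantBracket_flatImage_eq_zero_iff
    {d d' : (Fin n → ℝ) × ((Fin n → ℝ) →L[ℝ] ℝ)} :
    courantBracket (J.flatImage c d) (J.flatImage c d') c = 0 ↔
      frameBracket (J.chartImage c) (extChartAt 𝓘(ℝ, E) c c) d d' = 0 := by
  rw [← genPullback_courantBracket_flatImage (extChartAt_mem_coordTarget (mem_coordSource c))]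
  have hzero : genPullback E (extChartAt 𝓘(ℝ, E) c).symm (fun m : M => (0 : GenTangent E m))
      (extChartAt 𝓘(ℝ, E) c c) = 0 := (genMap _ _).map_zero
  refine ⟨fun h => ?_, fun h => ?_⟩
  · rw [← hzero, genPullback, genPullback, extChartAt_to_inv, h]
  · have hbracket := genPullback_injective
      (isLocalDiffeomorphAt_extChartAt_symm (mem_extChartAt_target c)) (h.trans hzero.symm)
    rwa [extChartAt_to_inv] at hbracket

lemma AdaptedGACS.bracketsVanish_iff_frameBracket_eq_zero :
    J.BracketsVanish ↔
      ∀ c d d', frameBracket (J.chartImage c) (extChartAt 𝓘(ℝ, E) c c) d d' = 0 := by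
  refine ⟨fun hJ c d d' => courantBracket_flatImage_eq_zero_iff.1 ?_,
    fun hJ U hU σ σ' θ θ' hσ hθ hσ' hθ' c hcU => ?_⟩
  · have he := B.trivAt_mem_atlas c
    exact hJ _ (B.trivAt c).open_baseSet _ _ _ _ (isFlatOn_flatFrame he d.1)
      (isFlatDualOn_comp_coordCLM he d.2) (isFlatOn_flatFrame he d'.1)
      (isFlatDualOn_comp_coordCLM he d'.2) c (B.mem_baseSet_trivAt c)
  · have himage {σ : ∀ m, B.V m} {θ : ∀ m, B.V m →L[ℝ] ℝ} (hσ : B.IsFlatOn U σ)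
        (hθ : B.IsFlatDualOn U θ) : ∃ d, ∀ᶠ m in 𝓝 c, J.image σ θ m = J.flatImage c d m := by
      obtain ⟨s, hs⟩ :=
        hσ.eventually_eq_flatFrame (B.trivAt_mem_atlas c) hU hcU (B.mem_baseSet_trivAt c)
      obtain ⟨φ, hφ⟩ :=
        hθ.eventually_eq_comp_coordCLM (B.trivAt_mem_atlas c) hU hcU (B.mem_baseSet_trivAt c)
      refine ⟨(s, φ), ?_⟩
      filter_upwards [hs, hφ] with m hsm hφm
      rw [image, flatImage, image, hsm, hφm]
    obtain ⟨d, hd⟩ := himage hσ hθ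
    obtain ⟨d', hd'⟩ := himage hσ' hθ'
    rw [courantBracket_congr hd hd']
    exact courantBracket_flatImage_eq_zero_iff.2 (hJ c d d')

end FlatBracket

section Eigensections

variable {n : ℕ} {E : Type*} [NormedAddCommGroup E] [NormedSpace ℝ E]
  {F : Type*} [NormedAddCommGroup F] [NormedSpace ℝ F]
  {M : Type*} [TopologicalSpace M] [ChartedSpace E M] [IsManifold 𝓘(ℝ, E) ∞ M]
  {Z : Type*} [TopologicalSpace Z] [ChartedSpace F Z] [IsManifold 𝓘(ℝ, F) ∞ Z]
  {B : TorusBundle n E F M Z} {J : B.AdaptedGACS} {c : M} {x : E × (Fin n → ℝ)}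
  {d d' : (Fin n → ℝ) × ((Fin n → ℝ) →L[ℝ] ℝ)}

variable (B) in
/-- The component in `V ⊕ V^∨` of a section of `T_Z ⊕ T_Z^∨`, as a function of the coordinates
given by `coordMap`. -/
def fibreComponent (c : M) (a : ∀ z : Z, GenTangent F z) (x : E × (Fin n → ℝ)) :
    (Fin n → ℝ) × ((Fin n → ℝ) →L[ℝ] ℝ) :=
  fibrePart E (Fin n → ℝ) (genPullback (E × (Fin n → ℝ)) (B.coordMap c) a x)

variable (J) in
/-- The section `J d + i d` of the `+i`-eigenbundle of a semi-flat structure `J`, for `d` a section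
of `V ⊕ V^∨` which is constant in the frame around `c`. -/
def AdaptedGACS.eigensection (c : M) (d : (Fin n → ℝ) × ((Fin n → ℝ) →L[ℝ] ℝ)) :
    ComplexGenSection F Z where
  re z := J.semiFlat z (B.fromBase z (B.genFrame c (B.proj z) (fibreIncl E (Fin n → ℝ) d)))
  im z := B.fromBase z (B.genFrame c (B.proj z) (fibreIncl E (Fin n → ℝ) d))

lemma AdaptedGACS.genPullback_eigensection_im (hx : x.1 ∈ B.coordTarget c) :
    genPullback (E × (Fin n → ℝ)) (B.coordMap c) (J.eigensection c d).im x =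
      fibreIncl E (Fin n → ℝ) d :=
  (genPullback_fromBase hx fun z => B.genFrame c (B.proj z) (fibreIncl E (Fin n → ℝ) d)).trans
    (genCoord_genFrame (proj_coordMap_mem_coordSource hx) _)

lemma AdaptedGACS.genPullback_eigensection_re (hx : x.1 ∈ B.coordTarget c) :
    genPullback (E × (Fin n → ℝ)) (B.coordMap c) (J.eigensection c d).re x =
      baseIncl E (Fin n → ℝ) (J.chartImage c x.1 d) := by
  refine (genPullback_semiFlat hx (J.eigensection c d).im).trans ?_
  rw [genPullback_eigensection_im hx, inFrame_fibreIncl, chartImage]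

lemma AdaptedGACS.fibreComponent_eigensection_im (hx : x.1 ∈ B.coordTarget c) :
    B.fibreComponent c (J.eigensection c d).im x = d := by
  rw [fibreComponent, genPullback_eigensection_im hx, fibrePart_fibreIncl]

lemma AdaptedGACS.fibreComponent_eigensection_re (hx : x.1 ∈ B.coordTarget c) :
    B.fibreComponent c (J.eigensection c d).re x = 0 := by
  rw [fibreComponent, genPullback_eigensection_re hx, fibrePart_baseIncl]

variable [FiniteDimensional ℝ E] [FiniteDimensional ℝ F]

lemma AdaptedGACS.inPlusEigenbundle_complexCourantBracket_iff (hx : x.1 ∈ B.coordTarget c)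
    {U : Set Z} (hU : IsOpen U) (hxU : B.coordMap c x ∈ U) {a b : ComplexGenSection F Z}
    (ha : IsSectionOfPlusEigenbundle J.semiFlat U a)
    (hb : IsSectionOfPlusEigenbundle J.semiFlat U b) :
    InPlusEigenbundle J.semiFlat (complexCourantBracket a b) (B.coordMap c x) ↔
      J.inFrame c ((extChartAt 𝓘(ℝ, E) c).symm x.1) (baseIncl E (Fin n → ℝ)
          (frameBracket (J.chartImage c) x.1
              (B.fibreComponent c a.im x) (B.fibreComponent c b.im x)
            - frameBracket (J.chartImage c) x.1
              (B.fibreComponent c a.re x) (B.fibreComponent c b.re x))) =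
        baseIncl E (Fin n → ℝ)
          (frameBracket (J.chartImage c) x.1
              (B.fibreComponent c a.im x) (B.fibreComponent c b.re x)
            + frameBracket (J.chartImage c) x.1
              (B.fibreComponent c a.re x) (B.fibreComponent c b.im x)) := by
  have hf := isLocalDiffeomorphAt_coordMap hx
  have hsmooth {s : ∀ z : Z, GenTangent F z} (hs : SmoothGenSectionOn U s) :
      SmoothGenSectionAt s (B.coordMap c x) := (smoothGenSectionOn_iff hU).1 hs _ hxU
  have hdiff {s : ∀ z : Z, GenTangent F z} (hs : SmoothGenSectionOn U s) :
      DifferentiableAt ℝ (genPullback (E × (Fin n → ℝ)) (B.coordMap c) s) x :=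
    ((hsmooth hs).contDiffAt_genPullback hf).differentiableAt (by simp)
  have heigen {a : ComplexGenSection F Z} (ha : IsSectionOfPlusEigenbundle J.semiFlat U a) :
      ∀ᶠ y in 𝓝 x, J.inFrame c ((extChartAt 𝓘(ℝ, E) c).symm y.1)
          (genPullback (E × (Fin n → ℝ)) (B.coordMap c) a.re y) =
        -genPullback (E × (Fin n → ℝ)) (B.coordMap c) a.im y := by
    filter_upwards [eventually_mem_coordTarget hx,
      hf.contMDiffAt.continuousAt.eventually (hU.mem_nhds hxU)] with y hy hyU
      using (inPlusEigenbundle_semiFlat_iff hy).1 (ha.2.2 _ hyU)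
  rw [inPlusEigenbundle_semiFlat_iff hx, complexCourantBracket, genPullback_sub, genPullback_add,
    genPullback_courantBracket hf (hsmooth ha.1) (hsmooth hb.1),
    genPullback_courantBracket hf (hsmooth ha.2.1) (hsmooth hb.2.1),
    genPullback_courantBracket hf (hsmooth ha.1) (hsmooth hb.2.1),
    genPullback_courantBracket hf (hsmooth ha.2.1) (hsmooth hb.1)]
  exact apply_jetBracket_eigensections_iff
    (J := fun y => J.inFrame c ((extChartAt 𝓘(ℝ, E) c).symm y))
    ((contDiffAt_chartImage hx).differentiableAt (by simp)) (eventually_isSemiFlatModel hx)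
    (hdiff ha.1) (hdiff ha.2.1) (hdiff hb.1) (hdiff hb.2.1) (heigen ha) (heigen hb)

lemma smoothGenSectionOn_of_contDiffAt_genPullback {a : ∀ z : Z, GenTangent F z}
    (ha : ∀ x : E × (Fin n → ℝ), x.1 ∈ B.coordTarget c →
      ContDiffAt ℝ ∞ (genPullback (E × (Fin n → ℝ)) (B.coordMap c) a) x) :
    SmoothGenSectionOn (B.proj ⁻¹' B.coordSource c) a := by
  refine (smoothGenSectionOn_iff
    ((isOpen_coordSource c).preimage B.contMDiff_proj.continuous)).2 fun z hz => ?_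
  obtain ⟨x, hx, rfl⟩ := exists_coordMap_eq hz
  exact smoothGenSectionAt_of_genPullback (isLocalDiffeomorphAt_coordMap hx)
    (smoothGenSectionAt_iff_contDiffAt.2 (ha x hx))

lemma AdaptedGACS.isSectionOfPlusEigenbundle_eigensection :
    IsSectionOfPlusEigenbundle J.semiFlat (B.proj ⁻¹' B.coordSource c) (J.eigensection c d) := by
  refine ⟨smoothGenSectionOn_of_contDiffAt_genPullback fun x hx => ?_,
    smoothGenSectionOn_of_contDiffAt_genPullback fun x hx => ?_,
    fun z _ => ⟨(J.isGenComplexLinear_semiFlat z).1 _, rfl⟩⟩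
  · have hbase : ContDiffAt ℝ ∞ (fun y : E × (Fin n → ℝ) =>
        baseIncl E (Fin n → ℝ) (J.chartImage c y.1 d)) x :=
      (baseIncl E (Fin n → ℝ)).contDiff.contDiffAt.comp x
        ((ContDiffAt.comp x (contDiffAt_chartImage hx) contDiffAt_fst).clm_apply contDiffAt_const)
    refine hbase.congr_of_eventuallyEq ?_
    filter_upwards [eventually_mem_coordTarget hx] with y hy using genPullback_eigensection_re hy
  · refine (contDiffAt_const (c := fibreIncl E (Fin n → ℝ) d)).congr_of_eventuallyEq ?_
    filter_upwards [eventually_mem_coordTarget hx] with y hy using genPullback_eigensection_im hy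

lemma AdaptedGACS.frameBracket_eq_zero_of_isIntegrableGen (hJ : IsIntegrableGen J.semiFlat) :
    frameBracket (J.chartImage c) (extChartAt 𝓘(ℝ, E) c c) d d' = 0 := by
  have hx : ((extChartAt 𝓘(ℝ, E) c c, 0) : E × (Fin n → ℝ)).1 ∈ B.coordTarget c :=
    extChartAt_mem_coordTarget (mem_coordSource c)
  have hU : IsOpen (B.proj ⁻¹' B.coordSource c) :=
    (isOpen_coordSource c).preimage B.contMDiff_proj.continuous
  have hxU := proj_coordMap_mem_coordSource hx
  have hd : IsSectionOfPlusEigenbundle J.semiFlat _ (J.eigensection c d) :=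
    isSectionOfPlusEigenbundle_eigensection
  have hd' : IsSectionOfPlusEigenbundle J.semiFlat _ (J.eigensection c d') :=
    isSectionOfPlusEigenbundle_eigensection
  have hbracket := (inPlusEigenbundle_complexCourantBracket_iff hx hU hxU hd hd').1
    (hJ _ hU _ _ hd hd' _ hxU)
  simp only [fibreComponent_eigensection_im hx, fibreComponent_eigensection_re hx,
    frameBracket_zero_left, frameBracket_zero_right, sub_zero, add_zero, map_zero] at hbracket
  have hsq := (isSemiFlatModel_inFrame (J := J)
    (extChartAt_symm_mem_coordSource hx)).isGenComplexLinear.1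
    (baseIncl E (Fin n → ℝ) (frameBracket (J.chartImage c) (extChartAt 𝓘(ℝ, E) c c) d d'))
  rw [hbracket, map_zero] at hsq
  exact baseIncl_injective (R := Fin n → ℝ) ((neg_eq_zero.1 hsq.symm).trans (map_zero _).symm)

theorem AdaptedGACS.isIntegrableGen_semiFlat_iff_frameBracket_eq_zero :
    IsIntegrableGen J.semiFlat ↔
      ∀ c d d', frameBracket (J.chartImage c) (extChartAt 𝓘(ℝ, E) c c) d d' = 0 := by
  refine ⟨fun hJ c d d' => frameBracket_eq_zero_of_isIntegrableGen hJ,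
    fun hJ U hU a b ha hb z hz => ?_⟩
  have hx : ((extChartAt 𝓘(ℝ, E) (B.proj z) (B.proj z), B.vertCoord z) : E × (Fin n → ℝ)).1 ∈
      B.coordTarget (B.proj z) := extChartAt_mem_coordTarget (mem_coordSource _)
  have hz_eq : B.coordMap (B.proj z)
      (extChartAt 𝓘(ℝ, E) (B.proj z) (B.proj z), B.vertCoord z) = z := by
    rw [coordMap, extChartAt_to_inv]
    exact param_vertCoord z
  rw [← hz_eq] at hz
  have hiff := inPlusEigenbundle_complexCourantBracket_iff hx hU hz ha hb
  simp only [hJ, sub_zero, add_zero, map_zero, iff_true] at hiff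
  rwa [hz_eq] at hiff

end Eigensections

end TorusBundle

end

theorem mainTheorem3 {n : ℕ}
    {E : Type*} [NormedAddCommGroup E] [NormedSpace ℝ E] [FiniteDimensional ℝ E]
    (hE : Module.finrank ℝ E = n)
    {F : Type*} [NormedAddCommGroup F] [NormedSpace ℝ F] [FiniteDimensional ℝ F]
    {M : Type*} [TopologicalSpace M] [ChartedSpace E M] [IsManifold 𝓘(ℝ, E) ∞ M]
    {Z : Type*} [TopologicalSpace Z] [ChartedSpace F Z] [IsManifold 𝓘(ℝ, F) ∞ Z]
    (B : TorusBundle n E F M Z) (J : B.AdaptedGACS) :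
    IsIntegrableGen J.semiFlat ↔ J.BracketsVanish :=
  TorusBundle.AdaptedGACS.isIntegrableGen_semiFlat_iff_frameBracket_eq_zero.trans
    TorusBundle.AdaptedGACS.bracketsVanish_iff_frameBracket_eq_zero.symm
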